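/- **Setting.** Let $N\ge 3$, let indices $n$ run over $\mathbb Z/N\mathbb Z$, and let $k_n,\ell_n$ be positive integers with $k_{n-1}k_{n+1}=\ell_{n-1}\ell_{n+1}$ for all $n$. Let $H^2=\bigoplus_n\big(\mathbb Z H_n\oplus\bigoplus_{-\ell_n\le i\le k_n,\ i\ne0}\mathbb Z E_n^i\big)$, let $H_2$ be the lattice with the corresponding basis $h_n,e_n^i$, and pair them by $\langle H_m,h_n\rangle=\delta_{mn}$, $\langle E_m^i,e_n^j\rangle=-\delta_{mn}\delta_{ij}$, all other pairings of basis elements being $0$. For $-\ell_n<i<k_n$ put $\alpha_n^0=H_n-E_n^1-E_n^{-1}$, $\check\alpha_n^0=h_{n-1}+h_{n+1}-e_n^1-e_n^{-1}$, $\alpha_n^{\pm i}=E_n^{\pm i}-E_n^{\pm(i+1)}$, $\check\alpha_n^{\pm i}=e_n^{\pm i}-e_n^{\pm(i+1)}$ ($i>0$). The Weyl group $W$ is generated by the reflections $s_n^i(\Lambda)=\Lambda+\langle\Lambda,\check\alpha_n^i\rangle\alpha_n^i$ of $H^2$, and $M=W\cdot\{E_n^i\}$. Let $\mathbb K$ be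 the field generated over $\mathbb C$ by independent variables $a_n^i$ ($-\ell_n<i<k_n$) and their fractional powers, and let $L=\mathbb K(\tau)$ be the field of rational functions over $\mathbb K$ in indeterminates $\tau_n^i$ ($-\ell_n\le i\le k_n$, $i\neq0$). Put $$u_n=\frac{\big(a_n^0\prod_{j=1}^{\ell_n-1}(a_n^{-j})^{1-j/\ell_n}\big)^{\ell_n/(k_n+\ell_n)}}{\big(\prod_{i=1}^{k_n-1}(a_n^i)^{1-i/k_n}\big)^{k_n/(k_n+\ell_n)}},\qquad v_n=\frac{\big(a_n^0\prod_{i=1}^{k_n-1}(a_n^i)^{1-i/k_n}\big)^{k_n/(k_n+\ell_n)}}{\big(\prod_{j=1}^{\ell_n-1}(a_n^{-j})^{1-j/\ell_n}\big)^{\ell_n/(k_n+\ell_n)}},$$ and $u_n^1=u_n$, $u_n^i=a_n^{i-1}u_n^{i-1}$, $v_n^{-1}=v_n$, $v_n^{-j}=a_n^{-j+1}v_n^{-j+1}$ ($i,j\ge2$). In $(\mathbb P^1)^N$ over $\mathbb K$ with coordinates $f_n=\zeta_n^0/\zeta_n^\infty$ let $$C_n^i=\{f_{n-1}=0,\ f_n=-u_n^i,\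 f_{n+1}=\infty\}\ (1\le i\le k_n),\quad C_n^{-j}=\{f_{n-1}=\infty,\ f_n=-1/v_n^{-j},\ f_{n+1}=0\}\ (1\le j\le\ell_n).$$ Put $\theta_n^0=k_{n+1}+\ell_{n-1}$, $\theta_n^\infty=k_{n-1}+\ell_{n+1}$, $\omega_n=\theta_n^0/(\theta_n^0+\theta_n^\infty)$, $\xi_n=\prod_{i=1}^{k_n}\tau_n^i$, $\eta_n=\prod_{j=1}^{\ell_n}\tau_n^{-j}$. Let $s_n^i$ act on $L$ over $\mathbb C$ by $s_n^i(a_m^j)=a_m^j(a_n^i)^{\langle\alpha_m^j,\check\alpha_n^i\rangle}$ (also on fractional powers) and $$s_n^0(\tau_n^1)=\frac{v_n^{\omega_n}\xi_{n+1}\eta_{n-1}+v_n^{-1+\omega_n}\xi_{n-1}\eta_{n+1}}{\tau_n^{-1}},\qquad s_n^0(\tau_n^{-1})=\frac{u_n^{-\omega_n}\xi_{n+1}\eta_{n-1}+u_n^{1-\omega_n}\xi_{n-1}\eta_{n+1}}{\tau_n^{1}},$$ while $s_n^{\pm i}$ ($i>0$) exchanges $\tau_n^{\pm i}$ and $\tau_n^{\pm(i+1)}$,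 and all other $\tau_m^j$ are fixed. (Superscripts on $\tau_n,a_n,u_n^{i},v_n^{-j},E_n$ are indices, but the exponents on the parameters $u_n$ and $v_n$ in these two formulas are powers.) The $\tau$-function $\tau:M\to L$ is defined by $\tau(E_n^i)=\tau_n^i$ and $\tau(w.\Lambda)=w.\tau(\Lambda)$ for $w\in W$. For $\Lambda=\sum d_nH_n-\sum\mu_n^iE_n^i\in M$, a *normalized defining polynomial* $\Phi_\Lambda=\sum_mA_m\zeta^m\in\mathbb K[\zeta]$ is a nonzero multihomogeneous polynomial of multidegree $d=(d_n)$ with multiplicity exactly $\max(\mu_n^i,0)$ along each $C_n^i$, such that every $A_m=\sum_xc_{m,x}a^x$ is a finite sum of monic monomials $a^x$ (rational exponents) with integral multiplicities $c_{m,x}$, is a single monic monomial for each of the corner monomials $\zeta^m=\prod_n(\zeta_n^{\varepsilon_n})^{d_n}$, $\varepsilon_n\in\{0,\infty\}$, and $$\prod_{m,x}(a^x)^{c_{m,x}(1/\theta)^m}=1,\qquad(1/\theta)^m=\prod_n(1/\theta_n^0)^{m_n^0}(1/\theta_n^\infty)^{m_n^\infty}.$$ **Theorem.** The action of the generators $s_n^i$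 on $L$ extends to an action of $W$ by field automorphisms and the $\tau$-function exists. For every $\Lambda=\sum d_nH_n-\sum\mu_n^iE_n^i\in M$ the forms of multidegree $d$ with multiplicity at least $\mu_n^i$ along every $C_n^i$ are a one-dimensional $\mathbb K$-vector space (so the hypersurface is unique), there is exactly one normalized defining polynomial $\Phi_\Lambda$, and $$\tau(\Lambda)\prod_{n,i}(\tau_n^i)^{\mu_n^i}=\Phi_\Lambda(\zeta)\qquad\text{with }\ \zeta_n^0=\xi_{n+1}\eta_{n-1},\quad\zeta_n^\infty=\xi_{n-1}\eta_{n+1}.$$ In particular every $\tau(\Lambda)$ is a Laurent polynomial in the $\tau_n^i$ with coefficients in $\mathbb K$. -/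

import Mathlib

open scoped BigOperators

noncomputable section

/-- The discrete data: `N ≥ 3` and two `N`-periodic sequences `k`, `ℓ` of positive integers. The
suffix `n` lives in `ℤ/Nℤ`. -/
structure TropicalDatum where
  N : ℕ
  three_le : 3 ≤ N
  k : ZMod N → ℕ
  ℓ : ZMod N → ℕ
  k_pos : ∀ n, 0 < k n
  ℓ_pos : ∀ n, 0 < ℓ n

namespace TropicalDatum

instance instNeZeroN (T : TropicalDatum) : NeZero T.N :=
  ⟨by have := T.three_le; omega⟩

/-- Indices `(n, i)` of the centers `C_n^i`: `-ℓ_n ≤ i ≤ k_n`, `i ≠ 0`. -/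
abbrev Center (T : TropicalDatum) : Type :=
  Σ n : ZMod T.N, ↥((Finset.Icc (-(T.ℓ n : ℤ)) (T.k n : ℤ)).erase 0)

/-- Indices `(n, i)` of the simple roots `α_n^i`: `-ℓ_n + 1 ≤ i ≤ k_n - 1`. -/
abbrev Root (T : TropicalDatum) : Type :=
  Σ n : ZMod T.N, ↥(Finset.Icc (-(T.ℓ n : ℤ) + 1) ((T.k n : ℤ) - 1))

variable (T : TropicalDatum)

/-! ### The Néron-Severi bilattice and the Weyl group -/

/-- `H²(X, ℤ)`, with basis `H_n`, `E_n^i`: the pair `(d, ε)` is `∑ d_n H_n + ∑ ε_n^i E_n^i`. -/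
abbrev NS : Type := (ZMod T.N → ℤ) × (T.Center → ℤ)

/-- `H_2(X, ℤ)`, with basis `h_n`, `e_n^i`: the pair `(d, ε)` is `∑ d_n h_n + ∑ ε_n^i e_n^i`. -/
abbrev Curves : Type := (ZMod T.N → ℤ) × (T.Center → ℤ)

/-- The class `H_n`; also the class `h_n`. -/
def H (n : ZMod T.N) : T.NS := (Pi.single n 1, 0)

/-- The class `E_n^i`; also the class `e_n^i` (used only for `-ℓ_n ≤ i ≤ k_n`, `i ≠ 0`). -/
def E (n : ZMod T.N) (i : ℤ) : T.NS :=
  (0, fun c => if c.1 = n ∧ (c.2 : ℤ) = i then 1 else 0)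

/-- The intersection pairing with a fixed element of `H_2`:
`⟨H_m, h_n⟩ = δ_{mn}`, `⟨E_m^i, e_n^j⟩ = -δ_{mn} δ_{ij}`, other pairings zero. -/
def pairing (γ : T.Curves) : T.NS →ₗ[ℤ] ℤ where
  toFun Λ := ∑ n, Λ.1 n * γ.1 n - ∑ c, Λ.2 c * γ.2 c
  map_add' x y := by
    simp only [Prod.fst_add, Prod.snd_add, Pi.add_apply, add_mul, Finset.sum_add_distrib]
    ring
  map_smul' a x := by
    simp only [Prod.smul_fst, Prod.smul_snd, Pi.smul_apply, smul_eq_mul, mul_assoc,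
      ← Finset.mul_sum, RingHom.id_apply, mul_sub]

/-- The simple roots: `α_n^0 = H_n - E_n^1 - E_n^{-1}`, `α_n^i = E_n^i - E_n^{i+1}` for `i > 0`,
`α_n^{-j} = E_n^{-j} - E_n^{-j-1}` for `j > 0`. -/
def α (r : T.Root) : T.NS :=
  if (r.2 : ℤ) = 0 then T.H r.1 - T.E r.1 1 - T.E r.1 (-1)
  else if 0 < (r.2 : ℤ) then T.E r.1 r.2 - T.E r.1 (r.2 + 1)
  else T.E r.1 r.2 - T.E r.1 (r.2 - 1)

/-- The simple coroots: `α̌_n^0 = h_{n-1} + h_{n+1} - e_n^1 - e_n^{-1}`,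
`α̌_n^i = e_n^i - e_n^{i+1}` for `i > 0`, `α̌_n^{-j} = e_n^{-j} - e_n^{-j-1}` for `j > 0`. -/
def coα (r : T.Root) : T.Curves :=
  if (r.2 : ℤ) = 0 then T.H (r.1 - 1) + T.H (r.1 + 1) - T.E r.1 1 - T.E r.1 (-1)
  else if 0 < (r.2 : ℤ) then T.E r.1 r.2 - T.E r.1 (r.2 + 1)
  else T.E r.1 r.2 - T.E r.1 (r.2 - 1)

theorem one_ne : (1 : ZMod T.N) ≠ 0 := by
  have h3 := T.three_le
  intro h
  have h' : ((1 : ℕ) : ZMod T.N) = 0 := by exact_mod_cast h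
  rw [ZMod.natCast_eq_zero_iff] at h'
  have := Nat.le_of_dvd one_pos h'
  omega

theorem sub_one_ne (n : ZMod T.N) : n - 1 ≠ n := by
  intro h; exact T.one_ne (by simpa using h)

theorem add_one_ne (n : ZMod T.N) : n + 1 ≠ n := by
  intro h; exact T.one_ne (by simpa using h)

/-- `(n, i)` as the index of a center. -/
def ctr (n : ZMod T.N) (i : ℤ) (h : i ≠ 0 ∧ -(T.ℓ n : ℤ) ≤ i ∧ i ≤ T.k n) : T.Center :=
  ⟨n, ⟨i, by simpa [Finset.mem_erase, Finset.mem_Icc] using h⟩⟩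

theorem E_ctr (n : ZMod T.N) (i : ℤ) (h) :
    T.E n i = (0, Pi.single (T.ctr n i h) 1) := by
  unfold E
  congr 1
  funext c
  rw [Pi.single_apply]
  congr 1
  apply propext
  constructor
  · rintro ⟨rfl, rfl⟩
    rfl
  · rintro rfl
    exact ⟨rfl, rfl⟩

theorem ctr_ne (n : ZMod T.N) (i j : ℤ) (h h') (hij : i ≠ j) :
    T.ctr n i h ≠ T.ctr n j h' := by
  intro e
  simp only [ctr, Sigma.mk.injEq, heq_eq_eq, Subtype.mk.injEq, true_and] at e
  exact hij e

theorem pairing_self (r : T.Root) : T.pairing (T.coα r) (T.α r) = -2 := by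
  have hr := Finset.mem_Icc.1 r.2.2
  have hk := T.k_pos r.1
  have hl := T.ℓ_pos r.1
  have key : ∀ (c c' : T.Center), c ≠ c' → ∀ x y : ZMod T.N → ℤ,
      (∑ n, x n * y n = 0) →
      T.pairing (y, Pi.single c 1 - Pi.single c' 1) (x, Pi.single c 1 - Pi.single c' 1) = -2 := by
    intro c c' hc x y hxy
    simp only [pairing, LinearMap.coe_mk, AddHom.coe_mk, hxy, Pi.sub_apply, sub_mul, mul_sub,
      Finset.sum_sub_distrib]
    simp [Pi.single_apply, hc, hc.symm]
  unfold α coα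
  split_ifs with h0 h1
  · rw [T.E_ctr r.1 1 ⟨by omega, by omega, by omega⟩,
      T.E_ctr r.1 (-1) ⟨by omega, by omega, by omega⟩]
    have hne := T.ctr_ne r.1 1 (-1) ⟨by omega, by omega, by omega⟩
      ⟨by omega, by omega, by omega⟩ (by omega)
    simp only [pairing, LinearMap.coe_mk, AddHom.coe_mk, H, Prod.mk_sub_mk, Prod.mk_add_mk,
      Pi.sub_apply, Pi.add_apply, Pi.zero_apply, sub_mul, mul_sub, mul_add,
      Finset.sum_sub_distrib, Finset.sum_add_distrib]
    simp [Pi.single_apply, hne, hne.symm, T.one_ne]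
  · rw [T.E_ctr r.1 r.2 ⟨by omega, by omega, by omega⟩,
      T.E_ctr r.1 (r.2 + 1) ⟨by omega, by omega, by omega⟩]
    rw [Prod.mk_sub_mk]
    exact key _ _ (T.ctr_ne _ _ _ _ _ (by omega)) _ _ (by simp)
  · rw [T.E_ctr r.1 r.2 ⟨by omega, by omega, by omega⟩,
      T.E_ctr r.1 (r.2 - 1) ⟨by omega, by omega, by omega⟩]
    rw [Prod.mk_sub_mk]
    exact key _ _ (T.ctr_ne _ _ _ _ _ (by omega)) _ _ (by simp)

/-- The simple reflection `s_n^i(Λ) = Λ + ⟨Λ, α̌_n^i⟩ α_n^i` on `H²(X, ℤ)`. -/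
def s (r : T.Root) : T.NS ≃ₗ[ℤ] T.NS :=
  LinearEquiv.ofInvolutive
    (LinearMap.id + (T.pairing (T.coα r)).smulRight (T.α r))
    (by
      intro Λ
      simp only [LinearMap.add_apply, LinearMap.id_apply, LinearMap.smulRight_apply, map_add,
        map_smul, T.pairing_self]
      module)

/-- The Weyl group `W`, generated by the simple reflections. -/
def W : Subgroup (T.NS ≃ₗ[ℤ] T.NS) := Subgroup.closure (Set.range T.s)

/-- The simple reflections as elements of `W`. -/
def sW (r : T.Root) : T.W := ⟨T.s r, Subgroup.subset_closure ⟨r, rfl⟩⟩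

/-- The Weyl orbit `M = W.{E_n^i}` of the classes of exceptional divisors. -/
def M : Set T.NS := {Λ | ∃ w ∈ T.W, ∃ c : T.Center, Λ = w (T.E c.1 c.2)}

/-! ### The coefficient field and the multiplicative root variables -/

/-- Finite sums of monomials `a^x` in fractional powers of the multiplicative root variables
`a_n^i`, with coefficients in `R`; the exponents `x` are vectors of rational numbers. -/
abbrev Puiseux (R : Type) [CommRing R] : Type := AddMonoidAlgebra R (T.Root → ℚ)

/-- The field `𝕂 = ⋃_p ℂ(a^{1/p})` generated over `ℂ` by the independent variables `a_n^i` and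
their fractional powers. -/
abbrev K : Type := FractionRing (T.Puiseux ℂ)

/-- The monic monomial `a^x`. -/
def mono (x : T.Root → ℚ) : T.K :=
  algebraMap (T.Puiseux ℂ) T.K (AddMonoidAlgebra.single x 1)

/-- The action on exponents of `a_m^j ↦ a_m^j (a_n^i)^{⟨α_m^j, α̌_n^i⟩}`. -/
def expAct (r : T.Root) : (T.Root → ℚ) ≃+ (T.Root → ℚ) where
  toFun x := x + Pi.single r (∑ t, x t * (T.pairing (T.coα r) (T.α t) : ℚ))
  invFun x := x + Pi.single r (∑ t, x t * (T.pairing (T.coα r) (T.α t) : ℚ))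
  left_inv x := by
    have h : ((T.pairing (T.coα r) (T.α r) : ℤ) : ℚ) = -2 := by rw [T.pairing_self]; norm_num
    simp only [Pi.add_apply, add_mul, Finset.sum_add_distrib, Pi.single_apply, ite_mul, zero_mul,
      Finset.sum_ite_eq', Finset.mem_univ, if_true, h]
    rw [add_assoc, ← Pi.single_add]
    convert add_zero x using 2
    rw [← Pi.single_zero r]
    congr 1
    ring
  right_inv x := by
    have h : ((T.pairing (T.coα r) (T.α r) : ℤ) : ℚ) = -2 := by rw [T.pairing_self]; norm_num
    simp only [Pi.add_apply, add_mul, Finset.sum_add_distrib, Pi.single_apply, ite_mul, zero_mul,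
      Finset.sum_ite_eq', Finset.mem_univ, if_true, h]
    rw [add_assoc, ← Pi.single_add]
    convert add_zero x using 2
    rw [← Pi.single_zero r]
    congr 1
    ring
  map_add' x y := by
    simp only [Pi.add_apply, add_mul, Finset.sum_add_distrib, Pi.single_add]
    abel

/-- The action of `s_n^i` on `𝕂`, determined by `s_n^i(a_n^i) = 1/a_n^i`,
`s_n^i(a_n^{i±1}) = a_n^i a_n^{i±1}`, `s_n^0(a_{n±1}^0) = a_n^0 a_{n±1}^0`, the other root variables
being fixed; that is, by `s_n^i(a_m^j) = a_m^j (a_n^i)^{⟨α_m^j, α̌_n^i⟩}`. -/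
def sK (r : T.Root) : T.K ≃+* T.K :=
  IsFractionRing.ringEquivOfRingEquiv
    (AddMonoidAlgebra.domCongr ℂ ℂ (T.expAct r)).toRingEquiv

/-- The exponent vector of `u_n^1 = u_n`, where, with `A = ∏_{0<i<k_n} (a_n^i)^{1-i/k_n}` and
`B = ∏_{0<j<ℓ_n} (a_n^{-j})^{1-j/ℓ_n}`,
`u_n = (a_n^0 B)^{ℓ_n/(k_n+ℓ_n)} / A^{k_n/(k_n+ℓ_n)}`. -/
def uExp (n : ZMod T.N) : T.Root → ℚ := fun r =>
  if r.1 ≠ n then 0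
  else if (r.2 : ℤ) = 0 then (T.ℓ n : ℚ) / (T.k n + T.ℓ n)
  else if 0 < (r.2 : ℤ) then -((1 - (r.2 : ℤ) / T.k n) * (T.k n / (T.k n + T.ℓ n)))
  else (1 + (r.2 : ℤ) / T.ℓ n) * (T.ℓ n / (T.k n + T.ℓ n))

/-- The exponent vector of `v_n^{-1} = v_n`, where, with `A`, `B` as for `u_n`,
`v_n = (a_n^0 A)^{k_n/(k_n+ℓ_n)} / B^{ℓ_n/(k_n+ℓ_n)}`. -/
def vExp (n : ZMod T.N) : T.Root → ℚ := fun r =>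
  if r.1 ≠ n then 0
  else if (r.2 : ℤ) = 0 then (T.k n : ℚ) / (T.k n + T.ℓ n)
  else if 0 < (r.2 : ℤ) then (1 - (r.2 : ℤ) / T.k n) * (T.k n / (T.k n + T.ℓ n))
  else -((1 + (r.2 : ℤ) / T.ℓ n) * (T.ℓ n / (T.k n + T.ℓ n)))

/-- The parameter `u_n^i = a_n^{i-1} ⋯ a_n^1 u_n` of the center `C_n^i`, `i > 0`. -/
def u (n : ZMod T.N) (i : ℤ) : T.K :=
  T.mono (T.uExp n + fun r => if r.1 = n ∧ 0 < (r.2 : ℤ) ∧ (r.2 : ℤ) < i then 1 else 0)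

/-- The inverse `1 / v_n^{i}` of the parameter `v_n^{-j} = a_n^{-j+1} ⋯ a_n^{-1} v_n` of the
center `C_n^{i}`, `i = -j < 0`. -/
def vInv (n : ZMod T.N) (i : ℤ) : T.K :=
  (T.mono (T.vExp n + fun r => if r.1 = n ∧ (r.2 : ℤ) < 0 ∧ i < (r.2 : ℤ) then 1 else 0))⁻¹

/-! ### The field of `τ`-variables -/

/-- The field `L = 𝕂(τ)` of rational functions in the indeterminates `τ_n^i`. -/
abbrev L : Type := FractionRing (MvPolynomial T.Center T.K)

/-- The inclusion of the coefficient field `𝕂` in `L`. -/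
def const : T.K →+* T.L :=
  (algebraMap (MvPolynomial T.Center T.K) T.L).comp MvPolynomial.C

/-- The indeterminate attached to a center. -/
def tauVar (c : T.Center) : T.L :=
  algebraMap (MvPolynomial T.Center T.K) T.L (MvPolynomial.X c)

/-- The indeterminate `τ_n^i` (by convention `1` where there is no center `C_n^i`; this value is
never used). -/
def tau (n : ZMod T.N) (i : ℤ) : T.L :=
  if h : i ≠ 0 ∧ -(T.ℓ n : ℤ) ≤ i ∧ i ≤ T.k n then T.tauVar (T.ctr n i h) else 1

/-- `ξ_n = ∏_{i=1}^{k_n} τ_n^i`. -/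
def ξ (n : ZMod T.N) : T.L := ∏ i ∈ Finset.Icc 1 (T.k n), T.tau n i

/-- `η_n = ∏_{j=1}^{ℓ_n} τ_n^{-j}`. -/
def η (n : ZMod T.N) : T.L := ∏ j ∈ Finset.Icc 1 (T.ℓ n), T.tau n (-j)

/-- `θ_n^0 = k_{n+1} + ℓ_{n-1}`. -/
def θ0 (n : ZMod T.N) : ℚ := T.k (n + 1) + T.ℓ (n - 1)

/-- `θ_n^∞ = k_{n-1} + ℓ_{n+1}`. -/
def θinf (n : ZMod T.N) : ℚ := T.k (n - 1) + T.ℓ (n + 1)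

/-- `ω_n = θ_n^0 / (θ_n^0 + θ_n^∞)`. -/
def ω (n : ZMod T.N) : ℚ := T.θ0 n / (T.θ0 n + T.θinf n)

/-- `v_n^{ω_n} ξ_{n+1} η_{n-1} + v_n^{-1+ω_n} ξ_{n-1} η_{n+1}`. -/
def Fv (n : ZMod T.N) : T.L :=
  T.const (T.mono (T.ω n • T.vExp n)) * (T.ξ (n + 1) * T.η (n - 1)) +
    T.const (T.mono ((-1 + T.ω n) • T.vExp n)) * (T.ξ (n - 1) * T.η (n + 1))

/-- `u_n^{-ω_n} ξ_{n+1} η_{n-1} + u_n^{1-ω_n} ξ_{n-1} η_{n+1}`. -/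
def Fu (n : ZMod T.N) : T.L :=
  T.const (T.mono ((-T.ω n) • T.uExp n)) * (T.ξ (n + 1) * T.η (n - 1)) +
    T.const (T.mono ((1 - T.ω n) • T.uExp n)) * (T.ξ (n - 1) * T.η (n + 1))

/-- The values `s_n^i(τ_m^j)`. -/
def sTau (r : T.Root) (c : T.Center) : T.L :=
  if c.1 ≠ r.1 then T.tau c.1 c.2
  else if (r.2 : ℤ) = 0 then
    if (c.2 : ℤ) = 1 then T.Fv r.1 / T.tau r.1 (-1)
    else if (c.2 : ℤ) = -1 then T.Fu r.1 / T.tau r.1 1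
    else T.tau c.1 c.2
  else if 0 < (r.2 : ℤ) then
    if (c.2 : ℤ) = r.2 then T.tau r.1 (r.2 + 1)
    else if (c.2 : ℤ) = r.2 + 1 then T.tau r.1 r.2
    else T.tau c.1 c.2
  else
    if (c.2 : ℤ) = r.2 then T.tau r.1 (r.2 - 1)
    else if (c.2 : ℤ) = r.2 - 1 then T.tau r.1 r.2
    else T.tau c.1 c.2

theorem tau_center (c : T.Center) : T.tau c.1 c.2 = T.tauVar c := by
  have h := c.2.2
  rw [Finset.mem_erase, Finset.mem_Icc] at h
  rw [tau, dif_pos ⟨h.1, h.2.1, h.2.2⟩]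
  rfl

theorem tau_ctr (n : ZMod T.N) (i : ℤ) (h) : T.tau n i = T.tauVar (T.ctr n i h) := by
  rw [tau, dif_pos h]

theorem tauVar_ne_zero (c : T.Center) : T.tauVar c ≠ 0 := by
  unfold tauVar
  simp

theorem tau_ne_zero (n : ZMod T.N) (i : ℤ) : T.tau n i ≠ 0 := by
  unfold tau
  split_ifs
  · exact T.tauVar_ne_zero _
  · exact one_ne_zero

theorem const_eq (x : T.K) : T.const x = algebraMap T.K T.L x := by
  rw [const, RingHom.comp_apply, ← MvPolynomial.algebraMap_eq,
    ← IsScalarTower.algebraMap_apply]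

theorem mono_add_mono_ne_zero (x y : T.Root → ℚ) : T.mono x + T.mono y ≠ 0 := by
  unfold mono
  rw [← map_add, Ne, IsFractionRing.to_map_eq_zero_iff]
  intro h
  have := congrArg (fun p : T.Puiseux ℂ => p.coeff x) h
  by_cases hxy : y = x
  · subst hxy
    norm_num at this
  · simp [hxy] at this

/-- Polynomials in the `τ`-variables with value `1` where all `τ`-variables are `1`. -/
def oneSub : Submonoid T.L where
  carrier := {x | ∃ P : MvPolynomial T.Center T.K,
    algebraMap _ T.L P = x ∧ MvPolynomial.eval 1 P = 1}
  mul_mem' := by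
    rintro _ _ ⟨P, rfl, hP⟩ ⟨Q, rfl, hQ⟩
    exact ⟨P * Q, map_mul _ _ _, by rw [map_mul, hP, hQ, one_mul]⟩
  one_mem' := ⟨1, map_one _, map_one _⟩

theorem tau_mem_oneSub (n : ZMod T.N) (i : ℤ) : T.tau n i ∈ T.oneSub := by
  unfold tau
  split_ifs
  · exact ⟨_, rfl, by simp⟩
  · exact T.oneSub.one_mem

theorem binomial_ne_zero (x y : T.Root → ℚ) (p q : T.L) (hp : p ∈ T.oneSub) (hq : q ∈ T.oneSub) :
    T.const (T.mono x) * p + T.const (T.mono y) * q ≠ 0 := by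
  obtain ⟨P, rfl, hP⟩ := hp
  obtain ⟨Q, rfl, hQ⟩ := hq
  simp only [const, RingHom.comp_apply]
  rw [← map_mul, ← map_mul, ← map_add, Ne, IsFractionRing.to_map_eq_zero_iff]
  intro h
  have := congrArg (MvPolynomial.eval 1) h
  rw [map_add, map_mul, map_mul, MvPolynomial.eval_C, MvPolynomial.eval_C, hP, hQ, mul_one,
    mul_one, map_zero] at this
  exact T.mono_add_mono_ne_zero x y this

theorem ξ_mem_oneSub (n : ZMod T.N) : T.ξ n ∈ T.oneSub :=
  T.oneSub.prod_mem fun _ _ => T.tau_mem_oneSub _ _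

theorem η_mem_oneSub (n : ZMod T.N) : T.η n ∈ T.oneSub :=
  T.oneSub.prod_mem fun _ _ => T.tau_mem_oneSub _ _

theorem Fu_ne_zero (n : ZMod T.N) : T.Fu n ≠ 0 :=
  T.binomial_ne_zero _ _ _ _ (T.oneSub.mul_mem (T.ξ_mem_oneSub _) (T.η_mem_oneSub _))
    (T.oneSub.mul_mem (T.ξ_mem_oneSub _) (T.η_mem_oneSub _))

theorem Fv_ne_zero (n : ZMod T.N) : T.Fv n ≠ 0 :=
  T.binomial_ne_zero _ _ _ _ (T.oneSub.mul_mem (T.ξ_mem_oneSub _) (T.η_mem_oneSub _))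
    (T.oneSub.mul_mem (T.ξ_mem_oneSub _) (T.η_mem_oneSub _))

/-- The values `s_n^i(τ_m^j)` generate `L` over `𝕂`. -/
theorem tauVar_mem_adjoin (r : T.Root) (c : T.Center) :
    T.tauVar c ∈ IntermediateField.adjoin T.K (Set.range (T.sTau r)) := by
  set F := IntermediateField.adjoin T.K (Set.range (T.sTau r)) with hF
  have hr := Finset.mem_Icc.1 r.2.2
  have hk := T.k_pos r.1
  have hl := T.ℓ_pos r.1
  have hs : ∀ c, T.sTau r c ∈ F := fun c => IntermediateField.subset_adjoin _ _ ⟨c, rfl⟩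
  have hc : ∀ x, T.const x ∈ F := fun x => by rw [T.const_eq]; exact F.algebraMap_mem x
  have h0 : ∀ m i, m ≠ r.1 → T.tau m i ∈ F := by
    intro m i hm
    by_cases h : i ≠ 0 ∧ -(T.ℓ m : ℤ) ≤ i ∧ i ≤ T.k m
    · have := hs (T.ctr m i h)
      rw [sTau, if_pos (by exact hm)] at this
      exact this
    · rw [tau, dif_neg h]
      exact F.one_mem
  have hξ : ∀ m, m ≠ r.1 → T.ξ m ∈ F := fun m hm => F.prod_mem fun i _ => h0 m i hm
  have hη : ∀ m, m ≠ r.1 → T.η m ∈ F := fun m hm => F.prod_mem fun i _ => h0 m _ hm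
  have hFu : T.Fu r.1 ∈ F :=
    F.add_mem (F.mul_mem (hc _) (F.mul_mem (hξ _ (T.add_one_ne _)) (hη _ (T.sub_one_ne _))))
      (F.mul_mem (hc _) (F.mul_mem (hξ _ (T.sub_one_ne _)) (hη _ (T.add_one_ne _))))
  have hFv : T.Fv r.1 ∈ F :=
    F.add_mem (F.mul_mem (hc _) (F.mul_mem (hξ _ (T.add_one_ne _)) (hη _ (T.sub_one_ne _))))
      (F.mul_mem (hc _) (F.mul_mem (hξ _ (T.sub_one_ne _)) (hη _ (T.add_one_ne _))))
  have hsc : ∀ i, ∀ h : i ≠ 0 ∧ -(T.ℓ r.1 : ℤ) ≤ i ∧ i ≤ T.k r.1,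
      T.sTau r (T.ctr r.1 i h) ∈ F := fun i h => hs _
  obtain ⟨n, i, hi⟩ := c
  by_cases hn : n = r.1
  swap
  · have := h0 n i hn
    rwa [T.tau_center ⟨n, i, hi⟩] at this
  subst hn
  have hi' := hi
  rw [Finset.mem_erase, Finset.mem_Icc] at hi'
  rw [← T.tau_center]
  change T.tau r.1 i ∈ F
  simp only [sTau, ctr, ne_eq, not_true, if_false] at hsc
  by_cases hr0 : (r.2 : ℤ) = 0
  · simp only [hr0, if_true] at hsc
    by_cases h1 : i = 1
    · subst h1
      have h := hsc (-1) ⟨by omega, by omega, by omega⟩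
      simp at h
      have h2 := F.div_mem hFu h
      rwa [div_div_cancel₀ (T.Fu_ne_zero _)] at h2
    by_cases h2 : i = -1
    · subst h2
      have h := hsc 1 ⟨by omega, by omega, by omega⟩
      simp at h
      have h2 := F.div_mem hFv h
      rwa [div_div_cancel₀ (T.Fv_ne_zero _)] at h2
    · have h := hsc i ⟨by omega, by omega, by omega⟩
      simpa [h1, h2] using h
  by_cases hrp : 0 < (r.2 : ℤ)
  · simp only [hr0, hrp, if_true, if_false] at hsc
    by_cases h1 : i = r.2
    · have h := hsc (r.2 + 1) ⟨by omega, by omega, by omega⟩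
      simp at h
      rwa [h1]
    by_cases h2 : i = r.2 + 1
    · have h := hsc r.2 ⟨by omega, by omega, by omega⟩
      simp at h
      rwa [h2]
    · have h := hsc i ⟨by omega, by omega, by omega⟩
      simpa [h1, h2] using h
  · simp only [hr0, hrp, if_false] at hsc
    by_cases h1 : i = r.2
    · have h := hsc (r.2 - 1) ⟨by omega, by omega, by omega⟩
      simp at h
      rwa [h1]
    by_cases h2 : i = r.2 - 1
    · have h := hsc r.2 ⟨by omega, by omega, by omega⟩
      simp at h
      rwa [h2]
    · have h := hsc i ⟨by omega, by omega, by omega⟩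
      simpa [h1, h2] using h

theorem adjoin_tauVar : IntermediateField.adjoin T.K (Set.range T.tauVar) = ⊤ := by
  rw [eq_top_iff]
  intro x _
  have hP : ∀ P : MvPolynomial T.Center T.K, algebraMap _ T.L P ∈
      IntermediateField.adjoin T.K (Set.range T.tauVar) := by
    intro P
    induction P using MvPolynomial.induction_on with
    | C a =>
      have := T.const_eq a
      rw [const, RingHom.comp_apply] at this
      rw [this]
      exact IntermediateField.algebraMap_mem _ _
    | add p q hp hq => rw [map_add]; exact add_mem hp hq
    | mul_X p i hp =>
      rw [map_mul]
      exact mul_mem hp (IntermediateField.subset_adjoin _ _ ⟨i, rfl⟩)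
  obtain ⟨p, q, _, rfl⟩ := IsFractionRing.div_surjective (A := MvPolynomial T.Center T.K) x
  exact div_mem (hP p) (hP q)

theorem algebraicIndependent_tauVar : AlgebraicIndependent T.K T.tauVar := by
  have h := MvPolynomial.algebraicIndependent_X T.Center T.K
  exact h.map' (f := IsScalarTower.toAlgHom T.K (MvPolynomial T.Center T.K) T.L)
    (IsFractionRing.injective (MvPolynomial T.Center T.K) T.L)

theorem algebraicIndependent_sTau (r : T.Root) : AlgebraicIndependent T.K (T.sTau r) := by
  have htop : IntermediateField.adjoin T.K (Set.range (T.sTau r)) = ⊤ := by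
    rw [eq_top_iff, ← T.adjoin_tauVar, IntermediateField.adjoin_le_iff]
    rintro _ ⟨c, rfl⟩
    exact T.tauVar_mem_adjoin r c
  have : Algebra.IsAlgebraic (Algebra.adjoin T.K (Set.range (T.sTau r))) T.L := by
    rw [← IntermediateField.isAlgebraic_adjoin_iff_top, htop,
      Algebra.isAlgebraic_iff_isIntegral]
    exact Algebra.isIntegral_of_surjective IntermediateField.topEquiv.surjective
  refine (Algebra.IsAlgebraic.isTranscendenceBasis_of_le_trdeg_of_finite T.K (T.sTau r) ?_).1
  exact T.algebraicIndependent_tauVar.cardinalMk_le_trdeg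

/-- The substitution of `s_n^i(a)`, `s_n^i(τ)` in polynomials. -/
def sPoly (r : T.Root) : MvPolynomial T.Center T.K →+* T.L :=
  MvPolynomial.eval₂Hom (T.const.comp (T.sK r : T.K →+* T.K)) (T.sTau r)

theorem sPoly_injective (r : T.Root) : Function.Injective (T.sPoly r) := by
  have h : T.sPoly r = (MvPolynomial.aeval (T.sTau r) : MvPolynomial T.Center T.K →ₐ[T.K] T.L).toRingHom.comp
      (MvPolynomial.map (T.sK r : T.K →+* T.K)) := by
    ext x
    · simp [sPoly, T.const_eq]
    · simp [sPoly]
  rw [h]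
  exact Function.Injective.comp (g := MvPolynomial.aeval (T.sTau r))
    (T.algebraicIndependent_sTau r)
    (MvPolynomial.map_injective _ (T.sK r).injective)

/-- The birational transformation `s_n^i` of `L`, i.e. `R(a, τ) ↦ R(s_n^i(a), s_n^i(τ))`. -/
def sL (r : T.Root) : T.L →+* T.L := IsFractionRing.lift (T.sPoly_injective r)

/-- `ρ` is the action of the Weyl group on `L` by field automorphisms in which the generators `s_n^i`
act as the birational transformations defined above. It is unique if it exists, since the `s_n^i`
generate `W`. -/
def IsWeylAction (ρ : T.W →* RingAut T.L) : Prop :=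
  ∀ (r : T.Root) (x : T.L), ρ (T.sW r) x = T.sL r x

/-- `τ : M → L` is the `τ`-function: `τ(E_n^i) = τ_n^i` and `τ(w.Λ) = w.τ(Λ)` for `w ∈ W`. -/
structure IsTauFunction (ρ : T.W →* RingAut T.L) (τ : T.M → T.L) : Prop where
  exceptional : ∀ (c : T.Center) (Λ : T.M), (Λ : T.NS) = T.E c.1 c.2 → τ Λ = T.tauVar c
  equivariant : ∀ (w : T.W) (Λ Λ' : T.M), (Λ' : T.NS) = w.1 (Λ : T.NS) → τ Λ' = ρ w (τ Λ)

/-! ### Defining polynomials -/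

/-- The index set of the homogeneous coordinates of `(ℙ¹)^N`: `(n, 0)` stands for `ζ_n^0` and
`(n, 1)` for `ζ_n^∞`, so that `f_n = ζ_n^0 / ζ_n^∞`. -/
abbrev Coord : Type := ZMod T.N × Fin 2

/-- The ideal of the center `C_n^i` in the homogeneous coordinate ring, where
`C_n^i = {f_{n-1} = 0, f_n = -u_n^i, f_{n+1} = ∞}` for `i > 0` and
`C_n^{-j} = {f_{n-1} = ∞, f_n = -1/v_n^{-j}, f_{n+1} = 0}` for `j > 0`. -/
def centerIdeal (c : T.Center) : Ideal (MvPolynomial T.Coord T.K) :=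
  if 0 < (c.2 : ℤ) then
    Ideal.span {MvPolynomial.X (c.1 - 1, 0),
      MvPolynomial.X (c.1, 0) + MvPolynomial.C (T.u c.1 c.2) * MvPolynomial.X (c.1, 1),
      MvPolynomial.X (c.1 + 1, 1)}
  else
    Ideal.span {MvPolynomial.X (c.1 - 1, 1),
      MvPolynomial.X (c.1, 0) + MvPolynomial.C (T.vInv c.1 c.2) * MvPolynomial.X (c.1, 1),
      MvPolynomial.X (c.1 + 1, 0)}

/-- The degrees `d_n` of `Λ = ∑ d_n H_n - ∑ μ_n^i E_n^i`. -/
def deg (Λ : T.NS) (n : ZMod T.N) : ℤ := Λ.1 n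

/-- The multiplicities `μ_n^i` of `Λ = ∑ d_n H_n - ∑ μ_n^i E_n^i`. -/
def mult (Λ : T.NS) (c : T.Center) : ℤ := -Λ.2 c

/-- The forms of multidegree `d` with multiplicity at least `μ_n^i` along `C_n^i`, i.e. the global
sections belonging to `Λ = ∑ d_n H_n - ∑ μ_n^i E_n^i`; a condition with `μ_n^i ≤ 0` is void. As
`C_n^i` is a complete intersection of hyperplanes, the polynomials of multiplicity at least `μ` are
those in the `μ`-th power of its ideal. -/
def linearSystem (Λ : T.NS) : Submodule T.K (MvPolynomial T.Coord T.K) :=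
  (⨅ n : ZMod T.N, MvPolynomial.weightedHomogeneousSubmodule T.K
      (fun z : T.Coord => if z.1 = n then (1 : ℤ) else 0) (T.deg Λ n)) ⊓
    ⨅ c : T.Center, (T.centerIdeal c ^ (T.mult Λ c).toNat).restrictScalars T.K

/-- `Φ` defines a hypersurface of multidegree `d` having multiplicity exactly `μ_n^i` along `C_n^i`
(multiplicity `0` in the case `μ_n^i = -1`, which occurs for `Λ = E_n^i`). -/
structure IsDefiningPolynomial (Λ : T.NS) (Φ : MvPolynomial T.Coord T.K) : Prop where
  ne_zero : Φ ≠ 0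
  mem_linearSystem : Φ ∈ T.linearSystem Λ
  multiplicity : ∀ c : T.Center, Φ ∉ T.centerIdeal c ^ ((T.mult Λ c).toNat + 1)

/-- Finite sums of monomials `a^x` with integral multiplicities, as elements of `𝕂`. -/
def puiseuxToK : T.Puiseux ℤ →+* T.K :=
  (algebraMap (T.Puiseux ℂ) T.K).comp
    (AddMonoidAlgebra.mapRingHom (T.Root → ℚ) (Int.castRingHom ℂ))

/-- The exponent of the corner monomial `∏_n (ζ_n^{S n})^{d_n}`, `S n ∈ {0, ∞}`. -/
def corner (d : ZMod T.N → ℤ) (S : ZMod T.N → Fin 2) : T.Coord →₀ ℕ :=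
  Finsupp.equivFunOnFinite.symm fun z => if z.2 = S z.1 then (d z.1).toNat else 0

/-- `(1/θ)^m = ∏_n (1/θ_n^0)^{m_n^0} (1/θ_n^∞)^{m_n^∞}`. -/
def thetaWeight (m : T.Coord →₀ ℕ) : ℚ :=
  ∏ n, (1 / T.θ0 n) ^ m (n, 0) * (1 / T.θinf n) ^ m (n, 1)

/-- `Φ = ∑_m A_m ζ^m` is normalized: each `A_m = ∑_x c_{m,x} a^x` is a sum of monic monomials `a^x`
with integral multiplicities `c_{m,x}`, it is a single monic monomial when `ζ^m` is a corner
monomial, and `∏_m A_m^{(1/θ)^m} = 1`, where a sum of monomials contributes through each of its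
terms, i.e. `∏_{m,x} (a^x)^{c_{m,x} (1/θ)^m} = 1`. -/
def IsNormalized (d : ZMod T.N → ℤ) (Φ : MvPolynomial T.Coord T.K) : Prop :=
  ∃ P : MvPolynomial T.Coord (T.Puiseux ℤ),
    MvPolynomial.map T.puiseuxToK P = Φ ∧
    (∀ S : ZMod T.N → Fin 2, ∃ x : T.Root → ℚ,
      P.coeff (T.corner d S) = AddMonoidAlgebra.single x 1) ∧
    ∏ m ∈ P.support, (P.coeff m).coeff.prod
      (fun x c => T.mono (((c : ℚ) * T.thetaWeight m) • x)) = 1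

/-- `Φ` is the normalized defining polynomial `Φ_Λ`. -/
def IsNormalizedDefiningPolynomial (Λ : T.NS) (Φ : MvPolynomial T.Coord T.K) : Prop :=
  T.IsDefiningPolynomial Λ Φ ∧ T.IsNormalized (T.deg Λ) Φ

/-- The values `ζ_n^0 = ξ_{n+1} η_{n-1}`, `ζ_n^∞ = ξ_{n-1} η_{n+1}` in `L`. -/
def zeta (z : T.Coord) : T.L :=
  if z.2 = 0 then T.ξ (z.1 + 1) * T.η (z.1 - 1) else T.ξ (z.1 - 1) * T.η (z.1 + 1)

/-- The ring `𝕂[τ^{±1}]` of Laurent polynomials in the `τ_n^i`, inside `L`. -/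
def laurent : Subalgebra T.K T.L :=
  Algebra.adjoin T.K (Set.range T.tauVar ∪ Set.range fun c => (T.tauVar c)⁻¹)

end TropicalDatum

end

noncomputable section
namespace TropicalDatum
variable (T : TropicalDatum)

/-! ### Monomials in the root variables -/

/-! Evaluated at ζ = ζ(τ), a simple reflection becomes a semilinear substitution `subK` in the
homogeneous coordinates. It acts on the coefficients, and for α_n^0 it multiplies each coordinate of
the rows n ± 1 by one of the two linear forms of row n cutting out C_n^1 and C_n^{-1}. The
denominators τ_n^1 τ_n^{-1} depend only on the row, so multihomogeneity pulls them out
(`sL_aeval_zeta`).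

This substitution transports sections. If f belongs to Λ, the forms F_1, F_{-1} of C_n^1, C_n^{-1}
divide `subK f` to the orders μ_n^{-1}, μ_n^1, and the quotient belongs to s(Λ); negative
multiplicities put the forms on the other side (`exists_transform`). Multiplicity along a center is
an order of vanishing in a polynomial ring over a domain, by the deformation `blow`, so it is
additive and the bookkeeping is that of a valuation. The condition k_{n-1}k_{n+1} = ℓ_{n-1}ℓ_{n+1}
enters once in each neighbouring row: it makes s_n^0 multiply the parameters of the rows n ± 1 by
powers of a_n^0 matching the weight ω_n in the scaled forms, so that the centers of these rows are
preserved.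

Applying the substitution twice gives f back up to a nonzero factor. Hence one-dimensionality of the
space of sections propagates along the orbit from E_n^i, whose sections are constants. Excess
multiplicity along C_n^i would give a section of Λ - E_n^i; pulled back by the Weyl group, a degree
count leaves only Λ = E_n^i, where the section is a nonzero constant (`eq_of_hasSection_sub`).

Normalization is expressed by ring homomorphisms, so that it passes to products and quotients.
Corner coefficients are values at points with coordinates 0 and 1. The weighted product of
coefficients is the exponential of a derivative: under a^x ↦ 1 + φ(x)ε, ζ ↦ 1/θ, the ε-part of P is
φ of the weighted exponent (`snd_expand`). The weight ω_n is the one for which the scaled forms have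
no ε-part. A scalar between two normalized sections is a monic monomial by the corners, and then 1
by the ε-part.

Uniqueness of normalized sections also replaces a check of the relations of W. A word in the
reflections acts on coefficients and on the values Φ(ζ)/∏τ^μ as its image in W acts on roots and
classes; if this image is trivial, the word fixes 𝕂 and every τ_n^i (`eq_one_of_acts`). The
τ-function is then given by these values. -/

theorem mono_add (x y : T.Root → ℚ) : T.mono (x + y) = T.mono x * T.mono y := by
  simp [mono, ← map_mul, AddMonoidAlgebra.single_mul_single]

theorem mono_zero : T.mono 0 = 1 := by
  rw [mono, ← AddMonoidAlgebra.one_def, map_one]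

theorem mono_ne_zero (x : T.Root → ℚ) : T.mono x ≠ 0 := by
  intro h
  have := T.mono_add x (-x)
  rw [h, zero_mul, add_neg_cancel, mono_zero] at this
  exact one_ne_zero this

theorem mono_injective : Function.Injective T.mono := by
  intro x y h
  have := IsFractionRing.injective (T.Puiseux ℂ) T.K h
  exact (AddMonoidAlgebra.single_left_inj (one_ne_zero)).1 this

theorem mono_neg (x : T.Root → ℚ) : T.mono (-x) = (T.mono x)⁻¹ := by
  refine eq_inv_of_mul_eq_one_left ?_
  rw [← mono_add, neg_add_cancel, mono_zero]

/-- The monic monomial `a^x` with integral coefficients. -/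
def monoZ (x : T.Root → ℚ) : T.Puiseux ℤ := AddMonoidAlgebra.single x 1

theorem monoZ_add (x y : T.Root → ℚ) : T.monoZ (x + y) = T.monoZ x * T.monoZ y := by
  simp [monoZ, AddMonoidAlgebra.single_mul_single]

theorem monoZ_zero : T.monoZ 0 = 1 := rfl

theorem monoZ_neg_mul (x : T.Root → ℚ) : T.monoZ (-x) * T.monoZ x = 1 := by
  rw [← monoZ_add, neg_add_cancel, monoZ_zero]

theorem puiseuxToK_monoZ (x : T.Root → ℚ) : T.puiseuxToK (T.monoZ x) = T.mono x := by
  simp [puiseuxToK, monoZ, mono]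

theorem puiseuxToK_injective : Function.Injective T.puiseuxToK := by
  refine (IsFractionRing.injective (T.Puiseux ℂ) T.K).comp ?_
  exact AddMonoidAlgebra.map_injective (Int.castRingHom ℂ).toAddMonoidHom
    (RingHom.injective_int (Int.castRingHom ℂ))

/-- The action of a simple reflection on sums of monomials with integral coefficients. -/
def sZ (r : T.Root) : T.Puiseux ℤ →+* T.Puiseux ℤ :=
  ((AddMonoidAlgebra.domCongr ℤ ℤ (T.expAct r)).toRingEquiv : T.Puiseux ℤ →+* T.Puiseux ℤ)

theorem sZ_single (r : T.Root) (x : T.Root → ℚ) (c : ℤ) :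
    T.sZ r (AddMonoidAlgebra.single x c) = AddMonoidAlgebra.single (T.expAct r x) c := by
  simp [sZ]

theorem sZ_monoZ (r : T.Root) (x : T.Root → ℚ) :
    T.sZ r (T.monoZ x) = T.monoZ (T.expAct r x) := T.sZ_single r x 1

theorem sK_algebraMap_single (r : T.Root) (x : T.Root → ℚ) (c : ℂ) :
    T.sK r (algebraMap _ _ (AddMonoidAlgebra.single x c)) =
      algebraMap (T.Puiseux ℂ) T.K (AddMonoidAlgebra.single (T.expAct r x) c) := by
  simp [sK]

theorem sK_mono (r : T.Root) (x : T.Root → ℚ) :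
    T.sK r (T.mono x) = T.mono (T.expAct r x) := T.sK_algebraMap_single r x 1

theorem puiseuxToK_comp_sZ (r : T.Root) :
    T.puiseuxToK.comp (T.sZ r) = (T.sK r : T.K →+* T.K).comp T.puiseuxToK := by
  refine AddMonoidAlgebra.ringHom_ext ?_ ?_
  · intro c
    simp [sZ, puiseuxToK, sK]
  · intro x
    simp [sZ, puiseuxToK, sK]

theorem expAct_expAct (r : T.Root) (x : T.Root → ℚ) : T.expAct r (T.expAct r x) = x :=
  (T.expAct r).left_inv x

/-- Ring homomorphisms out of `𝕂` agree if they agree on the terms `c a^x`. -/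
theorem ringHom_K_ext {S : Type*} [CommRing S] {f g : T.K →+* S}
    (h : ∀ x c, f (algebraMap (T.Puiseux ℂ) T.K (AddMonoidAlgebra.single x c)) =
      g (algebraMap (T.Puiseux ℂ) T.K (AddMonoidAlgebra.single x c))) : f = g := by
  refine IsLocalization.ringHom_ext (nonZeroDivisors (T.Puiseux ℂ)) ?_
  refine AddMonoidAlgebra.ringHom_ext (fun c => h _ _) (fun x => h _ _)

theorem sK_sK (r : T.Root) (x : T.K) : T.sK r (T.sK r x) = x := by
  have : (T.sK r : T.K →+* T.K).comp (T.sK r : T.K →+* T.K) = RingHom.id _ := by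
    refine T.ringHom_K_ext fun x c => ?_
    simp only [RingHom.comp_apply, RingHom.coe_coe, sK_algebraMap_single, expAct_expAct,
      RingHom.id_apply]
  exact RingHom.congr_fun this x

end TropicalDatum
end

noncomputable section
namespace TropicalDatum
variable (T : TropicalDatum)

/-! ### Simple reflections in coordinates -/

theorem root_mem (r : T.Root) : -(T.ℓ r.1 : ℤ) + 1 ≤ r.2 ∧ (r.2 : ℤ) ≤ T.k r.1 - 1 :=
  Finset.mem_Icc.1 r.2.2

theorem center_mem (c : T.Center) :
    (c.2 : ℤ) ≠ 0 ∧ -(T.ℓ c.1 : ℤ) ≤ c.2 ∧ (c.2 : ℤ) ≤ T.k c.1 := by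
  have h := c.2.2
  rwa [Finset.mem_erase, Finset.mem_Icc] at h

theorem center_ext {c c' : T.Center} (h1 : c.1 = c'.1) (h2 : (c.2 : ℤ) = c'.2) : c = c' := by
  obtain ⟨n, i, hi⟩ := c
  obtain ⟨n', i', hi'⟩ := c'
  simp only at h1 h2
  subst h1 h2
  rfl

theorem center_ext_iff {c c' : T.Center} : c = c' ↔ c.1 = c'.1 ∧ (c.2 : ℤ) = c'.2 :=
  ⟨fun h => by subst h; exact ⟨rfl, rfl⟩, fun h => T.center_ext h.1 h.2⟩

theorem root_ext {r r' : T.Root} (h1 : r.1 = r'.1) (h2 : (r.2 : ℤ) = r'.2) : r = r' := by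
  obtain ⟨n, i, hi⟩ := r
  obtain ⟨n', i', hi'⟩ := r'
  simp only at h1 h2
  subst h1 h2
  rfl

theorem root_ext_iff {r r' : T.Root} : r = r' ↔ r.1 = r'.1 ∧ (r.2 : ℤ) = r'.2 :=
  ⟨fun h => by subst h; exact ⟨rfl, rfl⟩, fun h => T.root_ext h.1 h.2⟩

/-- The first of the two centers involved in a simple root: `C_n^1` for `α_n^0` and `C_n^i` for
`α_n^i`. -/
def near (r : T.Root) : T.Center :=
  T.ctr r.1 (if (r.2 : ℤ) = 0 then 1 else r.2) (by
    have := T.root_mem r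
    have := T.k_pos r.1
    split_ifs <;> omega)

/-- The second of the two centers involved in a simple root: `C_n^{-1}` for `α_n^0` and
`C_n^{±(i+1)}` for `α_n^{±i}`. -/
def far (r : T.Root) : T.Center :=
  T.ctr r.1 (if (r.2 : ℤ) = 0 then -1 else if 0 < (r.2 : ℤ) then r.2 + 1 else r.2 - 1) (by
    have := T.root_mem r
    have := T.ℓ_pos r.1
    split_ifs <;> omega)

@[simp] theorem near_fst (r : T.Root) : (T.near r).1 = r.1 := rfl
@[simp] theorem far_fst (r : T.Root) : (T.far r).1 = r.1 := rfl

theorem near_snd (r : T.Root) : ((T.near r).2 : ℤ) =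
    if (r.2 : ℤ) = 0 then 1 else (r.2 : ℤ) := rfl

theorem far_snd (r : T.Root) : ((T.far r).2 : ℤ) =
    if (r.2 : ℤ) = 0 then -1 else if 0 < (r.2 : ℤ) then (r.2 : ℤ) + 1 else r.2 - 1 := rfl

theorem near_ne_far (r : T.Root) : T.near r ≠ T.far r := by
  intro h
  have := (T.center_ext_iff.1 h).2
  rw [near_snd, far_snd] at this
  split_ifs at this <;> omega

/-- The transposition of the two centers involved in a simple root. -/
def perm (r : T.Root) : Equiv.Perm T.Center := Equiv.swap (T.near r) (T.far r)

@[simp] theorem perm_near (r : T.Root) : T.perm r (T.near r) = T.far r := Equiv.swap_apply_left _ _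
@[simp] theorem perm_far (r : T.Root) : T.perm r (T.far r) = T.near r := Equiv.swap_apply_right _ _
@[simp] theorem perm_perm (r : T.Root) (c : T.Center) : T.perm r (T.perm r c) = c :=
  Equiv.swap_apply_self _ _ _

theorem perm_of_ne (r : T.Root) (c : T.Center) (h : c ≠ T.near r) (h' : c ≠ T.far r) :
    T.perm r c = c := Equiv.swap_apply_of_ne_of_ne h h'

@[simp] theorem perm_fst (r : T.Root) (c : T.Center) : (T.perm r c).1 = c.1 := by
  by_cases h : c = T.near r
  · subst h; simp
  by_cases h' : c = T.far r
  · subst h'; simp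
  rw [T.perm_of_ne r c h h']

theorem α_of_eq_zero {r : T.Root} (h : (r.2 : ℤ) = 0) :
    T.α r = (Pi.single r.1 1, -Pi.single (T.near r) 1 - Pi.single (T.far r) 1) := by
  have hr := T.root_mem r
  have hk := T.k_pos r.1
  have hl := T.ℓ_pos r.1
  rw [α, if_pos h, T.E_ctr r.1 1 ⟨by omega, by omega, by omega⟩,
    T.E_ctr r.1 (-1) ⟨by omega, by omega, by omega⟩, H]
  simp [near, far, h]

theorem α_of_ne_zero {r : T.Root} (h : (r.2 : ℤ) ≠ 0) :
    T.α r = (0, Pi.single (T.near r) 1 - Pi.single (T.far r) 1) := by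
  have hr := T.root_mem r
  rw [α, if_neg h]
  split_ifs with h1
  · rw [T.E_ctr r.1 r.2 ⟨by omega, by omega, by omega⟩,
      T.E_ctr r.1 (r.2 + 1) ⟨by omega, by omega, by omega⟩]
    simp [near, far, h, h1]
  · rw [T.E_ctr r.1 r.2 ⟨by omega, by omega, by omega⟩,
      T.E_ctr r.1 (r.2 - 1) ⟨by omega, by omega, by omega⟩]
    simp [near, far, h, h1]

theorem pairing_of_eq_zero {r : T.Root} (h : (r.2 : ℤ) = 0) (Λ : T.NS) :
    T.pairing (T.coα r) Λ =
      Λ.1 (r.1 - 1) + Λ.1 (r.1 + 1) + Λ.2 (T.near r) + Λ.2 (T.far r) := by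
  have hr := T.root_mem r
  have hk := T.k_pos r.1
  have hl := T.ℓ_pos r.1
  have : T.coα r = (Pi.single (r.1 - 1) 1 + Pi.single (r.1 + 1) 1,
      -Pi.single (T.near r) 1 - Pi.single (T.far r) 1) := by
    rw [coα, if_pos h, T.E_ctr r.1 1 ⟨by omega, by omega, by omega⟩,
      T.E_ctr r.1 (-1) ⟨by omega, by omega, by omega⟩, H, H]
    simp [near, far, h]
  rw [this]
  simp only [pairing, LinearMap.coe_mk, AddHom.coe_mk, Pi.add_apply, Pi.sub_apply, Pi.neg_apply,
    mul_add, mul_sub, mul_neg, Finset.sum_add_distrib, Finset.sum_sub_distrib,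
    Finset.sum_neg_distrib]
  simp [Pi.single_apply]
  ring

theorem pairing_of_ne_zero {r : T.Root} (h : (r.2 : ℤ) ≠ 0) (Λ : T.NS) :
    T.pairing (T.coα r) Λ = Λ.2 (T.far r) - Λ.2 (T.near r) := by
  have hc : T.coα r = T.α r := by rw [coα, α, if_neg h, if_neg h]
  rw [hc, T.α_of_ne_zero h]
  simp only [pairing, LinearMap.coe_mk, AddHom.coe_mk, Pi.zero_apply, Pi.sub_apply,
    mul_sub, Finset.sum_sub_distrib]
  simp [Pi.single_apply]

theorem s_apply (r : T.Root) (Λ : T.NS) :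
    T.s r Λ = Λ + T.pairing (T.coα r) Λ • T.α r := rfl

theorem s_s (r : T.Root) (Λ : T.NS) : T.s r (T.s r Λ) = Λ := (T.s r).left_inv Λ

theorem deg_s_of_ne_zero {r : T.Root} (h : (r.2 : ℤ) ≠ 0) (Λ : T.NS) :
    T.deg (T.s r Λ) = T.deg Λ := by
  funext n
  simp [deg, s_apply, T.α_of_ne_zero h]

theorem mult_s_of_ne_zero {r : T.Root} (h : (r.2 : ℤ) ≠ 0) (Λ : T.NS) (c : T.Center) :
    T.mult (T.s r Λ) c = T.mult Λ (T.perm r c) := by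
  have hne := T.near_ne_far r
  simp only [mult, s_apply, T.α_of_ne_zero h, T.pairing_of_ne_zero h, Prod.smul_mk, Prod.snd_add,
    Pi.add_apply, Pi.smul_apply, Pi.sub_apply, smul_eq_mul]
  by_cases h1 : c = T.near r
  · subst h1; simp [hne]
  by_cases h2 : c = T.far r
  · subst h2; simp [hne.symm]
  simp [T.perm_of_ne r c h1 h2, h1, h2]

theorem deg_s_of_eq_zero {r : T.Root} (h : (r.2 : ℤ) = 0) (Λ : T.NS) :
    T.deg (T.s r Λ) = T.deg Λ + Pi.single r.1 (T.deg Λ (r.1 - 1) + T.deg Λ (r.1 + 1)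
      - T.mult Λ (T.near r) - T.mult Λ (T.far r)) := by
  funext n
  simp only [deg, mult, s_apply, T.α_of_eq_zero h, T.pairing_of_eq_zero h, Prod.smul_mk,
    Prod.fst_add, Pi.add_apply, Pi.smul_apply, smul_eq_mul, Pi.single_apply]
  split_ifs <;> ring

theorem mult_s_near {r : T.Root} (h : (r.2 : ℤ) = 0) (Λ : T.NS) :
    T.mult (T.s r Λ) (T.near r) =
      T.deg Λ (r.1 - 1) + T.deg Λ (r.1 + 1) - T.mult Λ (T.far r) := by
  have hne := T.near_ne_far r
  simp [deg, mult, s_apply, T.α_of_eq_zero h, T.pairing_of_eq_zero h, hne]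
  ring

theorem mult_s_far {r : T.Root} (h : (r.2 : ℤ) = 0) (Λ : T.NS) :
    T.mult (T.s r Λ) (T.far r) =
      T.deg Λ (r.1 - 1) + T.deg Λ (r.1 + 1) - T.mult Λ (T.near r) := by
  have hne := T.near_ne_far r
  simp [deg, mult, s_apply, T.α_of_eq_zero h, T.pairing_of_eq_zero h, hne.symm]

theorem mult_s_of_ne {r : T.Root} (h : (r.2 : ℤ) = 0) (Λ : T.NS) {c : T.Center}
    (h1 : c ≠ T.near r) (h2 : c ≠ T.far r) : T.mult (T.s r Λ) c = T.mult Λ c := by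
  simp [mult, s_apply, T.α_of_eq_zero h, h1, h2]

/-! ### The root lattice with rational coefficients -/

/-- Extension of an exponent vector by zero to all indices. -/
def extend (x : T.Root → ℚ) (n : ZMod T.N) (j : ℤ) : ℚ :=
  if h : j ∈ Finset.Icc (-(T.ℓ n : ℤ) + 1) ((T.k n : ℤ) - 1) then x ⟨n, j, h⟩ else 0

theorem extend_root (x : T.Root → ℚ) (r : T.Root) : T.extend x r.1 r.2 = x r := by
  rw [extend, dif_pos r.2.2]

theorem sum_mul_indicator (x : T.Root → ℚ) (n : ZMod T.N) (j : ℤ) :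
    ∑ t : T.Root, x t * (if t.1 = n ∧ (t.2 : ℤ) = j then 1 else 0) = T.extend x n j := by
  by_cases h : j ∈ Finset.Icc (-(T.ℓ n : ℤ) + 1) ((T.k n : ℤ) - 1)
  · rw [extend, dif_pos h, Finset.sum_eq_single ⟨n, j, h⟩]
    · simp
    · intro t _ ht
      rw [if_neg, mul_zero]
      exact fun h' => ht (T.root_ext h'.1 h'.2)
    · simp
  · rw [extend, dif_neg h]
    refine Finset.sum_eq_zero fun t _ => ?_
    rw [if_neg, mul_zero]
    rintro ⟨rfl, rfl⟩
    exact h t.2.2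

theorem α_fst (t : T.Root) (n : ZMod T.N) :
    (T.α t).1 n = if t.1 = n ∧ (t.2 : ℤ) = 0 then 1 else 0 := by
  by_cases h : (t.2 : ℤ) = 0
  · simp [T.α_of_eq_zero h, h, Pi.single_apply, eq_comm]
  · simp [T.α_of_ne_zero h, h]

/-- E_n^i occurs positively in the root of the same index and negatively in the root one step closer
to 0, which is α_n^0 when i = ±1. For extremal i the first indicator vanishes because no such root
exists. -/
theorem α_snd (t : T.Root) (c : T.Center) :
    (T.α t).2 c = (if t.1 = c.1 ∧ (t.2 : ℤ) = c.2 then 1 else 0) -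
      (if t.1 = c.1 ∧ (t.2 : ℤ) = c.2 - (c.2 : ℤ).sign then 1 else 0) := by
  have hc := T.center_mem c
  have e1 : c = T.near t ↔ t.1 = c.1 ∧ (c.2 : ℤ) =
      if (t.2 : ℤ) = 0 then 1 else (t.2 : ℤ) :=
    T.center_ext_iff.trans (and_congr eq_comm Iff.rfl)
  have e2 : c = T.far t ↔ t.1 = c.1 ∧ (c.2 : ℤ) =
      if (t.2 : ℤ) = 0 then -1 else if 0 < (t.2 : ℤ) then (t.2 : ℤ) + 1 else t.2 - 1 :=
    T.center_ext_iff.trans (and_congr eq_comm Iff.rfl)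
  by_cases hn : t.1 = c.1
  swap
  · by_cases h : (t.2 : ℤ) = 0
    · simp [T.α_of_eq_zero h, e1, e2, hn]
    · simp [T.α_of_ne_zero h, e1, e2, hn]
  by_cases h : (t.2 : ℤ) = 0
  · simp only [T.α_of_eq_zero h, Pi.sub_apply, Pi.neg_apply, Pi.single_apply, e1, e2, hn, h,
      true_and, if_true]
    rcases lt_or_gt_of_ne hc.1 with h1 | h1
    · rw [Int.sign_eq_neg_one_of_neg h1]; split_ifs <;> omega
    · rw [Int.sign_eq_one_of_pos h1]; split_ifs <;> omega
  · simp only [T.α_of_ne_zero h, Pi.sub_apply, Pi.single_apply, e1, e2, hn, h,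
      true_and, if_false]
    rcases lt_or_gt_of_ne hc.1 with h1 | h1
    · rw [Int.sign_eq_neg_one_of_neg h1]; split_ifs <;> omega
    · rw [Int.sign_eq_one_of_pos h1]; split_ifs <;> omega

theorem sum_mul_α_fst (x : T.Root → ℚ) (n : ZMod T.N) :
    ∑ t, x t * ((T.α t).1 n : ℚ) = T.extend x n 0 := by
  rw [← sum_mul_indicator]
  refine Finset.sum_congr rfl fun t _ => ?_
  rw [α_fst]
  push_cast
  rfl

theorem sum_mul_α_snd (x : T.Root → ℚ) (c : T.Center) :
    ∑ t, x t * ((T.α t).2 c : ℚ) =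
      T.extend x c.1 c.2 - T.extend x c.1 (c.2 - (c.2 : ℤ).sign) := by
  rw [← sum_mul_indicator, ← sum_mul_indicator, ← Finset.sum_sub_distrib]
  refine Finset.sum_congr rfl fun t _ => ?_
  rw [α_snd]
  push_cast
  ring

theorem expAct_apply (r : T.Root) (x : T.Root → ℚ) :
    T.expAct r x = x + Pi.single r (∑ t, x t * (T.pairing (T.coα r) (T.α t) : ℚ)) := rfl

/-- The coefficient of `E_n^i` in `∑ x_t α_t`. -/
def slope (x : T.Root → ℚ) (c : T.Center) : ℚ :=
  T.extend x c.1 c.2 - T.extend x c.1 (c.2 - (c.2 : ℤ).sign)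

theorem expAct_of_ne_zero {r : T.Root} (h : (r.2 : ℤ) ≠ 0) (x : T.Root → ℚ) :
    T.expAct r x = x + Pi.single r (T.slope x (T.far r) - T.slope x (T.near r)) := by
  rw [expAct_apply]
  congr 2
  rw [slope, slope, ← sum_mul_α_snd, ← sum_mul_α_snd, ← Finset.sum_sub_distrib]
  refine Finset.sum_congr rfl fun t _ => ?_
  rw [T.pairing_of_ne_zero h]
  push_cast
  ring

theorem expAct_of_eq_zero {r : T.Root} (h : (r.2 : ℤ) = 0) (x : T.Root → ℚ) :
    T.expAct r x = x + Pi.single r (T.extend x (r.1 - 1) 0 + T.extend x (r.1 + 1) 0 +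
      T.slope x (T.near r) + T.slope x (T.far r)) := by
  rw [expAct_apply]
  congr 2
  rw [slope, slope, ← sum_mul_α_snd, ← sum_mul_α_snd, ← sum_mul_α_fst, ← sum_mul_α_fst,
    ← Finset.sum_add_distrib, ← Finset.sum_add_distrib, ← Finset.sum_add_distrib]
  refine Finset.sum_congr rfl fun t _ => ?_
  rw [T.pairing_of_eq_zero h]
  push_cast
  ring

/-- The simple roots are linearly independent. -/
theorem eq_zero_of_extend_slope {x : T.Root → ℚ} (h0 : ∀ n, T.extend x n 0 = 0)
    (h : ∀ c, T.slope x c = 0) : x = 0 := by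
  have hpos : ∀ n (j : ℕ), T.extend x n j = 0 := by
    intro n j
    induction j with
    | zero => exact h0 n
    | succ j ih =>
      by_cases hj : (j : ℤ) + 1 ≤ T.k n
      · have := h (T.ctr n (j + 1) ⟨by omega, by omega, hj⟩)
        simp only [slope, ctr] at this
        rw [Int.sign_eq_one_of_pos (by omega), add_sub_cancel_right, ih, sub_zero] at this
        exact_mod_cast this
      · rw [extend, dif_neg]
        rw [Finset.mem_Icc]
        push_cast
        omega
  have hneg : ∀ n (j : ℕ), T.extend x n (-(j : ℤ)) = 0 := by
    intro n j
    induction j with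
    | zero => exact h0 n
    | succ j ih =>
      by_cases hj : (j : ℤ) + 1 ≤ T.ℓ n
      · have := h (T.ctr n (-((j : ℤ) + 1)) ⟨by omega, by omega, by omega⟩)
        simp only [slope, ctr] at this
        rw [Int.sign_eq_neg_one_of_neg (by omega)] at this
        have e : -((j : ℤ) + 1) - -1 = -j := by ring
        rw [e, ih, sub_zero] at this
        exact_mod_cast this
      · rw [extend, dif_neg]
        rw [Finset.mem_Icc]
        push_cast
        omega
  funext r
  rw [← T.extend_root x r]
  rcases Int.eq_nat_or_neg (r.2 : ℤ) with ⟨j, hj | hj⟩ <;> rw [hj]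
  · exact hpos _ _
  · exact hneg _ _

end TropicalDatum
end

noncomputable section
namespace TropicalDatum
variable (T : TropicalDatum)

/-! ### The parameters of the centers -/

/-- The jump at `i` of the exponents of the parameter of the center `C_n^i`. -/
def jump (c : T.Center) (j : ℤ) : ℚ :=
  if 0 < (c.2 : ℤ) then (if (c.2 : ℤ) ≤ j then 1 else 0) else (if (c.2 : ℤ) < j then 1 else 0)

/-- The exponent vector of the parameter `u_n^i` resp. `1/v_n^{-j}` of a center. -/
def gexp (c : T.Center) : T.Root → ℚ := fun r =>
  if r.1 = c.1 then (T.ℓ c.1 + (r.2 : ℤ)) / (T.k c.1 + T.ℓ c.1) - T.jump c r.2 else 0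

theorem k_add_ℓ_pos (n : ZMod T.N) : (0 : ℚ) < T.k n + T.ℓ n := by
  have := T.k_pos n
  positivity

/-- Since (1 - i/k)·k/(k+ℓ) = 1 - (ℓ+i)/(k+ℓ), the fractional powers combine into one affine
function (ℓ+i)/(k+ℓ) of the index, lowered by 1 to the right of a cut at the center. The same
function serves both signs, which lets all centers be treated uniformly. -/
theorem u_eq (c : T.Center) (h : 0 < (c.2 : ℤ)) : T.u c.1 c.2 = T.mono (T.gexp c) := by
  rw [u]
  congr 1
  funext r
  have hk : (0 : ℚ) < T.k c.1 := by exact_mod_cast T.k_pos c.1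
  have hl : (0 : ℚ) < T.ℓ c.1 := by exact_mod_cast T.ℓ_pos c.1
  have hs := T.k_add_ℓ_pos c.1
  simp only [Pi.add_apply, uExp, gexp, jump, h, if_true]
  by_cases hn : r.1 = c.1
  swap
  · simp [hn]
  simp only [hn, ne_eq, not_true, if_false, true_and, if_true]
  by_cases h0 : (r.2 : ℤ) = 0
  · rw [if_pos h0, if_neg (by omega), if_neg (by omega), h0]
    simp
  by_cases h1 : 0 < (r.2 : ℤ)
  · rw [if_neg h0, if_pos h1]
    by_cases h2 : (c.2 : ℤ) ≤ r.2
    · rw [if_neg (by omega), if_pos h2]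
      field_simp
      ring
    · rw [if_pos (by omega), if_neg h2]
      field_simp
      ring
  · rw [if_neg h0, if_neg h1, if_neg (by omega), if_neg (by omega)]
    field_simp
    ring

theorem vInv_eq (c : T.Center) (h : ¬ 0 < (c.2 : ℤ)) : T.vInv c.1 c.2 = T.mono (T.gexp c) := by
  have hc := (T.center_mem c).1
  rw [vInv, ← mono_neg]
  congr 1
  funext r
  have hk : (0 : ℚ) < T.k c.1 := by exact_mod_cast T.k_pos c.1
  have hl : (0 : ℚ) < T.ℓ c.1 := by exact_mod_cast T.ℓ_pos c.1
  have hs := T.k_add_ℓ_pos c.1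
  simp only [Pi.neg_apply, Pi.add_apply, vExp, gexp, jump, h, if_false]
  by_cases hn : r.1 = c.1
  swap
  · simp [hn]
  simp only [hn, ne_eq, not_true, if_false, true_and, if_true]
  by_cases h0 : (r.2 : ℤ) = 0
  · rw [if_pos h0, if_neg (by omega), if_pos (by omega), h0]
    field_simp
    ring
  by_cases h1 : 0 < (r.2 : ℤ)
  · rw [if_neg h0, if_pos h1, if_neg (by omega), if_pos (by omega)]
    field_simp
    ring
  · rw [if_neg h0, if_neg h1]
    by_cases h2 : (c.2 : ℤ) < r.2
    · rw [if_pos (by omega), if_pos h2]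
      field_simp
      ring
    · rw [if_neg (by omega), if_neg h2]
      field_simp
      ring

theorem uExp_eq {r : T.Root} (h : (r.2 : ℤ) = 0) : T.uExp r.1 = T.gexp (T.near r) := by
  have := T.u_eq (T.near r) (by rw [near_snd, if_pos h]; omega)
  rw [u] at this
  rw [← T.mono_injective this]
  funext t
  rw [near_snd, if_pos h, Pi.add_apply, if_neg (by omega), add_zero]
  rfl

theorem vExp_eq {r : T.Root} (h : (r.2 : ℤ) = 0) : T.vExp r.1 = -T.gexp (T.far r) := by
  have := T.vInv_eq (T.far r) (by rw [far_snd, if_pos h]; omega)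
  rw [vInv, ← mono_neg] at this
  rw [← T.mono_injective this]
  funext t
  rw [far_snd, if_pos h, neg_neg, Pi.add_apply, if_neg (by omega), add_zero]
  rfl

/-- The affine formula persists just outside the range of the roots: it gives 0 at -ℓ_n and 1 - 1 =
0 at k_n, in agreement with extension by zero. Extremal centers therefore need no separate
treatment. -/
theorem extend_gexp (c : T.Center) (n : ZMod T.N) (j : ℤ) (h : -(T.ℓ n : ℤ) ≤ j)
    (h' : j ≤ T.k n) : T.extend (T.gexp c) n j =
      if n = c.1 then (T.ℓ c.1 + j) / (T.k c.1 + T.ℓ c.1) - T.jump c j else 0 := by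
  have hs := T.k_add_ℓ_pos c.1
  have hc := T.center_mem c
  rw [extend]
  split_ifs with h1 h2 h2
  · simp [gexp, h2]
  · simp [gexp, h2]
  · subst h2
    rw [Finset.mem_Icc] at h1
    obtain rfl | rfl : j = -(T.ℓ c.1 : ℤ) ∨ j = T.k c.1 := by omega
    · rw [jump]
      split_ifs <;> first | omega | simp
    · rw [jump]
      have : ((T.ℓ c.1 : ℚ) + ((T.k c.1 : ℤ) : ℚ)) / (T.k c.1 + T.ℓ c.1) = 1 := by
        rw [div_eq_one_iff_eq hs.ne']
        push_cast
        ring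
      rw [this]
      split_ifs <;> first | omega | simp
  · rfl

/-- The affine part has constant slope, and the cut separates the index of `c'` from its neighbour
towards 0 only if `c' = c`. -/
theorem slope_gexp (c c' : T.Center) : T.slope (T.gexp c) c' =
    if c'.1 = c.1 then ((c'.2 : ℤ).sign : ℚ) / (T.k c.1 + T.ℓ c.1) -
      (if (c'.2 : ℤ) = c.2 then ((c.2 : ℤ).sign : ℚ) else 0) else 0 := by
  have hs := T.k_add_ℓ_pos c.1
  have hc := T.center_mem c
  have hc' := T.center_mem c'
  rw [slope, T.extend_gexp c c'.1 _ (by omega) (by omega), T.extend_gexp c c'.1 _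
    (by rcases lt_or_gt_of_ne hc'.1 with h1 | h1
        · rw [Int.sign_eq_neg_one_of_neg h1]; omega
        · rw [Int.sign_eq_one_of_pos h1]; omega)
    (by rcases lt_or_gt_of_ne hc'.1 with h1 | h1
        · rw [Int.sign_eq_neg_one_of_neg h1]; omega
        · rw [Int.sign_eq_one_of_pos h1]; omega)]
  split_ifs with hn h
  · rw [h]
    rcases lt_or_gt_of_ne hc.1 with h1 | h1
    · rw [Int.sign_eq_neg_one_of_neg h1, jump, jump, if_neg (by omega), if_neg (by omega),
        if_neg (by omega), if_pos (by omega)]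
      push_cast
      field_simp
      ring
    · rw [Int.sign_eq_one_of_pos h1, jump, jump, if_pos (by omega), if_pos (by omega),
        if_pos (by omega), if_neg (by omega)]
      push_cast
      field_simp
      ring
  · have : T.jump c c'.2 = T.jump c (c'.2 - (c'.2 : ℤ).sign) := by
      unfold jump
      rcases lt_or_gt_of_ne hc'.1 with h1 | h1
      · rw [Int.sign_eq_neg_one_of_neg h1]
        split_ifs <;> first | omega | rfl
      · rw [Int.sign_eq_one_of_pos h1]
        split_ifs <;> first | omega | rfl
    rw [this]
    push_cast
    field_simp
    ring
  · ring

theorem gexp_near (r : T.Root) : T.gexp (T.near r) = T.gexp (T.far r) +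
    Pi.single r (if (r.2 : ℤ) = 0 then 1 else -((r.2 : ℤ).sign : ℚ)) := by
  funext t
  simp only [gexp, near_fst, far_fst, jump, near_snd, far_snd, Pi.add_apply, Pi.single_apply,
    root_ext_iff]
  by_cases hn : t.1 = r.1
  swap
  · simp [hn]
  simp only [hn, true_and, if_true]
  by_cases h0 : (r.2 : ℤ) = 0
  · simp only [h0, if_true]
    split_ifs <;> first | omega | ring
  rcases lt_or_gt_of_ne h0 with h1 | h1
  · rw [Int.sign_eq_neg_one_of_neg h1]
    simp only [h0, if_false]
    push_cast
    split_ifs <;> first | omega | ring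
  · rw [Int.sign_eq_one_of_pos h1]
    simp only [h0, if_false]
    push_cast
    split_ifs <;> first | omega | ring

theorem add_one_ne_sub_one (n : ZMod T.N) : n + 1 ≠ n - 1 := by
  have h3 := T.three_le
  intro h
  have h' : ((2 : ℕ) : ZMod T.N) = 0 := by
    have : (n + 1) - (n - 1) = 0 := sub_eq_zero.2 h
    push_cast
    rw [← this]
    ring
  rw [ZMod.natCast_eq_zero_iff] at h'
  have := Nat.le_of_dvd two_pos h'
  omega

theorem near_sign {r : T.Root} (h : (r.2 : ℤ) ≠ 0) : ((T.near r).2 : ℤ).sign = (r.2 : ℤ).sign := by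
  rw [near_snd, if_neg h]

theorem far_sign {r : T.Root} (h : (r.2 : ℤ) ≠ 0) : ((T.far r).2 : ℤ).sign = (r.2 : ℤ).sign := by
  rw [far_snd, if_neg h]
  rcases lt_or_gt_of_ne h with h1 | h1
  · rw [if_neg (by omega), Int.sign_eq_neg_one_of_neg h1, Int.sign_eq_neg_one_of_neg (by omega)]
  · rw [if_pos h1, Int.sign_eq_one_of_pos h1, Int.sign_eq_one_of_pos (by omega)]

/-- A simple reflection permutes the parameters of the centers in its own row. -/
theorem expAct_gexp {r : T.Root} {c : T.Center} (h : (r.2 : ℤ) ≠ 0 ∨ c.1 = r.1) :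
    T.expAct r (T.gexp c) = T.gexp (T.perm r c) := by
  have hne := T.near_ne_far r
  have hg := T.gexp_near r
  by_cases h0 : (r.2 : ℤ) = 0
  · have hc : c.1 = r.1 := h.resolve_left (not_not_intro h0)
    rw [T.expAct_of_eq_zero h0, T.extend_gexp _ _ _ (by omega) (by omega),
      T.extend_gexp _ _ _ (by omega) (by omega), slope_gexp, slope_gexp,
      if_neg (hc.symm ▸ T.sub_one_ne r.1), if_neg (hc.symm ▸ T.add_one_ne r.1),
      if_pos (show (T.near r).1 = c.1 from hc.symm), if_pos (show (T.far r).1 = c.1 from hc.symm)]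
    rw [if_pos h0] at hg
    have e1 : ((T.near r).2 : ℤ) = 1 := by rw [near_snd, if_pos h0]
    have e2 : ((T.far r).2 : ℤ) = -1 := by rw [far_snd, if_pos h0]
    by_cases h1 : c = T.near r
    · rw [h1, perm_near, hg, e1, e2, add_assoc, ← Pi.single_add]
      norm_num
      ring
    by_cases h2 : c = T.far r
    · rw [h2, perm_far, hg, e1, e2]
      norm_num
      ring
    · have h1' : ¬ ((T.near r).2 : ℤ) = c.2 := fun h' => h1 (T.center_ext hc h'.symm)
      have h2' : ¬ ((T.far r).2 : ℤ) = c.2 := fun h' => h2 (T.center_ext hc h'.symm)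
      -- For the other centers of the row the contributions of E_n^1 and E_n^{-1} have opposite
      -- signs and cancel.
      rw [T.perm_of_ne r c h1 h2, if_neg h1', if_neg h2', e1, e2]
      norm_num
      ring_nf
  · rw [T.expAct_of_ne_zero h0, slope_gexp, slope_gexp, T.near_sign h0, T.far_sign h0]
    rw [if_neg h0] at hg
    have hne' : ¬ ((T.near r).2 : ℤ) = (T.far r).2 := fun h' => hne (T.center_ext rfl h')
    by_cases h1 : c = T.near r
    · rw [h1, perm_near, T.near_sign h0, if_pos (show (T.far r).1 = (T.near r).1 from rfl),
        if_pos rfl, if_pos rfl, if_neg (Ne.symm hne'),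
        hg, add_assoc, ← Pi.single_add]
      ring_nf
      simp
    by_cases h2 : c = T.far r
    · rw [h2, perm_far, T.far_sign h0, if_pos (show (T.near r).1 = (T.far r).1 from rfl),
        if_pos rfl, if_pos rfl, if_neg hne', hg]
      ring_nf
    · rw [T.perm_of_ne r c h1 h2]
      by_cases hn : r.1 = c.1
      · have h1' : ¬ ((T.near r).2 : ℤ) = c.2 := fun h' => h1 (T.center_ext hn.symm h'.symm)
        have h2' : ¬ ((T.far r).2 : ℤ) = c.2 := fun h' => h2 (T.center_ext hn.symm h'.symm)
        rw [if_pos (show (T.near r).1 = c.1 from hn), if_pos (show (T.far r).1 = c.1 from hn),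
          if_neg h1', if_neg h2']
        simp
      · rw [if_neg (show ¬ (T.near r).1 = c.1 from hn), if_neg (show ¬ (T.far r).1 = c.1 from hn)]
        simp

theorem expAct_gexp_of_ne {r : T.Root} (h0 : (r.2 : ℤ) = 0) {c : T.Center} (h : c.1 ≠ r.1)
    (h1 : c.1 ≠ r.1 - 1) (h2 : c.1 ≠ r.1 + 1) : T.expAct r (T.gexp c) = T.gexp c := by
  rw [T.expAct_of_eq_zero h0, T.extend_gexp _ _ _ (by omega) (by omega),
    T.extend_gexp _ _ _ (by omega) (by omega), slope_gexp, slope_gexp, if_neg h1.symm,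
    if_neg h2.symm, if_neg (show ¬ (T.near r).1 = c.1 from h.symm),
    if_neg (show ¬ (T.far r).1 = c.1 from h.symm)]
  simp

theorem jump_zero (c : T.Center) : T.jump c 0 = if 0 < (c.2 : ℤ) then 0 else 1 := by
  have := T.center_mem c
  rw [jump]
  split_ifs <;> first | omega | rfl

theorem θ_pos (n : ZMod T.N) : 0 < T.θ0 n ∧ 0 < T.θinf n := by
  have h1 := T.k_pos (n + 1)
  have h2 := T.k_pos (n - 1)
  unfold θ0 θinf
  constructor <;> positivity

/-- Only the coefficient of H_{n-1} pairs nontrivially with the coroot: it is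
ℓ_{n-1}/(k_{n-1}+ℓ_{n-1}), less 1 for negative centers. Cross-multiplied, equality of this fraction
with ω_n is exactly the hypothesis on k and ℓ. -/
theorem expAct_gexp_sub_one
    (hT : ∀ n : ZMod T.N, T.k (n - 1) * T.k (n + 1) = T.ℓ (n - 1) * T.ℓ (n + 1))
    {r : T.Root} (h0 : (r.2 : ℤ) = 0) {c : T.Center} (h : c.1 = r.1 - 1) :
    T.expAct r (T.gexp c) =
      T.gexp c + Pi.single r (T.ω r.1 - if 0 < (c.2 : ℤ) then 0 else 1) := by
  have hne := T.sub_one_ne r.1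
  rw [T.expAct_of_eq_zero h0, T.extend_gexp _ _ _ (by omega) (by omega),
    T.extend_gexp _ _ _ (by omega) (by omega), slope_gexp, slope_gexp,
    if_pos h.symm, if_neg (h.symm ▸ T.add_one_ne_sub_one r.1),
    if_neg (show ¬ (T.near r).1 = c.1 from h.symm ▸ hne.symm),
    if_neg (show ¬ (T.far r).1 = c.1 from h.symm ▸ hne.symm), jump_zero]
  congr 2
  have hT' : (T.k (r.1 - 1) : ℚ) * T.k (r.1 + 1) = T.ℓ (r.1 - 1) * T.ℓ (r.1 + 1) := by
    exact_mod_cast hT r.1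
  have hs := T.k_add_ℓ_pos (r.1 - 1)
  obtain ⟨h1, h2⟩ := T.θ_pos r.1
  rw [add_zero, add_zero, add_zero]
  congr 1
  rw [show T.k c.1 = T.k (r.1 - 1) by rw [h], show T.ℓ c.1 = T.ℓ (r.1 - 1) by rw [h], ω,
    div_eq_div_iff hs.ne' (by positivity)]
  simp only [θ0, θinf]
  push_cast
  linear_combination -hT'

/-- Row n + 1 yields the complementary weight ℓ_{n+1}/(k_{n+1}+ℓ_{n+1}) = θ_n^∞/(θ_n^0+θ_n^∞), by
the same hypothesis. -/
theorem expAct_gexp_add_one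
    (hT : ∀ n : ZMod T.N, T.k (n - 1) * T.k (n + 1) = T.ℓ (n - 1) * T.ℓ (n + 1))
    {r : T.Root} (h0 : (r.2 : ℤ) = 0) {c : T.Center} (h : c.1 = r.1 + 1) :
    T.expAct r (T.gexp c) =
      T.gexp c + Pi.single r ((1 - T.ω r.1) - if 0 < (c.2 : ℤ) then 0 else 1) := by
  have hne := T.add_one_ne r.1
  rw [T.expAct_of_eq_zero h0, T.extend_gexp _ _ _ (by omega) (by omega),
    T.extend_gexp _ _ _ (by omega) (by omega), slope_gexp, slope_gexp,
    if_pos h.symm, if_neg (h.symm ▸ (T.add_one_ne_sub_one r.1).symm),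
    if_neg (show ¬ (T.near r).1 = c.1 from h.symm ▸ hne.symm),
    if_neg (show ¬ (T.far r).1 = c.1 from h.symm ▸ hne.symm), jump_zero]
  congr 2
  have hT' : (T.k (r.1 - 1) : ℚ) * T.k (r.1 + 1) = T.ℓ (r.1 - 1) * T.ℓ (r.1 + 1) := by
    exact_mod_cast hT r.1
  have hs := T.k_add_ℓ_pos (r.1 + 1)
  obtain ⟨h1, h2⟩ := T.θ_pos r.1
  rw [add_zero, add_zero, zero_add]
  congr 1
  have hω : 1 - T.ω r.1 = T.θinf r.1 / (T.θ0 r.1 + T.θinf r.1) := by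
    rw [ω]
    field_simp
    ring
  rw [show T.k c.1 = T.k (r.1 + 1) by rw [h], show T.ℓ c.1 = T.ℓ (r.1 + 1) by rw [h], hω,
    div_eq_div_iff hs.ne' (by positivity)]
  simp only [θ0, θinf]
  push_cast
  linear_combination -hT'

end TropicalDatum
end

noncomputable section

/-! ### Powers of an ideal through a one-parameter deformation -/

section Deformation

open Polynomial

variable {R : Type*} [CommRing R] {I : Ideal R} {b : R →+* R[X]}

/-- If `b` maps `R` to the Rees algebra of `I`, splits the specialization at `1` and maps `I` to
multiples of the variable, then `b` detects the powers of `I`. -/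
theorem Ideal.mem_pow_iff_X_pow_dvd (hb : ∀ f, b f ∈ reesAlgebra I)
    (hb1 : ∀ f, (b f).eval 1 = f) (hbI : ∀ f ∈ I, X ∣ b f) (f : R) (n : ℕ) :
    f ∈ I ^ n ↔ X ^ n ∣ b f := by
  constructor
  · intro hf
    have h1 : I.map b ≤ Ideal.span {X} := by
      rw [Ideal.map_le_iff_le_comap]
      intro g hg
      rw [Ideal.mem_comap, Ideal.mem_span_singleton]
      exact hbI g hg
    have h2 : b f ∈ (I ^ n).map b := Ideal.mem_map_of_mem b hf
    rw [Ideal.map_pow] at h2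
    have h3 := Ideal.pow_right_mono h1 n h2
    rwa [Ideal.span_singleton_pow, Ideal.mem_span_singleton] at h3
  · intro h
    -- The coefficients of `b f` in degrees below n vanish, and the i-th one lies in I^i. Their sum,
    -- the value at 1, is f.
    rw [X_pow_dvd_iff] at h
    rw [← hb1 f, eval_eq_sum_range]
    refine Ideal.sum_mem _ fun i _ => ?_
    rw [one_pow, mul_one]
    by_cases hi : i < n
    · rw [h i hi]
      exact Ideal.zero_mem _
    · exact Ideal.pow_le_pow_right (not_lt.1 hi) ((mem_reesAlgebra_iff I (b f)).1 (hb f) i)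

end Deformation

/-! ### Division by a linear form -/

namespace MvPolynomial

variable {σ K : Type*} [CommRing K]

/-- The coefficients of a quotient by the linear form `X_i + γ X_j` inherit every property of the
coefficients of the dividend which is compatible with the division algorithm. -/
theorem coeff_of_linear_mul [DecidableEq σ] {i j : σ} (hij : i ≠ j) (γ : K) (S : (σ →₀ ℕ) → K → Prop)
    (hsub : ∀ m x y, S m x → S m y → S m (x - y))
    (hγ : ∀ m x, S (m + Finsupp.single i 1) x → S (m + Finsupp.single j 1) (γ * x))
    {g : MvPolynomial σ K} (h : ∀ m, S m (coeff (m + Finsupp.single i 1) ((X i + C γ * X j) * g)))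
    (m : σ →₀ ℕ) : S m (coeff m g) := by
  -- Comparing coefficients at m + e_i + e_j expresses the coefficient of g at m + e_j through the
  -- dividend and γ times the coefficient at m + e_i, where the exponent of X_j is smaller by one.
  induction hm : m j generalizing m with
  | zero =>
    have := h m
    rw [add_mul, coeff_add, add_comm m, coeff_X_mul, mul_assoc, coeff_C_mul, coeff_X_mul',
      if_neg, mul_zero, add_zero] at this
    · exact this
    · simp [hm, hij]
  | succ k ih =>
    obtain ⟨m, rfl⟩ : ∃ m', m = m' + Finsupp.single j 1 := by
      refine ⟨m - Finsupp.single j 1, (tsub_add_cancel_of_le ?_).symm⟩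
      rw [Finsupp.single_le_iff]
      omega
    have h1 := h (m + Finsupp.single j 1)
    have h2 := hγ m _ (ih (m + Finsupp.single i 1) (by simpa [hij] using hm))
    have e : coeff (m + Finsupp.single j 1 + Finsupp.single i 1) ((X i + C γ * X j) * g) =
        coeff (m + Finsupp.single j 1) g + γ * coeff (m + Finsupp.single i 1) g := by
      rw [add_mul, coeff_add, add_comm _ (Finsupp.single i 1), coeff_X_mul, mul_assoc, coeff_C_mul,
        show Finsupp.single i 1 + (m + Finsupp.single j 1) =
          Finsupp.single j 1 + (m + Finsupp.single i 1) by abel, coeff_X_mul]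
    rw [e] at h1
    have h3 := hsub _ _ _ h1 h2
    rwa [add_sub_cancel_right] at h3

/-- Reduction modulo the linear form `X_i + γ X_j`. -/
def reduceLinear [DecidableEq σ] (i j : σ) (γ : K) : MvPolynomial σ K →ₐ[K] MvPolynomial σ K :=
  aeval fun z => if z = i then -(C γ * X j) else X z

theorem linear_dvd_iff [DecidableEq σ] {i j : σ} (hij : i ≠ j) (γ : K) (f : MvPolynomial σ K) :
    X i + C γ * X j ∣ f ↔ reduceLinear i j γ f = 0 := by
  constructor
  · rintro ⟨g, rfl⟩
    simp [reduceLinear, hij.symm, algebraMap_eq]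
  · intro h
    have : ∀ p : MvPolynomial σ K, X i + C γ * X j ∣ p - reduceLinear i j γ p := by
      intro p
      induction p using MvPolynomial.induction_on with
      | C a => simp [reduceLinear, algebraMap_eq]
      | add p q hp hq =>
        rw [map_add, add_sub_add_comm]
        exact dvd_add hp hq
      | mul_X p z hp =>
        have hz : X i + C γ * X j ∣ X z - reduceLinear i j γ (X z) := by
          by_cases hz : z = i
          · simp [reduceLinear, hz]
          · simp [reduceLinear, hz]
        rw [map_mul, show p * X z - reduceLinear i j γ p * reduceLinear i j γ (X z) =
          (p - reduceLinear i j γ p) * X z +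
            reduceLinear i j γ p * (X z - reduceLinear i j γ (X z)) by ring]
        exact dvd_add (hp.mul_right _) (hz.mul_left _)
    simpa [h] using this f

/-- The multiples of the form are the kernel of the reduction, an endomorphism of a domain. -/
theorem prime_linear [IsDomain K] [DecidableEq σ] {i j : σ} (hij : i ≠ j) (γ : K) :
    Prime (X i + C γ * X j : MvPolynomial σ K) := by
  refine ⟨?_, ?_, ?_⟩
  · intro h
    have := congrArg (coeff (Finsupp.single i 1)) h
    simp [coeff_X, coeff_C_mul, Finsupp.single_left_inj, hij.symm] at this
  · intro h
    have := (linear_dvd_iff hij γ 1).1 h.dvd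
    simp at this
  · intro p q h
    rw [linear_dvd_iff hij, map_mul, mul_eq_zero] at h
    rwa [linear_dvd_iff hij, linear_dvd_iff hij]

end MvPolynomial

namespace TropicalDatum
variable (T : TropicalDatum)

/-! ### Multihomogeneous polynomials -/

/-- `f` is multihomogeneous of multidegree `d`. -/
def IsMultihomogeneous {A : Type*} [CommSemiring A] (d : ZMod T.N → ℤ) (f : MvPolynomial T.Coord A) :
    Prop :=
  ∀ m, f.coeff m ≠ 0 → ∀ n, ((m (n, 0) : ℕ) : ℤ) + (m (n, 1) : ℕ) = d n

theorem mem_iInf_weightedHomogeneousSubmodule (d : ZMod T.N → ℤ) (f : MvPolynomial T.Coord T.K) :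
    f ∈ (⨅ n : ZMod T.N, MvPolynomial.weightedHomogeneousSubmodule T.K
      (fun z : T.Coord => if z.1 = n then (1 : ℤ) else 0) (d n)) ↔ T.IsMultihomogeneous d f := by
  have hw : ∀ (m : T.Coord →₀ ℕ) n, Finsupp.weight (fun z : T.Coord => if z.1 = n then (1 : ℤ) else 0) m
      = ((m (n, 0) : ℕ) : ℤ) + (m (n, 1) : ℕ) := by
    intro m n
    rw [Finsupp.weight_apply, Finsupp.sum_fintype _ _ (by simp), Fintype.sum_prod_type]
    simp
  simp only [Submodule.mem_iInf, MvPolynomial.mem_weightedHomogeneousSubmodule,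
    MvPolynomial.IsWeightedHomogeneous, hw]
  exact ⟨fun h m hm n => h n hm, fun h n m hm => h m hm n⟩

section Multihomogeneous

variable {T} {A B : Type*} [CommRing A] [CommRing B] {d d' : ZMod T.N → ℤ}
  {f g : MvPolynomial T.Coord A}

theorem IsMultihomogeneous.nonneg (hf : T.IsMultihomogeneous d f) (h : f ≠ 0) (n : ZMod T.N) :
    0 ≤ d n := by
  obtain ⟨m, hm⟩ := MvPolynomial.ne_zero_iff.1 h
  rw [← hf m hm n]
  positivity

theorem IsMultihomogeneous.of_eq (hf : T.IsMultihomogeneous d f) (h : d = d') :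
    T.IsMultihomogeneous d' f := h ▸ hf

theorem IsMultihomogeneous.zero : T.IsMultihomogeneous d (0 : MvPolynomial T.Coord A) := by
  intro m hm
  simp at hm

theorem IsMultihomogeneous.add (hf : T.IsMultihomogeneous d f) (hg : T.IsMultihomogeneous d g) :
    T.IsMultihomogeneous d (f + g) := by
  intro m hm
  by_cases h : f.coeff m = 0
  · refine hg m fun h' => hm ?_
    rw [MvPolynomial.coeff_add, h, h', add_zero]
  · exact hf m h

theorem IsMultihomogeneous.mul (hf : T.IsMultihomogeneous d f) (hg : T.IsMultihomogeneous d' g) :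
    T.IsMultihomogeneous (d + d') (f * g) := by
  classical
  intro m hm n
  rw [MvPolynomial.coeff_mul] at hm
  obtain ⟨⟨p, q⟩, hpq, h⟩ := Finset.exists_ne_zero_of_sum_ne_zero hm
  have h1 := hf p (left_ne_zero_of_mul h) n
  have h2 := hg q (right_ne_zero_of_mul h) n
  rw [Finset.HasAntidiagonal.mem_antidiagonal] at hpq
  rw [← hpq, Pi.add_apply, ← h1, ← h2]
  simp only [Finsupp.add_apply]
  push_cast
  ring

theorem IsMultihomogeneous.one : T.IsMultihomogeneous 0 (1 : MvPolynomial T.Coord A) := by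
  classical
  intro m hm n
  rw [MvPolynomial.coeff_one] at hm
  have : 0 = m := by
    by_contra h
    exact hm (if_neg h)
  subst this
  simp

theorem IsMultihomogeneous.pow (hf : T.IsMultihomogeneous d f) (a : ℕ) :
    T.IsMultihomogeneous (a • d) (f ^ a) := by
  induction a with
  | zero => simpa using IsMultihomogeneous.one
  | succ a ih =>
    rw [pow_succ, succ_nsmul]
    exact ih.mul hf

theorem IsMultihomogeneous.map (hf : T.IsMultihomogeneous d f) (φ : A →+* B) :
    T.IsMultihomogeneous d (MvPolynomial.map φ f) := by
  intro m hm
  refine hf m fun h => hm ?_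
  rw [MvPolynomial.coeff_map, h, map_zero]

theorem IsMultihomogeneous.of_map {φ : A →+* B} (hφ : Function.Injective φ)
    (hf : T.IsMultihomogeneous d (MvPolynomial.map φ f)) : T.IsMultihomogeneous d f := by
  intro m hm
  refine hf m fun h => hm (hφ ?_)
  rw [← MvPolynomial.coeff_map, h, map_zero]

theorem IsMultihomogeneous.C_mul (hf : T.IsMultihomogeneous d f) (a : A) :
    T.IsMultihomogeneous d (MvPolynomial.C a * f) := by
  intro m hm
  rw [MvPolynomial.coeff_C_mul] at hm
  exact hf m (right_ne_zero_of_mul hm)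

theorem IsMultihomogeneous.sum {ι : Type*} {s : Finset ι} {F : ι → MvPolynomial T.Coord A}
    (h : ∀ i ∈ s, T.IsMultihomogeneous d (F i)) : T.IsMultihomogeneous d (∑ i ∈ s, F i) := by
  classical
  induction s using Finset.induction_on with
  | empty => exact IsMultihomogeneous.zero
  | insert i s hi ih =>
    rw [Finset.sum_insert hi]
    exact (h i (Finset.mem_insert_self _ _)).add
      (ih fun j hj => h j (Finset.mem_insert_of_mem hj))

theorem IsMultihomogeneous.prod {ι : Type*} {s : Finset ι} {F : ι → MvPolynomial T.Coord A}
    {D : ι → ZMod T.N → ℤ} (h : ∀ i ∈ s, T.IsMultihomogeneous (D i) (F i)) :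
    T.IsMultihomogeneous (∑ i ∈ s, D i) (∏ i ∈ s, F i) := by
  classical
  induction s using Finset.induction_on with
  | empty => exact IsMultihomogeneous.one
  | insert i s hi ih =>
    rw [Finset.prod_insert hi, Finset.sum_insert hi]
    exact (h i (Finset.mem_insert_self _ _)).mul
      (ih fun j hj => h j (Finset.mem_insert_of_mem hj))

theorem IsMultihomogeneous.X (z : T.Coord) :
    T.IsMultihomogeneous (Pi.single z.1 1) (MvPolynomial.X z : MvPolynomial T.Coord A) := by
  classical
  obtain ⟨n, i⟩ := z
  intro m hm k
  rw [MvPolynomial.coeff_X] at hm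
  split_ifs at hm with h
  · subst h
    by_cases hk : k = n
    · subst hk
      fin_cases i <;> simp
    · simp [hk]
  · simp at hm

/-- Substitution of multihomogeneous polynomials. -/
theorem IsMultihomogeneous.eval₂Hom (hf : T.IsMultihomogeneous d f)
    {D : ZMod T.N → ZMod T.N → ℤ} (φ : A →+* B) {x : T.Coord → MvPolynomial T.Coord B}
    (hx : ∀ z, T.IsMultihomogeneous (D z.1) (x z)) :
    T.IsMultihomogeneous (∑ n, d n • D n)
      (MvPolynomial.eval₂Hom (MvPolynomial.C.comp φ) x f) := by
  simp only [MvPolynomial.coe_eval₂Hom, MvPolynomial.eval₂_eq']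
  refine IsMultihomogeneous.sum fun m hm => ?_
  have h1 : T.IsMultihomogeneous (∑ z : T.Coord, m z • D z.1) (∏ z, x z ^ m z) :=
    IsMultihomogeneous.prod fun z _ => (hx z).pow _
  have h2 : ∑ z : T.Coord, m z • D z.1 = ∑ n, d n • D n := by
    rw [Fintype.sum_prod_type]
    refine Finset.sum_congr rfl fun n _ => ?_
    rw [Fin.sum_univ_two, ← hf m (MvPolynomial.mem_support_iff.1 hm) n, add_smul,
      natCast_zsmul, natCast_zsmul]
  rw [← h2]
  exact h1.C_mul _

theorem IsMultihomogeneous.linear (n : ZMod T.N) (a b : A) : T.IsMultihomogeneous (Pi.single n 1)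
    (MvPolynomial.C a * MvPolynomial.X (n, 0) + MvPolynomial.C b * MvPolynomial.X (n, 1)) := by
  exact ((IsMultihomogeneous.X (n, 0)).C_mul a).add ((IsMultihomogeneous.X (n, 1)).C_mul b)

/-- Rescaling the coordinates in each factor rescales multihomogeneous polynomials. -/
theorem IsMultihomogeneous.eval₂Hom_mul (hf : T.IsMultihomogeneous d f) (φ : A →+* B)
    (c : ZMod T.N → B) (x : T.Coord → B) :
    MvPolynomial.eval₂Hom φ (fun z => c z.1 * x z) f =
      (∏ n, c n ^ (d n).toNat) * MvPolynomial.eval₂Hom φ x f := by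
  simp only [MvPolynomial.coe_eval₂Hom, MvPolynomial.eval₂_eq', Finset.mul_sum]
  refine Finset.sum_congr rfl fun m hm => ?_
  have hd : ∀ n, (d n).toNat = m (n, 0) + m (n, 1) := by
    intro n
    have := hf m (MvPolynomial.mem_support_iff.1 hm) n
    omega
  have : ∏ z : T.Coord, (c z.1 * x z) ^ m z =
      (∏ n, c n ^ (d n).toNat) * ∏ z : T.Coord, x z ^ m z := by
    simp only [mul_pow, Finset.prod_mul_distrib]
    congr 1
    rw [Fintype.prod_prod_type]
    refine Finset.prod_congr rfl fun n _ => ?_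
    rw [Fin.prod_univ_two, hd, pow_add]
  rw [this]
  ring

end Multihomogeneous

/-- Quotients by powers of linear forms of multihomogeneous polynomials with coefficients in a
subring have the same properties. -/
theorem exists_map_eq_of_linear_mul {A : Type*} [CommRing A] {φ : A →+* T.K}
    (n : ZMod T.N) (γ : A) {g : MvPolynomial T.Coord T.K}
    {P : MvPolynomial T.Coord A}
    (h : (MvPolynomial.X (n, 0) + MvPolynomial.C (φ γ) * MvPolynomial.X (n, 1)) * g =
      MvPolynomial.map φ P) :
    ∃ Q : MvPolynomial T.Coord A, MvPolynomial.map φ Q = g := by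
  -- The form is monic in the coordinate (n, 0), so the division inverts no coefficient and the
  -- property of lying in the range of `φ` passes to the quotient.
  have key := MvPolynomial.coeff_of_linear_mul (i := (n, (0 : Fin 2))) (j := (n, 1)) (by simp) (φ γ)
    (fun _ x => x ∈ φ.range) (fun _ _ _ hx hy => sub_mem hx hy)
    (fun _ x hx => mul_mem ⟨γ, rfl⟩ hx) (g := g)
    (fun m => by rw [h, MvPolynomial.coeff_map]; exact ⟨_, rfl⟩)
  refine (MvPolynomial.mem_range_map_iff_coeffs_subset).2 ?_
  intro x hx
  obtain ⟨m, _, rfl⟩ := MvPolynomial.mem_coeffs_iff.1 hx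
  exact key m

/-- Multihomogeneity constrains each coefficient separately: it vanishes unless its exponent has
multidegree d. This condition is stable under the steps of the division, since both terms of the
form have the same multidegree. -/
theorem IsMultihomogeneous.of_linear_mul (n : ZMod T.N) (γ : T.K) {d : ZMod T.N → ℤ}
    {g : MvPolynomial T.Coord T.K} (h : T.IsMultihomogeneous (d + Pi.single n 1)
      ((MvPolynomial.X (n, 0) + MvPolynomial.C γ * MvPolynomial.X (n, 1)) * g)) :
    T.IsMultihomogeneous d g := by
  refine MvPolynomial.coeff_of_linear_mul (i := (n, (0 : Fin 2))) (j := (n, 1)) (by simp) γ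
    (fun m x => x ≠ 0 → ∀ n, ((m (n, 0) : ℕ) : ℤ) + (m (n, 1) : ℕ) = d n) ?_ ?_ ?_
  · intro m x y hx hy hxy
    by_cases h0 : x = 0
    · exact hy fun h1 => hxy (by rw [h0, h1, sub_zero])
    · exact hx h0
  · intro m x hx h0 k
    have := hx (right_ne_zero_of_mul h0) k
    simp only [Finsupp.add_apply, Finsupp.single_apply, Prod.mk.injEq] at this ⊢
    by_cases hk : n = k
    · simp [hk] at this ⊢
      linarith
    · simp [hk] at this ⊢
      exact this
  · intro m h0 k
    have := h _ h0 k
    simp only [Finsupp.add_apply, Finsupp.single_apply, Prod.mk.injEq, Pi.add_apply,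
      Pi.single_apply, eq_comm (a := k)] at this
    by_cases hk : n = k
    · simp [hk] at this
      linarith
    · simp [hk] at this
      exact this

end TropicalDatum
end

noncomputable section
namespace TropicalDatum
variable (T : TropicalDatum)

/-! ### The ideals of the centers -/

/-- The coordinate of `ℙ¹` number `n - 1` vanishing on the center `C_n^i`. -/
def side (c : T.Center) : Fin 2 := if 0 < (c.2 : ℤ) then 0 else 1

/-- The coordinate of `ℙ¹` number `n + 1` vanishing on the center `C_n^i`. -/
def coside (c : T.Center) : Fin 2 := if 0 < (c.2 : ℤ) then 1 else 0

section Forms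

variable {A B : Type*} [CommRing A] [CommRing B] (e : (T.Root → ℚ) → A) (φ : A →+* B)

/-- The linear form vanishing on the center `C_n^i`, for monomials `e`. -/
def centerForm (c : T.Center) : MvPolynomial T.Coord A :=
  MvPolynomial.X (c.1, 0) + MvPolynomial.C (e (T.gexp c)) * MvPolynomial.X (c.1, 1)

/-- The linear form vanishing on `C_n^i`, scaled as in the action on the `τ`-variables. -/
def scaledForm (c : T.Center) : MvPolynomial T.Coord A :=
  MvPolynomial.C (e (-T.ω c.1 • T.gexp c)) * T.centerForm e c

/-- The factor by which a simple reflection multiplies a homogeneous coordinate. -/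
def multiplier (r : T.Root) (z : T.Coord) : MvPolynomial T.Coord A :=
  if (r.2 : ℤ) = 0 then
    if z.1 = r.1 - 1 then T.scaledForm e (if z.2 = 0 then T.far r else T.near r)
    else if z.1 = r.1 + 1 then T.scaledForm e (if z.2 = 0 then T.near r else T.far r)
    else 1
  else 1

/-- The substitution by which a simple reflection acts on defining polynomials. -/
def substitution (s : A →+* A) (r : T.Root) : MvPolynomial T.Coord A →+* MvPolynomial T.Coord A :=
  MvPolynomial.eval₂Hom (MvPolynomial.C.comp s)
    (fun z => T.multiplier e r z * MvPolynomial.X z)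

/-- The product of linear forms split off by a simple reflection. -/
def denom (r : T.Root) (Λ : T.NS) : MvPolynomial T.Coord A :=
  if (r.2 : ℤ) = 0 then
    T.scaledForm e (T.near r) ^ (T.mult Λ (T.far r)).toNat *
      T.scaledForm e (T.far r) ^ (T.mult Λ (T.near r)).toNat
  else 1

/-- The product of linear forms acquired under a simple reflection. -/
def numer (r : T.Root) (Λ : T.NS) : MvPolynomial T.Coord A :=
  if (r.2 : ℤ) = 0 then
    T.scaledForm e (T.near r) ^ (-T.mult Λ (T.far r)).toNat *
      T.scaledForm e (T.far r) ^ (-T.mult Λ (T.near r)).toNat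
  else 1

variable {T e}

theorem map_scaledForm (c : T.Center) :
    MvPolynomial.map φ (T.scaledForm e c) = T.scaledForm (fun x => φ (e x)) c := by
  simp [scaledForm, centerForm]

theorem map_multiplier (r : T.Root) (z : T.Coord) :
    MvPolynomial.map φ (T.multiplier e r z) = T.multiplier (fun x => φ (e x)) r z := by
  unfold multiplier
  split_ifs <;> simp [map_scaledForm]

theorem map_denom (r : T.Root) (Λ : T.NS) :
    MvPolynomial.map φ (T.denom e r Λ) = T.denom (fun x => φ (e x)) r Λ := by
  unfold denom
  split_ifs <;> simp [map_scaledForm]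

theorem map_numer (r : T.Root) (Λ : T.NS) :
    MvPolynomial.map φ (T.numer e r Λ) = T.numer (fun x => φ (e x)) r Λ := by
  unfold numer
  split_ifs <;> simp [map_scaledForm]

theorem multiplier_of_ne_zero {r : T.Root} (h : (r.2 : ℤ) ≠ 0) (z : T.Coord) :
    T.multiplier e r z = 1 := by
  rw [multiplier, if_neg h]

theorem multiplier_of_ne (r : T.Root) {z : T.Coord} (h1 : z.1 ≠ r.1 - 1)
    (h2 : z.1 ≠ r.1 + 1) : T.multiplier e r z = 1 := by
  rw [multiplier, if_neg h1, if_neg h2, ite_self]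

theorem multiplier_sub_one {r : T.Root} (h : (r.2 : ℤ) = 0) (i : Fin 2) :
    T.multiplier e r (r.1 - 1, i) = T.scaledForm e (if i = 0 then T.far r else T.near r) := by
  rw [multiplier, if_pos h, if_pos rfl]

theorem multiplier_add_one {r : T.Root} (h : (r.2 : ℤ) = 0) (i : Fin 2) :
    T.multiplier e r (r.1 + 1, i) = T.scaledForm e (if i = 0 then T.near r else T.far r) := by
  rw [multiplier, if_pos h, if_neg (T.add_one_ne_sub_one _), if_pos rfl]

theorem isMultihomogeneous_scaledForm (c : T.Center) :
    T.IsMultihomogeneous (Pi.single c.1 1) (T.scaledForm e c) := by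
  have := IsMultihomogeneous.linear (T := T) c.1 1 (e (T.gexp c))
  rw [MvPolynomial.C_1, one_mul] at this
  exact this.C_mul _

end Forms

theorem centerIdeal_eq (c : T.Center) : T.centerIdeal c = Ideal.span
    {MvPolynomial.X (c.1 - 1, T.side c), T.centerForm T.mono c,
      MvPolynomial.X (c.1 + 1, T.coside c)} := by
  unfold centerIdeal side coside centerForm
  split_ifs with h
  · rw [T.u_eq c h]
  · rw [T.vInv_eq c h]

theorem X_sub_mem (c : T.Center) : MvPolynomial.X (c.1 - 1, T.side c) ∈ T.centerIdeal c := by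
  rw [centerIdeal_eq]
  exact Ideal.subset_span (by simp)

theorem X_add_mem (c : T.Center) : MvPolynomial.X (c.1 + 1, T.coside c) ∈ T.centerIdeal c := by
  rw [centerIdeal_eq]
  exact Ideal.subset_span (by simp)

theorem centerForm_mem (c : T.Center) : T.centerForm T.mono c ∈ T.centerIdeal c := by
  rw [centerIdeal_eq]
  exact Ideal.subset_span (by simp)

theorem scaledForm_mem (c : T.Center) : T.scaledForm T.mono c ∈ T.centerIdeal c :=
  Ideal.mul_mem_left _ _ (T.centerForm_mem c)

theorem centerIdeal_le {c : T.Center} {I : Ideal (MvPolynomial T.Coord T.K)}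
    (h1 : MvPolynomial.X (c.1 - 1, T.side c) ∈ I) (h2 : T.centerForm T.mono c ∈ I)
    (h3 : MvPolynomial.X (c.1 + 1, T.coside c) ∈ I) : T.centerIdeal c ≤ I := by
  rw [centerIdeal_eq, Ideal.span_le]
  rintro x (rfl | rfl | rfl) <;> assumption

/-- A point of the center lying on no other center. -/
def point (c : T.Center) (z : T.Coord) : T.K :=
  if z = (c.1 - 1, T.side c) ∨ z = (c.1 + 1, T.coside c) then 0
  else if z = (c.1, 0) then -T.mono (T.gexp c) else 1

theorem point_row (c : T.Center) (i : Fin 2) :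
    T.point c (c.1, i) = if i = 0 then -T.mono (T.gexp c) else 1 := by
  have h1 := T.sub_one_ne c.1
  have h2 := T.add_one_ne c.1
  simp [point, Prod.ext_iff, h1.symm, h2.symm]

theorem centerIdeal_le_ker_eval (c : T.Center) :
    T.centerIdeal c ≤ RingHom.ker (MvPolynomial.eval (T.point c)) := by
  refine T.centerIdeal_le ?_ ?_ ?_
  · simp [RingHom.mem_ker, point]
  · simp [RingHom.mem_ker, centerForm, point_row]
  · simp [RingHom.mem_ker, point]

/-- The slope at `c` tells the two apart. Within a row the slopes differ by the sign of the index;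
for different rows the slope of `gexp c` is ±(1/(k+ℓ) - 1), which is nonzero because k + ℓ ≥ 2. -/
theorem gexp_ne {c c' : T.Center} (h : c ≠ c') : T.gexp c ≠ T.gexp c' := by
  intro h'
  have hc := (T.center_mem c).1
  have hc' := (T.center_mem c').1
  have e1 : T.slope (T.gexp c) c = T.slope (T.gexp c') c := by rw [h']
  have hpos := T.k_add_ℓ_pos c.1
  have hk : (1 : ℚ) ≤ T.k c.1 := by exact_mod_cast T.k_pos c.1
  have hl : (1 : ℚ) ≤ T.ℓ c.1 := by exact_mod_cast T.ℓ_pos c.1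
  by_cases hn : c.1 = c'.1
  · have h2 : ¬ (c.2 : ℤ) = c'.2 := fun h2 => h (T.center_ext hn h2)
    rw [slope_gexp, slope_gexp, if_pos rfl, if_pos rfl, if_pos hn, if_neg h2, sub_zero,
      show T.k c'.1 = T.k c.1 by rw [hn], show T.ℓ c'.1 = T.ℓ c.1 by rw [hn]] at e1
    have : (c.2 : ℤ).sign = 0 := by
      have : ((c.2 : ℤ).sign : ℚ) = 0 := by linarith
      exact_mod_cast this
    exact hc (Int.sign_eq_zero_iff_zero.1 this)
  · rw [slope_gexp, slope_gexp, if_pos rfl, if_pos rfl, if_neg hn] at e1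
    have : ((c.2 : ℤ).sign : ℚ) * (1 - (T.k c.1 + T.ℓ c.1)) = 0 := by
      field_simp at e1
      linarith
    rcases mul_eq_zero.1 this with h1 | h1
    · exact hc (Int.sign_eq_zero_iff_zero.1 (by exact_mod_cast h1))
    · linarith

/-- This is what makes the forms of the other centers cancellable when multiplicities along `c` are
computed. -/
theorem eval_point_scaledForm {c c' : T.Center} (h : c ≠ c') :
    MvPolynomial.eval (T.point c) (T.scaledForm T.mono c') ≠ 0 := by
  have hne := T.mono_injective.ne (T.gexp_ne h)
  simp only [scaledForm, centerForm, map_mul, map_add, MvPolynomial.eval_C, MvPolynomial.eval_X]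
  refine mul_ne_zero (T.mono_ne_zero _) ?_
  by_cases hn : c'.1 = c.1
  · rw [hn, point_row, point_row]
    simp only [if_true, one_ne_zero, if_false, mul_one]
    rw [neg_add_eq_sub, sub_ne_zero]
    exact hne.symm
  · have hx : ∀ i, T.point c (c'.1, i) = 0 ∨ T.point c (c'.1, i) = 1 := by
      intro i
      unfold point
      split_ifs with h1 h2
      · exact Or.inl rfl
      · exact absurd (congrArg Prod.fst h2) hn
      · exact Or.inr rfl
    -- The two vanishing coordinates of the point lie in the rows n - 1 and n + 1, which are
    -- distinct because N ≥ 3.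
    have h01 : ¬ (T.point c (c'.1, 0) = 0 ∧ T.point c (c'.1, 1) = 0) := by
      rintro ⟨h0, h1⟩
      simp only [point, Prod.mk.injEq, hn, false_and, if_false] at h0 h1
      have hs : T.coside c = 1 - T.side c := by
        unfold coside side; split_ifs <;> rfl
      have hne' := T.add_one_ne_sub_one c.1
      rw [hs] at h0 h1
      rcases (show T.side c = 0 ∨ T.side c = 1 by unfold side; split_ifs <;> simp) with h | h
      · simp [h] at h0 h1
        exact hne' (h1.symm.trans h0)
      · simp [h] at h0 h1
        exact hne' (h0.symm.trans h1)
    rcases hx 0 with h0 | h0 <;> rcases hx 1 with h1 | h1 <;> rw [h0, h1]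
    · exact absurd ⟨h0, h1⟩ h01
    · simpa using T.mono_ne_zero _
    · simp
    · have := T.mono_add_mono_ne_zero 0 (T.gexp c')
      rw [mono_zero] at this
      simpa using this

/-! ### Multiplicities along the centers -/

/-- The deformation of the coordinate ring along a center. -/
def blow (c : T.Center) :
    MvPolynomial T.Coord T.K →+* Polynomial (MvPolynomial T.Coord T.K) :=
  MvPolynomial.eval₂Hom (Polynomial.C.comp MvPolynomial.C) fun z =>
    if z = (c.1 - 1, T.side c) ∨ z = (c.1 + 1, T.coside c) then
      Polynomial.X * Polynomial.C (MvPolynomial.X z)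
    else if z = (c.1, 0) then Polynomial.X * Polynomial.C (T.centerForm T.mono c) -
      Polynomial.C (MvPolynomial.C (T.mono (T.gexp c)) * MvPolynomial.X (c.1, 1))
    else Polynomial.C (MvPolynomial.X z)

theorem blow_C (c : T.Center) (a : T.K) :
    T.blow c (MvPolynomial.C a) = Polynomial.C (MvPolynomial.C a) := by
  simp [blow]

theorem blow_X_row (c : T.Center) (i : Fin 2) : T.blow c (MvPolynomial.X (c.1, i)) =
    if i = 0 then Polynomial.X * Polynomial.C (T.centerForm T.mono c) -
      Polynomial.C (MvPolynomial.C (T.mono (T.gexp c)) * MvPolynomial.X (c.1, 1))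
    else Polynomial.C (MvPolynomial.X (c.1, i)) := by
  have h1 := T.sub_one_ne c.1
  have h2 := T.add_one_ne c.1
  simp [blow, h1.symm, h2.symm]

/-- In `blow` the coordinate ζ_n^0 is written as the linear form minus a multiple of ζ_n^∞, and the
deformation variable is put on the form. Thus all three generators of the ideal are scaled alike. -/
theorem blow_centerForm (c : T.Center) : T.blow c (T.centerForm T.mono c) =
    Polynomial.X * Polynomial.C (T.centerForm T.mono c) := by
  conv_lhs => rw [centerForm]
  rw [map_add, map_mul, blow_X_row, blow_X_row, blow_C, if_pos rfl, if_neg (by simp),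
    Polynomial.C_mul]
  ring

theorem mul_C_mem_reesAlgebra {R : Type*} [CommRing R] {I : Ideal R} {a : R} (h : a ∈ I) :
    Polynomial.X * Polynomial.C a ∈ reesAlgebra I := by
  rw [mul_comm, Polynomial.C_mul_X_eq_monomial]
  exact reesAlgebra.monomial_mem.2 (by simpa using h)

theorem blow_mem_reesAlgebra (c : T.Center) (f : MvPolynomial T.Coord T.K) :
    T.blow c f ∈ reesAlgebra (T.centerIdeal c) := by
  have hC : ∀ a, Polynomial.C a ∈ reesAlgebra (T.centerIdeal c) :=
    fun a => (reesAlgebra (T.centerIdeal c)).algebraMap_mem a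
  induction f using MvPolynomial.induction_on with
  | C a => rw [blow_C]; exact hC _
  | add p q hp hq => rw [map_add]; exact add_mem hp hq
  | mul_X p z hp =>
    rw [map_mul]
    refine mul_mem hp ?_
    rw [blow, MvPolynomial.coe_eval₂Hom, MvPolynomial.eval₂_X]
    split_ifs with h1 h2
    · rcases h1 with rfl | rfl
      · exact mul_C_mem_reesAlgebra (T.X_sub_mem c)
      · exact mul_C_mem_reesAlgebra (T.X_add_mem c)
    · exact sub_mem (mul_C_mem_reesAlgebra (T.centerForm_mem c)) (hC _)
    · exact hC _

theorem eval_one_blow (c : T.Center) (f : MvPolynomial T.Coord T.K) :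
    (T.blow c f).eval 1 = f := by
  induction f using MvPolynomial.induction_on with
  | C a => simp [blow_C]
  | add p q hp hq => rw [map_add, Polynomial.eval_add, hp, hq]
  | mul_X p z hp =>
    rw [map_mul, Polynomial.eval_mul, hp]
    congr 1
    rw [blow, MvPolynomial.coe_eval₂Hom, MvPolynomial.eval₂_X]
    split_ifs with h1 h2
    · simp
    · simp [h2, centerForm]
    · simp

theorem X_dvd_blow (c : T.Center) (f : MvPolynomial T.Coord T.K) (hf : f ∈ T.centerIdeal c) :
    Polynomial.X ∣ T.blow c f := by
  have : T.centerIdeal c ≤ (Ideal.span {Polynomial.X}).comap (T.blow c) := by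
    refine T.centerIdeal_le ?_ ?_ ?_ <;> rw [Ideal.mem_comap, Ideal.mem_span_singleton]
    · simp [blow]
    · rw [blow_centerForm]; exact dvd_mul_right _ _
    · simp [blow]
  have h := this hf
  rwa [Ideal.mem_comap, Ideal.mem_span_singleton] at h

/-- Multiplicity along a center becomes the order in the deformation variable, a prime of a
polynomial ring over a domain. This is the source of its additivity. -/
theorem mem_centerIdeal_pow (c : T.Center) (f : MvPolynomial T.Coord T.K) (n : ℕ) :
    f ∈ T.centerIdeal c ^ n ↔ Polynomial.X ^ n ∣ T.blow c f :=
  Ideal.mem_pow_iff_X_pow_dvd (T.blow_mem_reesAlgebra c) (T.eval_one_blow c) (T.X_dvd_blow c) f n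

theorem not_X_dvd_blow {c : T.Center} {G : MvPolynomial T.Coord T.K}
    (hG : MvPolynomial.eval (T.point c) G ≠ 0) : ¬ Polynomial.X ∣ T.blow c G := by
  intro h
  have : G ∈ T.centerIdeal c ^ 1 := by rwa [mem_centerIdeal_pow, pow_one]
  rw [pow_one] at this
  exact hG (T.centerIdeal_le_ker_eval c this)

theorem mem_pow_of_mul {c : T.Center} {G Q : MvPolynomial T.Coord T.K} {n : ℕ}
    (hG : MvPolynomial.eval (T.point c) G ≠ 0) (h : G * Q ∈ T.centerIdeal c ^ n) :
    Q ∈ T.centerIdeal c ^ n := by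
  rw [mem_centerIdeal_pow, map_mul] at h
  rw [mem_centerIdeal_pow]
  exact Polynomial.prime_X.pow_dvd_of_dvd_mul_left n (T.not_X_dvd_blow hG) h

theorem centerForm_ne_zero (c : T.Center) : T.centerForm T.mono c ≠ 0 :=
  (MvPolynomial.prime_linear (i := ((c.1, 0) : T.Coord)) (j := (c.1, 1)) (by simp) _).ne_zero

theorem scaledForm_ne_zero (c : T.Center) : T.scaledForm T.mono c ≠ 0 :=
  mul_ne_zero (by simpa using T.mono_ne_zero _) (T.centerForm_ne_zero c)

/-- The form of a center has order exactly one there: its image is the deformation variable times a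
constant which that variable does not divide. When a ≥ n the truncated exponent makes the assertion
void. -/
theorem mem_pow_of_scaledForm_pow_mul {c : T.Center} {Q : MvPolynomial T.Coord T.K} {n a : ℕ}
    (h : T.scaledForm T.mono c ^ a * Q ∈ T.centerIdeal c ^ n) : Q ∈ T.centerIdeal c ^ (n - a) := by
  rcases le_total n a with hna | hna
  · rw [Nat.sub_eq_zero_of_le hna, pow_zero, Ideal.one_eq_top]
    exact Submodule.mem_top
  · obtain ⟨k, rfl⟩ := Nat.exists_eq_add_of_le hna
    rw [Nat.add_sub_cancel_left]
    have hb : T.blow c (T.scaledForm T.mono c) =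
        Polynomial.X * Polynomial.C (T.scaledForm T.mono c) := by
      rw [scaledForm, map_mul, blow_C, blow_centerForm, Polynomial.C_mul]
      ring
    rw [mem_centerIdeal_pow, map_mul, map_pow, hb, mul_pow, mul_assoc, pow_add,
      mul_dvd_mul_iff_left (pow_ne_zero _ Polynomial.X_ne_zero)] at h
    rw [mem_centerIdeal_pow]
    refine Polynomial.prime_X.pow_dvd_of_dvd_mul_left k ?_ h
    rw [← Polynomial.C_pow, Polynomial.X_dvd_iff, Polynomial.coeff_C_zero]
    exact pow_ne_zero _ (T.scaledForm_ne_zero c)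

theorem prime_scaledForm (c : T.Center) : Prime (T.scaledForm T.mono c) := by
  have h : Associated (T.centerForm T.mono c) (T.scaledForm T.mono c) := by
    exact associated_unit_mul_right _ _ ((T.mono_ne_zero _).isUnit.map MvPolynomial.C)
  exact h.prime (MvPolynomial.prime_linear (by simp) _)

theorem not_scaledForm_dvd {c c' : T.Center} (h : c ≠ c') :
    ¬ T.scaledForm T.mono c ∣ T.scaledForm T.mono c' := by
  rintro ⟨q, hq⟩
  have := T.eval_point_scaledForm h
  rw [hq, map_mul, T.centerIdeal_le_ker_eval c (T.scaledForm_mem c), zero_mul] at this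
  exact this rfl

theorem IsMultihomogeneous.of_scaledForm_pow_mul {T : TropicalDatum} (c : T.Center)
    {d : ZMod T.N → ℤ} {g : MvPolynomial T.Coord T.K} {a : ℕ}
    (h : T.IsMultihomogeneous (d + a • Pi.single c.1 1) (T.scaledForm T.mono c ^ a * g)) :
    T.IsMultihomogeneous d g := by
  induction a generalizing d with
  | zero => simpa using h
  | succ a ih =>
    refine ih (d := d) (IsMultihomogeneous.of_linear_mul T c.1 (T.mono (T.gexp c)) ?_)
    have h' := h.C_mul (T.mono (T.ω c.1 • T.gexp c))
    rw [succ_nsmul, ← add_assoc] at h'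
    have e : MvPolynomial.C (T.mono (T.ω c.1 • T.gexp c)) * (T.scaledForm T.mono c ^ (a + 1) * g) =
        T.centerForm T.mono c * (T.scaledForm T.mono c ^ a * g) := by
      rw [pow_succ, scaledForm, show ∀ x y z w t : MvPolynomial T.Coord T.K,
        t * (x * (y * z) * w) = (t * y) * (z * (x * w)) by intros; ring, ← MvPolynomial.C_mul,
        ← mono_add, neg_smul, add_neg_cancel, mono_zero, MvPolynomial.C_1, one_mul]
    rw [e] at h'
    exact h'

end TropicalDatum
end

noncomputable section
namespace TropicalDatum
variable (T : TropicalDatum)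

/-! ### The action of simple reflections on linear systems -/

/-- The semilinear substitution over `𝕂` attached to a simple reflection. -/
abbrev subK (r : T.Root) : MvPolynomial T.Coord T.K →+* MvPolynomial T.Coord T.K :=
  T.substitution T.mono (T.sK r : T.K →+* T.K) r

theorem subK_X (r : T.Root) (z : T.Coord) :
    T.subK r (MvPolynomial.X z) = T.multiplier T.mono r z * MvPolynomial.X z := by
  simp [substitution]

theorem subK_C (r : T.Root) (a : T.K) :
    T.subK r (MvPolynomial.C a) = MvPolynomial.C (T.sK r a) := by
  simp [substitution]

theorem row_ne (n : ZMod T.N) : n ≠ n - 1 ∧ n ≠ n + 1 :=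
  ⟨(T.sub_one_ne n).symm, (T.add_one_ne n).symm⟩

theorem multiplier_row {A : Type*} [CommRing A] {e : (T.Root → ℚ) → A} {r : T.Root} {c : T.Center}
    (h : (r.2 : ℤ) ≠ 0 ∨ c.1 = r.1) (i : Fin 2) : T.multiplier e r (c.1, i) = 1 := by
  rcases h with h | h
  · exact multiplier_of_ne_zero h _
  · exact multiplier_of_ne r (by rw [h]; exact (T.row_ne _).1) (by rw [h]; exact (T.row_ne _).2)

theorem subK_centerForm {r : T.Root} {c : T.Center} (h : (r.2 : ℤ) ≠ 0 ∨ c.1 = r.1) :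
    T.subK r (T.centerForm T.mono c) = T.centerForm T.mono (T.perm r c) := by
  rw [centerForm, centerForm, map_add, map_mul, subK_X, subK_X, subK_C, T.multiplier_row h,
    T.multiplier_row h, one_mul, one_mul, sK_mono, T.expAct_gexp h, perm_fst]

theorem expAct_smul (r : T.Root) (q : ℚ) (x : T.Root → ℚ) :
    T.expAct r (q • x) = q • T.expAct r x :=
  map_rat_smul (T.expAct r) q x

theorem subK_scaledForm {r : T.Root} {c : T.Center} (h : (r.2 : ℤ) ≠ 0 ∨ c.1 = r.1) :
    T.subK r (T.scaledForm T.mono c) = T.scaledForm T.mono (T.perm r c) := by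
  rw [scaledForm, scaledForm, map_mul, subK_C, T.subK_centerForm h, sK_mono, expAct_smul,
    T.expAct_gexp h, perm_fst]

theorem side_perm {r : T.Root} (h : (r.2 : ℤ) ≠ 0) (c : T.Center) :
    T.side (T.perm r c) = T.side c ∧ T.coside (T.perm r c) = T.coside c := by
  have e : (0 < ((T.perm r c).2 : ℤ)) ↔ 0 < (c.2 : ℤ) := by
    have h1 := T.near_sign h
    have h2 := T.far_sign h
    have h3 : ((T.near r).2 : ℤ).sign = ((T.far r).2 : ℤ).sign := h1.trans h2.symm
    have key : ∀ x y : ℤ, x.sign = y.sign → (0 < x ↔ 0 < y) := by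
      intro x y hxy
      rw [← Int.sign_eq_one_iff_pos, hxy, Int.sign_eq_one_iff_pos]
    by_cases hc : c = T.near r
    · rw [hc, perm_near]; exact key _ _ h3.symm
    by_cases hc' : c = T.far r
    · rw [hc', perm_far]; exact key _ _ h3
    · rw [T.perm_of_ne r c hc hc']
  simp only [side, coside, e, and_self]

theorem X_dvd_subK_X (r : T.Root) (z : T.Coord) :
    (MvPolynomial.X z : MvPolynomial T.Coord T.K) ∣ T.subK r (MvPolynomial.X z) := by
  rw [subK_X]
  exact dvd_mul_left _ _

theorem centerIdeal_le_comap_of_ne_zero {r : T.Root} (h : (r.2 : ℤ) ≠ 0) (c : T.Center) :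
    T.centerIdeal c ≤ (T.centerIdeal (T.perm r c)).comap (T.subK r) := by
  obtain ⟨h1, h2⟩ := T.side_perm h c
  have h3 := T.X_sub_mem (T.perm r c)
  have h4 := T.X_add_mem (T.perm r c)
  rw [perm_fst] at h3 h4
  refine T.centerIdeal_le ?_ ?_ ?_ <;> rw [Ideal.mem_comap]
  · exact Ideal.mem_of_dvd _ (T.X_dvd_subK_X r _) (h1 ▸ h3)
  · rw [T.subK_centerForm (Or.inl h)]
    exact T.centerForm_mem _
  · exact Ideal.mem_of_dvd _ (T.X_dvd_subK_X r _) (h2 ▸ h4)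

/-- The linear form of a neighbouring row is preserved modulo one of the coordinates. -/
theorem mul_add_mem_ideal {S : Type*} [CommRing S] {I : Ideal S} {x₀ x₁ y₀ y₁ a b p p' g γ : S}
    (hI : y₀ + γ * y₁ ∈ I) (h : x₁ ∈ I ∧ g * b = γ * a ∨ x₀ ∈ I ∧ g * (b * p') = γ * (a * p)) :
    a * (x₀ + p * x₁) * y₀ + g * (b * (x₀ + p' * x₁) * y₁) ∈ I := by
  rcases h with ⟨hx, h⟩ | ⟨hx, h⟩
  · have e : a * (x₀ + p * x₁) * y₀ + g * (b * (x₀ + p' * x₁) * y₁) =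
        (a * x₀) * (y₀ + γ * y₁) + (a * p * y₀ + g * b * p' * y₁) * x₁ := by
      linear_combination (x₀ * y₁) * h
    rw [e]
    exact add_mem (I.mul_mem_left _ hI) (I.mul_mem_left _ hx)
  · have e : a * (x₀ + p * x₁) * y₀ + g * (b * (x₀ + p' * x₁) * y₁) =
        (a * p * x₁) * (y₀ + γ * y₁) + (a * y₀ + g * b * y₁) * x₀ := by
      linear_combination (x₁ * y₁) * h
    rw [e]
    exact add_mem (I.mul_mem_left _ hI) (I.mul_mem_left _ hx)

theorem scaledForm_dvd_iff (c : T.Center) (f : MvPolynomial T.Coord T.K) :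
    T.scaledForm T.mono c ∣ f ↔ T.centerForm T.mono c ∣ f :=
  ((T.mono_ne_zero _).isUnit.map MvPolynomial.C).mul_left_dvd

/-! ### Reflections at the roots α_n^0 -/

section ZeroRoot

variable {T}
variable (hT : ∀ n : ZMod T.N, T.k (n - 1) * T.k (n + 1) = T.ℓ (n - 1) * T.ℓ (n + 1))
  {r : T.Root} (h0 : (r.2 : ℤ) = 0)
include h0

theorem gexp_near_of_eq_zero : T.gexp (T.near r) = T.gexp (T.far r) + Pi.single r 1 := by
  rw [gexp_near, if_pos h0]

theorem side_near : T.side (T.near r) = 0 ∧ T.coside (T.near r) = 1 := by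
  simp [side, coside, near_snd, h0]

theorem side_far : T.side (T.far r) = 1 ∧ T.coside (T.far r) = 0 := by
  simp [side, coside, far_snd, h0]

include hT in
-- For a center in row n ± 1, one coordinate of row n lies in its ideal. Modulo that coordinate the
-- two multipliers become multiples of the same remaining coordinate, and their ratio, a power of
-- a_n^0, compensates the change of the parameter. The four cases are the two rows and the two
-- signs.
theorem subK_centerForm_mem (c : T.Center) (hc : c.1 ≠ r.1) :
    T.subK r (T.centerForm T.mono c) ∈ T.centerIdeal c := by
  have hg := gexp_near_of_eq_zero h0
  have hsm : ∀ q : ℚ, (Pi.single r q : T.Root → ℚ) = q • Pi.single r 1 := by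
    intro q
    rw [← Pi.single_smul, smul_eq_mul, mul_one]
  have hX1 := T.X_sub_mem c
  have hX2 := T.X_add_mem c
  have hF := T.centerForm_mem c
  by_cases h1 : c.1 = r.1 - 1
  · have e : T.subK r (T.centerForm T.mono c) = T.scaledForm T.mono (T.far r) *
        MvPolynomial.X (c.1, 0) + MvPolynomial.C (T.mono (T.expAct r (T.gexp c))) *
          (T.scaledForm T.mono (T.near r) * MvPolynomial.X (c.1, 1)) := by
      rw [centerForm, map_add, map_mul, subK_X, subK_X, subK_C, h1, multiplier_sub_one h0,
        multiplier_sub_one h0, sK_mono, if_pos rfl, if_neg (by simp)]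
    rw [e, T.expAct_gexp_sub_one hT h0 h1]
    refine mul_add_mem_ideal hF ?_
    rw [h1, sub_add_cancel] at hX2
    simp only [near_fst, far_fst, ← MvPolynomial.C_mul, ← mono_add, hg]
    by_cases hs : 0 < (c.2 : ℤ)
    · left
      rw [coside, if_pos hs] at hX2
      refine ⟨hX2, ?_⟩
      rw [if_pos hs, hsm]
      congr 2
      module
    · right
      rw [coside, if_neg hs] at hX2
      refine ⟨hX2, ?_⟩
      rw [if_neg hs, hsm]
      congr 2
      module
  by_cases h2 : c.1 = r.1 + 1
  · have e : T.subK r (T.centerForm T.mono c) = T.scaledForm T.mono (T.near r) *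
        MvPolynomial.X (c.1, 0) + MvPolynomial.C (T.mono (T.expAct r (T.gexp c))) *
          (T.scaledForm T.mono (T.far r) * MvPolynomial.X (c.1, 1)) := by
      rw [centerForm, map_add, map_mul, subK_X, subK_X, subK_C, h2, multiplier_add_one h0,
        multiplier_add_one h0, sK_mono, if_pos rfl, if_neg (by simp)]
    rw [e, T.expAct_gexp_add_one hT h0 h2]
    refine mul_add_mem_ideal hF ?_
    rw [h2, add_sub_cancel_right] at hX1
    simp only [near_fst, far_fst, ← MvPolynomial.C_mul, ← mono_add, hg]
    by_cases hs : 0 < (c.2 : ℤ)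
    · right
      rw [side, if_pos hs] at hX1
      refine ⟨hX1, ?_⟩
      rw [if_pos hs, hsm]
      congr 2
      module
    · left
      rw [side, if_neg hs] at hX1
      refine ⟨hX1, ?_⟩
      rw [if_neg hs, hsm]
      congr 2
      module
  · rw [centerForm, map_add, map_mul, subK_X, subK_X, subK_C, multiplier_of_ne r h1 h2,
      multiplier_of_ne r h1 h2, one_mul, one_mul, sK_mono, T.expAct_gexp_of_ne h0 hc h1 h2]
    exact hF

include hT in
theorem centerIdeal_le_comap (c : T.Center) (h1 : c ≠ T.near r) (h2 : c ≠ T.far r) :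
    T.centerIdeal c ≤ (T.centerIdeal c).comap (T.subK r) := by
  refine T.centerIdeal_le ?_ ?_ ?_ <;> rw [Ideal.mem_comap]
  · exact Ideal.mem_of_dvd _ (T.X_dvd_subK_X r _) (T.X_sub_mem c)
  · by_cases hc : c.1 = r.1
    · rw [T.subK_centerForm (Or.inr hc), T.perm_of_ne r c h1 h2]
      exact T.centerForm_mem c
    · exact subK_centerForm_mem hT h0 c hc
  · exact Ideal.mem_of_dvd _ (T.X_dvd_subK_X r _) (T.X_add_mem c)

/-- Geometrically, the hypersurface given by the form of C_n^{-1} is contracted into C_n^1: two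
generators acquire this form as multiplier, and the form of C_n^1 is exchanged with it. -/
theorem centerIdeal_near_le :
    T.centerIdeal (T.near r) ≤ (Ideal.span {T.scaledForm T.mono (T.far r)}).comap (T.subK r) := by
  obtain ⟨h1, h2⟩ := side_near h0
  refine T.centerIdeal_le ?_ ?_ ?_ <;> rw [Ideal.mem_comap, Ideal.mem_span_singleton]
  · rw [h1, subK_X, near_fst, multiplier_sub_one h0, if_pos rfl]
    exact dvd_mul_right _ _
  · rw [T.subK_centerForm (Or.inr rfl), perm_near, scaledForm_dvd_iff]
  · rw [h2, subK_X, near_fst, multiplier_add_one h0, if_neg (by simp)]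
    exact dvd_mul_right _ _

theorem centerIdeal_far_le :
    T.centerIdeal (T.far r) ≤ (Ideal.span {T.scaledForm T.mono (T.near r)}).comap (T.subK r) := by
  obtain ⟨h1, h2⟩ := side_far h0
  refine T.centerIdeal_le ?_ ?_ ?_ <;> rw [Ideal.mem_comap, Ideal.mem_span_singleton]
  · rw [h1, subK_X, far_fst, multiplier_sub_one h0, if_neg (by simp)]
    exact dvd_mul_right _ _
  · rw [T.subK_centerForm (Or.inr rfl), perm_far, scaledForm_dvd_iff]
  · rw [h2, subK_X, far_fst, multiplier_add_one h0, if_pos rfl]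
    exact dvd_mul_right _ _

/-- All coordinates of the neighbouring rows are moved into the ideals of the two centers. -/
theorem subK_X_mem {c : T.Center} (hc : c = T.near r ∨ c = T.far r) {z : T.Coord}
    (hz : z.1 = r.1 - 1 ∨ z.1 = r.1 + 1) : T.subK r (MvPolynomial.X z) ∈ T.centerIdeal c := by
  obtain ⟨h1, h2⟩ := side_near h0
  obtain ⟨h3, h4⟩ := side_far h0
  have n1 := T.X_sub_mem (T.near r)
  have n2 := T.X_add_mem (T.near r)
  have f1 := T.X_sub_mem (T.far r)
  have f2 := T.X_add_mem (T.far r)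
  rw [h1, near_fst] at n1
  rw [h2, near_fst] at n2
  rw [h3, far_fst] at f1
  rw [h4, far_fst] at f2
  have n3 := T.scaledForm_mem (T.near r)
  have f3 := T.scaledForm_mem (T.far r)
  obtain ⟨n, i⟩ := z
  rw [subK_X]
  rcases hz with hz | hz <;> simp only at hz <;> subst hz
  · rw [multiplier_sub_one h0]
    fin_cases i
    · rcases hc with rfl | rfl
      · exact Ideal.mul_mem_left _ _ n1
      · exact Ideal.mul_mem_right _ _ f3
    · rcases hc with rfl | rfl
      · exact Ideal.mul_mem_right _ _ n3
      · exact Ideal.mul_mem_left _ _ f1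
  · rw [multiplier_add_one h0]
    fin_cases i
    · rcases hc with rfl | rfl
      · exact Ideal.mul_mem_right _ _ n3
      · exact Ideal.mul_mem_left _ _ f2
    · rcases hc with rfl | rfl
      · exact Ideal.mul_mem_left _ _ n2
      · exact Ideal.mul_mem_right _ _ f3

/-- Each coordinate of the rows n ± 1 gains one order of vanishing, so multihomogeneity yields the
order d_{n-1} + d_{n+1}. This is the term of the reflected multiplicity which does not come from the
old one. -/
theorem subK_mem_pow {c : T.Center} (hc : c = T.near r ∨ c = T.far r) {d : ZMod T.N → ℤ}
    {f : MvPolynomial T.Coord T.K} (hf : T.IsMultihomogeneous d f) :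
    T.subK r f ∈ T.centerIdeal c ^ ((d (r.1 - 1)).toNat + (d (r.1 + 1)).toNat) := by
  rw [mem_centerIdeal_pow]
  let w : ZMod T.N → Polynomial (MvPolynomial T.Coord T.K) := fun n =>
    if n = r.1 - 1 ∨ n = r.1 + 1 then Polynomial.X else 1
  have hx : ∀ z : T.Coord, ∃ x, T.blow c (T.subK r (MvPolynomial.X z)) = w z.1 * x := by
    intro z
    by_cases hz : z.1 = r.1 - 1 ∨ z.1 = r.1 + 1
    · obtain ⟨x, hx⟩ := T.X_dvd_blow c _ (subK_X_mem h0 hc hz)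
      exact ⟨x, by simp only [w, if_pos hz, hx]⟩
    · exact ⟨T.blow c (T.subK r (MvPolynomial.X z)), by simp only [w, if_neg hz, one_mul]⟩
  choose x hx using hx
  have e : T.blow c (T.subK r f) = MvPolynomial.eval₂Hom
      ((T.blow c).comp (MvPolynomial.C.comp (T.sK r : T.K →+* T.K))) (fun z => w z.1 * x z) f := by
    rw [← RingHom.comp_apply]
    congr 1
    refine MvPolynomial.ringHom_ext ?_ ?_
    · intro a
      simp only [RingHom.comp_apply, subK_C, MvPolynomial.coe_eval₂Hom, MvPolynomial.eval₂_C,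
        RingHom.coe_coe]
    · intro z
      simp only [RingHom.comp_apply, MvPolynomial.coe_eval₂Hom, MvPolynomial.eval₂_X, hx]
  rw [e.trans (hf.eval₂Hom_mul _ w x)]
  refine Dvd.dvd.mul_right ?_ _
  have h2 : ∏ n ∈ {r.1 - 1, r.1 + 1}, w n ^ (d n).toNat =
      Polynomial.X ^ ((d (r.1 - 1)).toNat + (d (r.1 + 1)).toNat) := by
    rw [Finset.prod_pair (T.add_one_ne_sub_one _).symm, pow_add]
    simp [w]
  rw [← h2]
  exact Finset.prod_dvd_prod_of_subset _ _ _ (Finset.subset_univ _)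

theorem isMultihomogeneous_multiplier {A : Type*} [CommRing A] {e : (T.Root → ℚ) → A} (z : T.Coord) :
    T.IsMultihomogeneous (if z.1 = r.1 - 1 ∨ z.1 = r.1 + 1 then Pi.single r.1 1 else 0)
      (T.multiplier e r z) := by
  by_cases h1 : z.1 = r.1 - 1
  · rw [if_pos (Or.inl h1), multiplier, if_pos h0, if_pos h1]
    split_ifs
    · exact isMultihomogeneous_scaledForm (T.far r)
    · exact isMultihomogeneous_scaledForm (T.near r)
  by_cases h2 : z.1 = r.1 + 1
  · rw [if_pos (Or.inr h2), multiplier, if_pos h0, if_neg h1, if_pos h2]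
    split_ifs
    · exact isMultihomogeneous_scaledForm (T.near r)
    · exact isMultihomogeneous_scaledForm (T.far r)
  · rw [if_neg (not_or.2 ⟨h1, h2⟩), multiplier_of_ne r h1 h2]
    exact IsMultihomogeneous.one

/-- The multidegree of the transform of a multihomogeneous polynomial. -/
theorem isMultihomogeneous_subK {d : ZMod T.N → ℤ} {f : MvPolynomial T.Coord T.K}
    (hf : T.IsMultihomogeneous d f) : T.IsMultihomogeneous
      (d + Pi.single r.1 (d (r.1 - 1) + d (r.1 + 1))) (T.subK r f) := by
  have h := hf.eval₂Hom (D := fun n => (if n = r.1 - 1 ∨ n = r.1 + 1 then Pi.single r.1 1 else 0) +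
    Pi.single n 1) (T.sK r : T.K →+* T.K) (x := fun z => T.multiplier T.mono r z * MvPolynomial.X z)
    (fun z => (isMultihomogeneous_multiplier h0 z).mul (IsMultihomogeneous.X z))
  refine h.of_eq ?_
  simp only [smul_add, Finset.sum_add_distrib]
  rw [add_comm]
  congr 1
  · funext n
    simp [Finset.sum_apply, Pi.single_apply]
  · have : ∀ n, d n • (if n = r.1 - 1 ∨ n = r.1 + 1 then Pi.single r.1 (1 : ℤ) else 0) =
        (if n = r.1 - 1 then (Pi.single r.1 (d n) : ZMod T.N → ℤ) else 0) +
          (if n = r.1 + 1 then Pi.single r.1 (d n) else 0) := by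
      intro n
      have hne := T.add_one_ne_sub_one r.1
      by_cases h1 : n = r.1 - 1
      · subst h1
        simp [hne.symm, ← Pi.single_smul]
      · by_cases h2 : n = r.1 + 1
        · subst h2
          simp [hne, ← Pi.single_smul]
        · simp [h1, h2]
    simp only [this, Finset.sum_add_distrib, Finset.sum_ite_eq', Finset.mem_univ, if_true,
      Pi.single_add]

end ZeroRoot

/-! ### Transforms of sections -/

theorem mem_linearSystem (Λ : T.NS) (f : MvPolynomial T.Coord T.K) : f ∈ T.linearSystem Λ ↔
    T.IsMultihomogeneous (T.deg Λ) f ∧ ∀ c, f ∈ T.centerIdeal c ^ (T.mult Λ c).toNat := by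
  rw [linearSystem, Submodule.mem_inf, mem_iInf_weightedHomogeneousSubmodule]
  simp only [Submodule.mem_iInf, Submodule.restrictScalars_mem]

theorem subK_mem_pow_of_le {r : T.Root} {I J : Ideal (MvPolynomial T.Coord T.K)}
    (h : I ≤ J.comap (T.subK r)) {f : MvPolynomial T.Coord T.K} {n : ℕ} (hf : f ∈ I ^ n) :
    T.subK r f ∈ J ^ n := by
  have h1 := Ideal.mem_map_of_mem (T.subK r) hf
  rw [Ideal.map_pow] at h1
  exact Ideal.pow_right_mono (Ideal.map_le_iff_le_comap.2 h) n h1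

theorem denom_ne_zero (r : T.Root) (Λ : T.NS) : T.denom T.mono r Λ ≠ 0 := by
  unfold denom
  split_ifs
  · exact mul_ne_zero (pow_ne_zero _ (T.scaledForm_ne_zero _))
      (pow_ne_zero _ (T.scaledForm_ne_zero _))
  · exact one_ne_zero

theorem numer_ne_zero (r : T.Root) (Λ : T.NS) : T.numer T.mono r Λ ≠ 0 := by
  unfold numer
  split_ifs
  · exact mul_ne_zero (pow_ne_zero _ (T.scaledForm_ne_zero _))
      (pow_ne_zero _ (T.scaledForm_ne_zero _))
  · exact one_ne_zero

theorem isMultihomogeneous_map_sK {d : ZMod T.N → ℤ} {f : MvPolynomial T.Coord T.K} {r : T.Root}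
    (h : (r.2 : ℤ) ≠ 0) (hf : T.IsMultihomogeneous d f) :
    T.IsMultihomogeneous d (T.subK r f) := by
  have e : T.subK r f = MvPolynomial.map (T.sK r : T.K →+* T.K) f := by
    congr 1
    refine MvPolynomial.ringHom_ext ?_ ?_
    · intro a; simp [subK_C]
    · intro z; simp [subK_X, multiplier_of_ne_zero h]
  rw [e]
  exact hf.map _

/-- A simple reflection carries the linear system of `Λ` to that of `s(Λ)`. -/
theorem exists_transform
    (hT : ∀ n : ZMod T.N, T.k (n - 1) * T.k (n + 1) = T.ℓ (n - 1) * T.ℓ (n + 1))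
    (r : T.Root) (Λ : T.NS) {f : MvPolynomial T.Coord T.K} (hf : f ∈ T.linearSystem Λ) :
    ∃ g ∈ T.linearSystem (T.s r Λ),
      T.denom T.mono r Λ * g = T.numer T.mono r Λ * T.subK r f := by
  by_cases hf0 : f = 0
  · exact ⟨0, zero_mem _, by rw [hf0, map_zero, mul_zero, mul_zero]⟩
  obtain ⟨hd, hm⟩ := (T.mem_linearSystem Λ f).1 hf
  by_cases h0 : (r.2 : ℤ) = 0
  swap
  · refine ⟨T.subK r f, (T.mem_linearSystem _ _).2 ⟨?_, fun c => ?_⟩, ?_⟩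
    · rw [T.deg_s_of_ne_zero h0]
      exact T.isMultihomogeneous_map_sK h0 hd
    · rw [T.mult_s_of_ne_zero h0]
      have := T.subK_mem_pow_of_le (T.centerIdeal_le_comap_of_ne_zero h0 (T.perm r c))
        (hm (T.perm r c))
      rwa [perm_perm] at this
    · rw [denom, numer, if_neg h0, if_neg h0]
  have hne := T.near_ne_far r
  have hP := T.prime_scaledForm (T.near r)
  have d1 : T.scaledForm T.mono (T.far r) ^ (T.mult Λ (T.near r)).toNat ∣ T.subK r f := by
    have := T.subK_mem_pow_of_le (centerIdeal_near_le h0) (hm (T.near r))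
    rwa [Ideal.span_singleton_pow, Ideal.mem_span_singleton] at this
  have d2 : T.scaledForm T.mono (T.near r) ^ (T.mult Λ (T.far r)).toNat ∣ T.subK r f := by
    have := T.subK_mem_pow_of_le (centerIdeal_far_le h0) (hm (T.far r))
    rwa [Ideal.span_singleton_pow, Ideal.mem_span_singleton] at this
  obtain ⟨q, hq⟩ := d1
  rw [hq] at d2
  -- The two forms are primes not dividing each other, so their powers split off one after the
  -- other.
  obtain ⟨g₀, hg₀⟩ := hP.pow_dvd_of_dvd_mul_left _
    (fun h => T.not_scaledForm_dvd hne (hP.dvd_of_dvd_pow h)) d2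
  set P := T.scaledForm T.mono (T.near r) with hPdef
  set Q := T.scaledForm T.mono (T.far r) with hQdef
  set a := T.mult Λ (T.near r) with ha
  set b := T.mult Λ (T.far r) with hb
  have hden : T.denom T.mono r Λ = P ^ b.toNat * Q ^ a.toNat := by rw [denom, if_pos h0]
  have hnum : T.numer T.mono r Λ = P ^ (-b).toNat * Q ^ (-a).toNat := by rw [numer, if_pos h0]
  have heq : T.denom T.mono r Λ * (T.numer T.mono r Λ * g₀) =
      T.numer T.mono r Λ * T.subK r f := by
    rw [hden, hq, hg₀]
    ring
  refine ⟨T.numer T.mono r Λ * g₀, (T.mem_linearSystem _ _).2 ⟨?_, fun c => ?_⟩, heq⟩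
  · have hσ := isMultihomogeneous_subK h0 hd
    have hg : T.IsMultihomogeneous (T.deg Λ + Pi.single r.1 (T.deg Λ (r.1 - 1) + T.deg Λ (r.1 + 1))
        - b.toNat • Pi.single r.1 1 - a.toNat • Pi.single r.1 1) g₀ := by
      refine IsMultihomogeneous.of_scaledForm_pow_mul (T.near r) (a := b.toNat) ?_
      refine IsMultihomogeneous.of_scaledForm_pow_mul (T.far r) (a := a.toNat) ?_
      rw [← hg₀, ← hq, near_fst, far_fst]
      exact hσ.of_eq (by abel)
    have hN : T.IsMultihomogeneous ((-b).toNat • Pi.single r.1 1 + (-a).toNat • Pi.single r.1 1)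
        (T.numer T.mono r Λ) := by
      rw [hnum]
      exact ((isMultihomogeneous_scaledForm (T.near r)).pow _).mul
        ((isMultihomogeneous_scaledForm (T.far r)).pow _)
    refine (hN.mul hg).of_eq ?_
    rw [T.deg_s_of_eq_zero h0, ← ha, ← hb]
    have e : ∀ m : ℕ, m • (Pi.single r.1 1 : ZMod T.N → ℤ) = Pi.single r.1 (m : ℤ) := by
      intro m
      rw [← Pi.single_smul]
      simp
    simp only [e]
    funext n
    simp only [Pi.add_apply, Pi.sub_apply, Pi.single_apply]
    split_ifs
    · have h1 := Int.toNat_sub_toNat_neg a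
      have h2 := Int.toNat_sub_toNat_neg b
      linarith
    · ring
  · have hn1 := hd.nonneg hf0 (r.1 - 1)
    have hn2 := hd.nonneg hf0 (r.1 + 1)
    by_cases h1 : c = T.near r
    · subst h1
      -- Along C_n^1 the numerator side has order at least b⁻ + d_{n-1} + d_{n+1}, where b = b⁺ -
      -- b⁻. Cancelling P^{b⁺} lowers this by b⁺, and Q does not vanish on the whole center, so
      -- d_{n-1} + d_{n+1} - b remains.
      have e1 := Ideal.mul_mem_mul (Ideal.pow_mem_pow (T.scaledForm_mem (T.near r)) (-b).toNat)
        (Ideal.mul_mem_left _ (Q ^ (-a).toNat) (subK_mem_pow h0 (Or.inl rfl) hd))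
      rw [← pow_add, ← mul_assoc, ← hPdef, ← hnum, ← heq, hden, mul_assoc] at e1
      have e2 := T.mem_pow_of_mul (by
        rw [map_pow]
        exact pow_ne_zero _ (T.eval_point_scaledForm hne)) (T.mem_pow_of_scaledForm_pow_mul e1)
      rw [T.mult_s_near h0, ← hb]
      refine Ideal.pow_le_pow_right ?_ e2
      omega
    by_cases h2 : c = T.far r
    · subst h2
      have e1 := Ideal.mul_mem_mul (Ideal.pow_mem_pow (T.scaledForm_mem (T.far r)) (-a).toNat)
        (Ideal.mul_mem_left _ (P ^ (-b).toNat) (subK_mem_pow h0 (Or.inr rfl) hd))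
      rw [← pow_add, ← mul_assoc, ← hQdef, mul_comm (Q ^ (-a).toNat), ← hnum, ← heq, hden,
        mul_comm (P ^ b.toNat), mul_assoc] at e1
      have e2 := T.mem_pow_of_mul (by
        rw [map_pow]
        exact pow_ne_zero _ (T.eval_point_scaledForm hne.symm))
        (T.mem_pow_of_scaledForm_pow_mul e1)
      rw [T.mult_s_far h0, ← ha]
      refine Ideal.pow_le_pow_right ?_ e2
      omega
    · rw [T.mult_s_of_ne h0 Λ h1 h2]
      refine T.mem_pow_of_mul (G := T.denom T.mono r Λ) ?_ ?_
      · rw [hden, map_mul, map_pow, map_pow]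
        exact mul_ne_zero (pow_ne_zero _ (T.eval_point_scaledForm h1))
          (pow_ne_zero _ (T.eval_point_scaledForm h2))
      · rw [heq]
        exact Ideal.mul_mem_left _ _ (T.subK_mem_pow_of_le (centerIdeal_le_comap hT h0 c h1 h2)
          (hm c))

end TropicalDatum
end

noncomputable section
namespace TropicalDatum
variable (T : TropicalDatum)

/-! ### Linear systems on the Weyl orbit of the exceptional classes -/

/-- The substitution exchanges the two forms, so applied twice it multiplies every coordinate of the
rows n ± 1 by their product, independently of the coordinate. On multihomogeneous polynomials this
is a common factor; in particular no nonzero section is killed. -/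
theorem subK_subK (r : T.Root) {d : ZMod T.N → ℤ} {f : MvPolynomial T.Coord T.K}
    (hf : T.IsMultihomogeneous d f) :
    ∃ G : MvPolynomial T.Coord T.K, G ≠ 0 ∧ T.subK r (T.subK r f) = G * f := by
  let w : ZMod T.N → MvPolynomial T.Coord T.K := fun n =>
    if (r.2 : ℤ) = 0 ∧ (n = r.1 - 1 ∨ n = r.1 + 1) then
      T.scaledForm T.mono (T.near r) * T.scaledForm T.mono (T.far r) else 1
  have hw : ∀ n, w n ≠ 0 := by
    intro n
    simp only [w]
    split_ifs
    · exact mul_ne_zero (T.scaledForm_ne_zero _) (T.scaledForm_ne_zero _)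
    · exact one_ne_zero
  have hX : ∀ z, T.subK r (T.subK r (MvPolynomial.X z)) = w z.1 * MvPolynomial.X z := by
    rintro ⟨n, i⟩
    have e1 : T.subK r (T.scaledForm T.mono (T.near r)) = T.scaledForm T.mono (T.far r) := by
      rw [T.subK_scaledForm (Or.inr rfl), perm_near]
    have e2 : T.subK r (T.scaledForm T.mono (T.far r)) = T.scaledForm T.mono (T.near r) := by
      rw [T.subK_scaledForm (Or.inr rfl), perm_far]
    by_cases h0 : (r.2 : ℤ) = 0
    swap
    · simp only [subK_X, multiplier_of_ne_zero h0, one_mul, w, h0, false_and, if_false]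
    by_cases h1 : n = r.1 - 1
    · subst h1
      simp only [w, h0, true_and, true_or, if_true]
      rw [subK_X, map_mul, subK_X, multiplier_sub_one h0]
      split_ifs
      · rw [e2]; ring
      · rw [e1]; ring
    by_cases h2 : n = r.1 + 1
    · subst h2
      simp only [w, h0, true_and, or_true, if_true]
      rw [subK_X, map_mul, subK_X, multiplier_add_one h0]
      split_ifs
      · rw [e1]; ring
      · rw [e2]; ring
    · simp only [w, h0, true_and, h1, h2, or_self, if_false, one_mul]
      rw [subK_X, map_mul, subK_X, multiplier_of_ne r h1 h2, map_one, one_mul, one_mul]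
  have e : (T.subK r).comp (T.subK r) =
      MvPolynomial.eval₂Hom MvPolynomial.C (fun z => w z.1 * MvPolynomial.X z) := by
    refine MvPolynomial.ringHom_ext ?_ ?_
    · intro a
      simp only [RingHom.comp_apply, subK_C, MvPolynomial.coe_eval₂Hom, MvPolynomial.eval₂_C]
      exact congrArg _ (T.sK_sK r a)
    · intro z
      simp only [RingHom.comp_apply, hX, MvPolynomial.coe_eval₂Hom, MvPolynomial.eval₂_X]
  refine ⟨∏ n, w n ^ (d n).toNat, Finset.prod_ne_zero_iff.2 fun n _ => pow_ne_zero _ (hw n), ?_⟩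
  have h1 := (RingHom.congr_fun e f).trans (hf.eval₂Hom_mul MvPolynomial.C w MvPolynomial.X)
  rw [RingHom.comp_apply] at h1
  rw [h1]
  congr 1
  exact MvPolynomial.eval₂_eta f

theorem subK_ne_zero (r : T.Root) {d : ZMod T.N → ℤ} {f : MvPolynomial T.Coord T.K}
    (hf : T.IsMultihomogeneous d f) (h : f ≠ 0) : T.subK r f ≠ 0 := by
  intro h'
  obtain ⟨G, hG, e⟩ := T.subK_subK r hf
  rw [h', map_zero] at e
  exact mul_ne_zero hG h e.symm

/-- `Λ` has a nonzero section. -/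
def HasSection (Λ : T.NS) : Prop := ∃ f ∈ T.linearSystem Λ, f ≠ 0

/-- `Λ` has exactly one section up to scalars. -/
def IsRigid (Λ : T.NS) : Prop :=
  ∃ f ∈ T.linearSystem Λ, f ≠ 0 ∧ ∀ g ∈ T.linearSystem Λ, ∃ a : T.K, g = a • f

theorem transform_ne_zero {r : T.Root} {Λ : T.NS} {f g : MvPolynomial T.Coord T.K}
    (hf : f ∈ T.linearSystem Λ) (h : f ≠ 0)
    (hg : T.denom T.mono r Λ * g = T.numer T.mono r Λ * T.subK r f) : g ≠ 0 := by
  intro h'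
  rw [h', mul_zero] at hg
  exact mul_ne_zero (T.numer_ne_zero r Λ)
    (T.subK_ne_zero r ((T.mem_linearSystem Λ f).1 hf).1 h) hg.symm

theorem weyl_induction {Q : T.NS → Prop} (h : ∀ r Λ, Q Λ → Q (T.s r Λ)) {w : T.NS ≃ₗ[ℤ] T.NS}
    (hw : w ∈ T.W) (Λ : T.NS) (hΛ : Q Λ) : Q (w Λ) := by
  -- The equivalence, rather than one implication, is what passes to inverses; for generators it
  -- follows from involutivity.
  have key : ∀ Λ, Q Λ ↔ Q (w Λ) := by
    induction hw using Subgroup.closure_induction with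
    | mem x hx =>
      obtain ⟨r, rfl⟩ := hx
      refine fun Λ => ⟨h r Λ, fun h' => ?_⟩
      have := h r _ h'
      rwa [s_s] at this
    | one => exact fun Λ => Iff.rfl
    | mul x y _ _ hx hy => exact fun Λ => (hy Λ).trans (hx _)
    | inv x _ hx =>
      intro Λ
      rw [hx (x⁻¹ Λ)]
      change Q Λ ↔ Q ((x * x⁻¹) Λ)
      rw [mul_inv_cancel]
      rfl
  exact (key Λ).1 hΛ

/-! ### Propagation of rigidity -/

section Rigidity

variable (hT : ∀ n : ZMod T.N, T.k (n - 1) * T.k (n + 1) = T.ℓ (n - 1) * T.ℓ (n + 1))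
include hT

theorem hasSection_s (r : T.Root) (Λ : T.NS) (h : T.HasSection Λ) : T.HasSection (T.s r Λ) := by
  obtain ⟨f, hf, h0⟩ := h
  obtain ⟨g, hg, e⟩ := T.exists_transform hT r Λ hf
  exact ⟨g, hg, T.transform_ne_zero hf h0 e⟩

/-- Transforming back sends all sections of s(Λ) to multiples of f, and the substitution kills no
nonzero section. So proportionality can be checked after transforming back. -/
theorem isRigid_s (r : T.Root) (Λ : T.NS) (h : T.IsRigid Λ) : T.IsRigid (T.s r Λ) := by
  obtain ⟨f, hf, h0, h1⟩ := h
  obtain ⟨g, hg, e⟩ := T.exists_transform hT r Λ hf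
  have hg0 := T.transform_ne_zero hf h0 e
  have back : ∀ g ∈ T.linearSystem (T.s r Λ), ∃ a : T.K,
      T.denom T.mono r (T.s r Λ) * (a • f) = T.numer T.mono r (T.s r Λ) * T.subK r g := by
    intro g hg
    obtain ⟨f', hf', e'⟩ := T.exists_transform hT r (T.s r Λ) hg
    rw [s_s] at hf'
    obtain ⟨a, rfl⟩ := h1 f' hf'
    exact ⟨a, e'⟩
  refine ⟨g, hg, hg0, fun g' hg' => ?_⟩
  obtain ⟨a, ha⟩ := back g hg
  obtain ⟨b, hb⟩ := back g' hg'
  have hN := T.numer_ne_zero r (T.s r Λ)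
  have hsg := T.subK_ne_zero r ((T.mem_linearSystem _ g).1 hg).1 hg0
  have ha0 : a ≠ 0 := by
    rintro rfl
    rw [zero_smul, mul_zero] at ha
    exact mul_ne_zero hN hsg ha.symm
  -- The reflection of b/a appears because the substitution is only semilinear: it turns this scalar
  -- into b/a.
  refine ⟨T.sK r (b / a), ?_⟩
  have hmem : g' - T.sK r (b / a) • g ∈ T.linearSystem (T.s r Λ) :=
    sub_mem hg' (Submodule.smul_mem _ _ hg)
  by_contra hne
  refine T.subK_ne_zero r ((T.mem_linearSystem _ _).1 hmem).1 (sub_ne_zero.2 hne) ?_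
  have e2 : T.subK r (T.sK r (b / a) • g) = MvPolynomial.C (b / a) * T.subK r g := by
    rw [MvPolynomial.smul_eq_C_mul, map_mul, subK_C, sK_sK]
  have e3 : T.numer T.mono r (T.s r Λ) * T.subK r (g' - T.sK r (b / a) • g) = 0 := by
    rw [map_sub, e2, mul_sub, ← hb, mul_left_comm, ← ha, MvPolynomial.smul_eq_C_mul,
      MvPolynomial.smul_eq_C_mul]
    have : (b : T.K) = b / a * a := (div_mul_cancel₀ b ha0).symm
    conv_lhs => rw [this]
    rw [MvPolynomial.C_mul]
    rw [← this]
    ring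
  exact (mul_eq_zero.1 e3).resolve_left hN

end Rigidity

theorem E_center (c : T.Center) : T.E c.1 c.2 = (0, Pi.single c 1) := by
  have h := T.center_mem c
  rw [T.E_ctr c.1 c.2 h]
  rfl

theorem eq_C_of_isMultihomogeneous_zero {d : ZMod T.N → ℤ} (hd : ∀ n, d n = 0)
    {f : MvPolynomial T.Coord T.K}
    (hf : T.IsMultihomogeneous d f) : f = MvPolynomial.C (f.coeff 0) := by
  classical
  ext m
  rw [MvPolynomial.coeff_C]
  split_ifs with h
  · rw [h]
  · by_contra h'
    refine h (Finsupp.ext ?_)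
    rintro ⟨n, i⟩
    have := hf m h' n
    rw [hd] at this
    rw [Finsupp.zero_apply]
    fin_cases i
    · simp only [Fin.zero_eta]; omega
    · simp only [Fin.mk_one]; omega

theorem C_notMem_centerIdeal (c : T.Center) {a : T.K} (ha : a ≠ 0) :
    (MvPolynomial.C a : MvPolynomial T.Coord T.K) ∉ T.centerIdeal c := by
  intro h
  have := T.centerIdeal_le_ker_eval c h
  rw [RingHom.mem_ker, MvPolynomial.eval_C] at this
  exact ha this

theorem deg_E (c : T.Center) : T.deg (T.E c.1 c.2) = 0 := by
  rw [E_center]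
  rfl

theorem mult_E (c c' : T.Center) : T.mult (T.E c.1 c.2) c' = if c' = c then -1 else 0 := by
  rw [E_center, mult]
  simp only [Pi.single_apply]
  split_ifs <;> rfl

theorem one_mem_linearSystem_E (c : T.Center) : 1 ∈ T.linearSystem (T.E c.1 c.2) := by
  refine (T.mem_linearSystem _ _).2 ⟨?_, fun c' => ?_⟩
  · rw [deg_E]; exact IsMultihomogeneous.one
  · rw [mult_E]
    split_ifs <;> simp

theorem isRigid_E (c : T.Center) : T.IsRigid (T.E c.1 c.2) := by
  refine ⟨1, T.one_mem_linearSystem_E c, one_ne_zero, fun g hg => ?_⟩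
  have h1 := ((T.mem_linearSystem _ _).1 hg).1
  rw [deg_E] at h1
  refine ⟨g.coeff 0, ?_⟩
  rw [MvPolynomial.smul_eq_C_mul, mul_one]
  exact T.eq_C_of_isMultihomogeneous_zero (fun _ => rfl) h1

theorem HasSection.deg_nonneg {T : TropicalDatum} {Λ : T.NS} (h : T.HasSection Λ) (n : ZMod T.N) :
    0 ≤ T.deg Λ n := by
  obtain ⟨f, hf, h0⟩ := h
  exact ((T.mem_linearSystem Λ f).1 hf).1.nonneg h0 n

theorem HasSection.mult_nonpos {T : TropicalDatum} {Λ : T.NS} (h : T.HasSection Λ)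
    (hd : ∀ n, T.deg Λ n = 0) (c : T.Center) : T.mult Λ c ≤ 0 := by
  obtain ⟨f, hf, h0⟩ := h
  obtain ⟨h1, h2⟩ := (T.mem_linearSystem Λ f).1 hf
  have e := T.eq_C_of_isMultihomogeneous_zero hd h1
  have hc : f.coeff 0 ≠ 0 := by
    intro hc
    rw [hc, MvPolynomial.C_0] at e
    exact h0 e
  by_contra hm
  have h3 := Ideal.pow_le_self (show (T.mult Λ c).toNat ≠ 0 by omega) (h2 c)
  rw [e] at h3
  exact T.C_notMem_centerIdeal c hc h3

/-! ### Sections on the orbit and exact multiplicities -/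

section Orbit

variable (hT : ∀ n : ZMod T.N, T.k (n - 1) * T.k (n + 1) = T.ℓ (n - 1) * T.ℓ (n + 1))
include hT

theorem isRigid_of_mem {Λ : T.NS} (h : Λ ∈ T.M) : T.IsRigid Λ := by
  obtain ⟨w, hw, c, rfl⟩ := h
  exact T.weyl_induction (T.isRigid_s hT) hw _ (T.isRigid_E c)

theorem hasSection_of_mem {Λ : T.NS} (h : Λ ∈ T.M) : T.HasSection Λ := by
  obtain ⟨f, hf, h0, _⟩ := T.isRigid_of_mem hT h
  exact ⟨f, hf, h0⟩

/-- Distinct exceptional classes do not contain each other. -/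
theorem eq_of_hasSection_sub {Λ : T.NS} (h : Λ ∈ T.M) (c : T.Center)
    (hs : T.HasSection (Λ - T.E c.1 c.2)) : Λ = T.E c.1 c.2 := by
  obtain ⟨w, hw, c', rfl⟩ := h
  -- Pulling back by w turns Λ into E_{c'} and E_c into Λ'; both Λ' and E_{c'} - Λ' then have
  -- sections.
  set Λ' := w⁻¹ (T.E c.1 c.2) with hΛ'
  have hwΛ : w Λ' = T.E c.1 c.2 := by
    change (w * w⁻¹) _ = _
    rw [mul_inv_cancel]
    rfl
  have hM : Λ' ∈ T.M := ⟨w⁻¹, inv_mem hw, c, rfl⟩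
  have hs' := T.weyl_induction (T.hasSection_s hT) (inv_mem hw) _ hs
  have e : w⁻¹ (w (T.E c'.1 c'.2) - T.E c.1 c.2) = T.E c'.1 c'.2 - Λ' := by
    rw [map_sub]
    congr 1
    change (w⁻¹ * w) _ = _
    rw [inv_mul_cancel]
    rfl
  rw [e] at hs'
  have hsec := T.hasSection_of_mem hT hM
  -- The degrees of Λ' and E_{c'} - Λ' are nonnegative with sum zero.
  have hdeg : ∀ n, T.deg Λ' n = 0 := by
    intro n
    have h1 := hsec.deg_nonneg n
    have h2 := hs'.deg_nonneg n
    have h3 : T.deg (T.E c'.1 c'.2 - Λ') n = - T.deg Λ' n := by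
      rw [E_center]
      simp [deg]
    omega
  have h3 : ∀ x, T.mult (T.E c'.1 c'.2 - Λ') x = T.mult (T.E c'.1 c'.2) x - T.mult Λ' x := by
    intro x
    simp [mult]
    ring
  have hm1 := hsec.mult_nonpos hdeg
  have hm2 := hs'.mult_nonpos (fun n => by
    have := hdeg n
    rw [E_center]
    simpa [deg] using this)
  -- In degree zero, having a section forces nonnegative coefficients of the exceptional classes. So
  -- Λ' and its complement in E_{c'} are both nonnegative, which leaves Λ' = 0 or Λ' = E_{c'}.
  have hne : Λ' ≠ 0 := by
    intro h0
    rw [h0, map_zero, E_center] at hwΛ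
    have := congrFun (congrArg Prod.snd hwΛ) c
    simp at this
  have hother : ∀ x, x ≠ c' → Λ'.2 x = 0 := by
    intro x hx
    have h4 := hm1 x
    have h5 := hm2 x
    rw [h3, mult_E, if_neg hx] at h5
    have : T.mult Λ' x = 0 := by omega
    simpa [mult] using this
  have hself : Λ'.2 c' = 1 := by
    have h4 := hm1 c'
    have h5 := hm2 c'
    rw [h3, mult_E, if_pos rfl] at h5
    have h6 : Λ'.2 c' ≠ 0 := by
      intro h6
      refine hne (Prod.ext (funext fun n => hdeg n) (funext fun x => ?_))
      by_cases hx : x = c'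
      · rw [hx, h6]; rfl
      · rw [hother x hx]; rfl
    simp only [mult] at h4 h5
    omega
  have : Λ' = T.E c'.1 c'.2 := by
    rw [E_center]
    refine Prod.ext (funext fun n => hdeg n) (funext fun x => ?_)
    by_cases hx : x = c'
    · rw [hx, hself]; simp
    · rw [hother x hx]; simp [hx]
  rw [← this, hwΛ]

/-- Excess multiplicity along `c` would make f a section of Λ - E_c, hence Λ = E_c. But then f is a
nonzero constant and vanishes on no center. -/
theorem isDefiningPolynomial {Λ : T.NS} (h : Λ ∈ T.M) {f : MvPolynomial T.Coord T.K}
    (hf : f ∈ T.linearSystem Λ) (h0 : f ≠ 0) : T.IsDefiningPolynomial Λ f := by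
  refine ⟨h0, hf, fun c hc => ?_⟩
  obtain ⟨h1, h2⟩ := (T.mem_linearSystem Λ f).1 hf
  have hs : T.HasSection (Λ - T.E c.1 c.2) := by
    refine ⟨f, (T.mem_linearSystem _ f).2 ⟨h1.of_eq ?_, fun x => ?_⟩, h0⟩
    · rw [E_center]
      funext n
      simp [deg]
    · have h3 : T.mult (Λ - T.E c.1 c.2) x = T.mult Λ x - T.mult (T.E c.1 c.2) x := by
        simp [mult]
        ring
      rw [h3, mult_E]
      split_ifs with hx
      · subst hx
        exact Ideal.pow_le_pow_right (by omega) hc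
      · rw [sub_zero]
        exact h2 x
  have hΛ := T.eq_of_hasSection_sub hT h c hs
  rw [hΛ, deg_E] at h1
  have e := T.eq_C_of_isMultihomogeneous_zero (fun _ => rfl) h1
  have hc0 : f.coeff 0 ≠ 0 := by
    intro hc
    rw [hc, MvPolynomial.C_0] at e
    exact h0 e
  have h3 := Ideal.pow_le_self (Nat.succ_ne_zero _) hc
  rw [e] at h3
  exact T.C_notMem_centerIdeal c hc0 h3

theorem finrank_linearSystem {Λ : T.NS} (h : Λ ∈ T.M) :
    Module.finrank T.K (T.linearSystem Λ) = 1 := by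
  obtain ⟨f, hf, h0, h1⟩ := T.isRigid_of_mem hT h
  refine finrank_eq_one (⟨f, hf⟩ : T.linearSystem Λ) (fun h' => h0 (congrArg Subtype.val h')) ?_
  rintro ⟨g, hg⟩
  obtain ⟨a, rfl⟩ := h1 g hg
  exact ⟨a, rfl⟩

end Orbit

end TropicalDatum
end

noncomputable section
namespace TropicalDatum
variable (T : TropicalDatum)

/-! ### Integral forms -/

/-- The semilinear substitution attached to a simple reflection, with integral coefficients. -/
abbrev subZ (r : T.Root) :
    MvPolynomial T.Coord (T.Puiseux ℤ) →+* MvPolynomial T.Coord (T.Puiseux ℤ) :=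
  T.substitution T.monoZ (T.sZ r) r

theorem puiseuxToK_comp_monoZ : (fun x => T.puiseuxToK (T.monoZ x)) = T.mono :=
  funext T.puiseuxToK_monoZ

theorem map_subZ (r : T.Root) (P : MvPolynomial T.Coord (T.Puiseux ℤ)) :
    MvPolynomial.map T.puiseuxToK (T.subZ r P) = T.subK r (MvPolynomial.map T.puiseuxToK P) := by
  have e : (MvPolynomial.map T.puiseuxToK).comp (T.subZ r) =
      (T.subK r).comp (MvPolynomial.map T.puiseuxToK) := by
    refine MvPolynomial.ringHom_ext ?_ ?_
    · intro a
      have := RingHom.congr_fun (T.puiseuxToK_comp_sZ r) a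
      simp only [RingHom.comp_apply, RingHom.coe_coe] at this
      simp [substitution, this]
    · intro z
      simp only [RingHom.comp_apply, MvPolynomial.map_X, subK_X]
      simp [substitution, map_multiplier, puiseuxToK_comp_monoZ]
  exact RingHom.congr_fun e P

/-- Up to the monomial a^{-ω g}, which is a unit of the integral ring, the form is monic in ζ_n^0;
division by it therefore preserves integrality. -/
theorem exists_map_eq_of_scaledForm_pow_mul (c : T.Center) (a : ℕ)
    {g : MvPolynomial T.Coord T.K}
    (h : ∃ P, MvPolynomial.map T.puiseuxToK P = T.scaledForm T.mono c ^ a * g) :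
    ∃ Q, MvPolynomial.map T.puiseuxToK Q = g := by
  induction a with
  | zero => simpa using h
  | succ a ih =>
    refine ih ?_
    obtain ⟨P, hP⟩ := h
    refine T.exists_map_eq_of_linear_mul c.1 (T.monoZ (T.gexp c))
      (P := MvPolynomial.C (T.monoZ (T.ω c.1 • T.gexp c)) * P) ?_
    rw [map_mul, hP, MvPolynomial.map_C, puiseuxToK_monoZ, puiseuxToK_monoZ, scaledForm, pow_succ,
      show ∀ x y z w t : MvPolynomial T.Coord T.K,
        t * (x * (y * z) * w) = (t * y) * (z * (x * w)) by intros; ring, ← MvPolynomial.C_mul,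
      ← mono_add, neg_smul, add_neg_cancel, mono_zero, MvPolynomial.C_1, one_mul]
    rfl

theorem exists_map_eq_of_denom_mul (r : T.Root) (Λ : T.NS) {g : MvPolynomial T.Coord T.K}
    (h : ∃ P, MvPolynomial.map T.puiseuxToK P = T.denom T.mono r Λ * g) :
    ∃ Q, MvPolynomial.map T.puiseuxToK Q = g := by
  unfold denom at h
  split_ifs at h
  · simp only [mul_assoc] at h
    exact T.exists_map_eq_of_scaledForm_pow_mul _ _ (T.exists_map_eq_of_scaledForm_pow_mul _ _ h)
  · simpa using h

theorem map_puiseuxToK_injective :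
    Function.Injective (MvPolynomial.map (σ := T.Coord) T.puiseuxToK) :=
  MvPolynomial.map_injective _ T.puiseuxToK_injective

/-! ### Corner coefficients -/

/-- The point all of whose coordinates are `0` or `1`, in the corner given by `S`. -/
def cornerPoint {A : Type*} [CommRing A] (S : ZMod T.N → Fin 2) (z : T.Coord) : A :=
  if z.2 = S z.1 then 1 else 0

/-- At the point every monomial other than the corner one contains a vanishing coordinate. Corner
coefficients thus become values of a ring homomorphism and are multiplicative. -/
theorem coeff_corner {A : Type*} [CommRing A] {d : ZMod T.N → ℤ} {f : MvPolynomial T.Coord A}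
    (hf : T.IsMultihomogeneous d f) (S : ZMod T.N → Fin 2) :
    f.coeff (T.corner d S) = MvPolynomial.eval (T.cornerPoint S) f := by
  classical
  rw [MvPolynomial.eval_eq']
  have key : ∀ m ∈ f.support, f.coeff m * ∏ z, T.cornerPoint S z ^ m z =
      if m = T.corner d S then f.coeff m else 0 := by
    intro m hm
    have hd := hf m (MvPolynomial.mem_support_iff.1 hm)
    by_cases h : ∀ z : T.Coord, z.2 ≠ S z.1 → m z = 0
    · have e : m = T.corner d S := by
        ext ⟨n, i⟩
        have h0 := h (n, 0)
        have h1 := h (n, 1)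
        have hn := hd n
        simp only [corner, Finsupp.equivFunOnFinite_symm_apply_apply]
        rcases (show S n = 0 ∨ S n = 1 by omega) with hS | hS <;> simp only [hS] at h0 h1 ⊢ <;>
          fin_cases i <;> simp at h0 h1 ⊢ <;> omega
      rw [if_pos e, Finset.prod_eq_one, mul_one]
      intro z _
      by_cases hz : z.2 = S z.1
      · rw [cornerPoint, if_pos hz, one_pow]
      · rw [h z hz, pow_zero]
    · push Not at h
      obtain ⟨z, hz, hmz⟩ := h
      have e : m ≠ T.corner d S := by
        rintro rfl
        simp [corner, hz] at hmz
      rw [if_neg e, Finset.prod_eq_zero (Finset.mem_univ z), mul_zero]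
      rw [cornerPoint, if_neg hz, zero_pow hmz]
  rw [Finset.sum_congr rfl key, Finset.sum_ite_eq']
  split_ifs with h
  · rfl
  · exact MvPolynomial.notMem_support_iff.1 h

/-- All corner coefficients are monic monomials. -/
def HasMonicCorners (P : MvPolynomial T.Coord (T.Puiseux ℤ)) : Prop :=
  ∀ S, ∃ x, MvPolynomial.eval (T.cornerPoint S) P = T.monoZ x

variable {T}

theorem HasMonicCorners.one : T.HasMonicCorners 1 :=
  fun _ => ⟨0, by rw [map_one, monoZ_zero]⟩

theorem HasMonicCorners.mul {P Q : MvPolynomial T.Coord (T.Puiseux ℤ)} (hP : T.HasMonicCorners P)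
    (hQ : T.HasMonicCorners Q) : T.HasMonicCorners (P * Q) := by
  intro S
  obtain ⟨x, hx⟩ := hP S
  obtain ⟨y, hy⟩ := hQ S
  exact ⟨x + y, by rw [map_mul, hx, hy, monoZ_add]⟩

theorem HasMonicCorners.pow {P : MvPolynomial T.Coord (T.Puiseux ℤ)} (hP : T.HasMonicCorners P)
    (a : ℕ) : T.HasMonicCorners (P ^ a) := by
  induction a with
  | zero => simpa using HasMonicCorners.one
  | succ a ih => rw [pow_succ]; exact ih.mul hP

theorem HasMonicCorners.of_mul {P Q : MvPolynomial T.Coord (T.Puiseux ℤ)}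
    (hP : T.HasMonicCorners P) (hQ : T.HasMonicCorners (P * Q)) : T.HasMonicCorners Q := by
  intro S
  obtain ⟨x, hx⟩ := hP S
  obtain ⟨y, hy⟩ := hQ S
  refine ⟨-x + y, ?_⟩
  rw [map_mul, hx] at hy
  rw [monoZ_add, ← hy, ← mul_assoc, monoZ_neg_mul, one_mul]

theorem hasMonicCorners_scaledForm (c : T.Center) :
    T.HasMonicCorners (T.scaledForm T.monoZ c) := by
  intro S
  rcases (show S c.1 = 0 ∨ S c.1 = 1 by omega) with h | h
  · exact ⟨_, by simp [scaledForm, centerForm, cornerPoint, h]; rfl⟩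
  · refine ⟨-T.ω c.1 • T.gexp c + T.gexp c, ?_⟩
    simp [scaledForm, centerForm, cornerPoint, h, monoZ_add]

theorem hasMonicCorners_multiplier (r : T.Root) (z : T.Coord) :
    T.HasMonicCorners (T.multiplier T.monoZ r z) := by
  by_cases h0 : (r.2 : ℤ) = 0
  swap
  · rw [multiplier_of_ne_zero h0]
    exact HasMonicCorners.one
  obtain ⟨n, i⟩ := z
  by_cases h1 : n = r.1 - 1
  · subst h1
    rw [multiplier_sub_one h0]
    split_ifs
    · exact hasMonicCorners_scaledForm _
    · exact hasMonicCorners_scaledForm _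
  by_cases h2 : n = r.1 + 1
  · subst h2
    rw [multiplier_add_one h0]
    split_ifs
    · exact hasMonicCorners_scaledForm _
    · exact hasMonicCorners_scaledForm _
  · rw [multiplier_of_ne r h1 h2]
    exact HasMonicCorners.one

theorem hasMonicCorners_denom (r : T.Root) (Λ : T.NS) :
    T.HasMonicCorners (T.denom T.monoZ r Λ) := by
  unfold denom
  split_ifs
  · exact ((hasMonicCorners_scaledForm _).pow _).mul ((hasMonicCorners_scaledForm _).pow _)
  · exact HasMonicCorners.one

theorem hasMonicCorners_numer (r : T.Root) (Λ : T.NS) :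
    T.HasMonicCorners (T.numer T.monoZ r Λ) := by
  unfold numer
  split_ifs
  · exact ((hasMonicCorners_scaledForm _).pow _).mul ((hasMonicCorners_scaledForm _).pow _)
  · exact HasMonicCorners.one

/-- Only one coordinate per row survives at a corner point, so the multiplier may be replaced by its
value for that coordinate and depends on the row alone. Multihomogeneity then factors out monic
monomials. -/
theorem HasMonicCorners.subZ {P : MvPolynomial T.Coord (T.Puiseux ℤ)} {d : ZMod T.N → ℤ}
    (hd : T.IsMultihomogeneous d P) (hP : T.HasMonicCorners P) (r : T.Root) :
    T.HasMonicCorners (T.subZ r P) := by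
  intro S
  let w : ZMod T.N → T.Puiseux ℤ := fun n =>
    MvPolynomial.eval (T.cornerPoint S) (T.multiplier T.monoZ r (n, S n))
  have e : (MvPolynomial.eval (T.cornerPoint S)).comp (T.subZ r) =
      MvPolynomial.eval₂Hom (T.sZ r) (fun z => w z.1 * T.cornerPoint S z) := by
    refine MvPolynomial.ringHom_ext ?_ ?_
    · intro a
      simp [substitution]
    · rintro ⟨n, i⟩
      simp only [RingHom.comp_apply, substitution, MvPolynomial.coe_eval₂Hom,
        MvPolynomial.eval₂_X, map_mul, MvPolynomial.eval_X, w]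
      by_cases h : i = S n
      · rw [h]
      · simp [cornerPoint, h]
  have e1 : MvPolynomial.eval (T.cornerPoint S) (T.subZ r P) = _ :=
    (RingHom.congr_fun e P).trans (hd.eval₂Hom_mul (T.sZ r) w (T.cornerPoint S))
  have e2 : MvPolynomial.eval₂Hom (T.sZ r) (T.cornerPoint S) P =
      T.sZ r (MvPolynomial.eval (T.cornerPoint S) P) := by
    have : MvPolynomial.eval₂Hom (T.sZ r) (T.cornerPoint S) =
        (T.sZ r).comp (MvPolynomial.eval (T.cornerPoint S)) := by
      refine MvPolynomial.ringHom_ext ?_ ?_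
      · intro a; simp
      · intro z
        by_cases h : z.2 = S z.1 <;> simp [cornerPoint, h]
    rw [this]
    rfl
  rw [e1, e2]
  obtain ⟨x, hx⟩ := hP S
  choose y hy using fun n => hasMonicCorners_multiplier r (n, S n) S
  have hprod : ∀ s : Finset (ZMod T.N), ∃ v, ∏ n ∈ s, w n ^ (d n).toNat = T.monoZ v := by
    intro s
    induction s using Finset.induction_on with
    | empty => exact ⟨0, rfl⟩
    | insert n s hn ih =>
      obtain ⟨v, hv⟩ := ih
      have hpow : ∀ a : ℕ, w n ^ a = T.monoZ (a • y n) := by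
        intro a
        induction a with
        | zero => rw [pow_zero, zero_nsmul, monoZ_zero]
        | succ a ih => rw [pow_succ, ih, succ_nsmul, monoZ_add, ← hy n]
      exact ⟨(d n).toNat • y n + v, by rw [Finset.prod_insert hn, hv, hpow, monoZ_add]⟩
  obtain ⟨v, hv⟩ := hprod Finset.univ
  exact ⟨v + T.expAct r x, by rw [hv, hx, sZ_monoZ, monoZ_add]⟩

/-! ### The normalization as the vanishing of a logarithmic derivative -/

open TrivSqZeroExt in
/-- The homomorphism `a^x ↦ 1 + φ(x) ε` to the dual numbers. -/
def tangent (φ : (T.Root → ℚ) →+ ℚ) : T.Puiseux ℤ →+* DualNumber ℚ :=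
  (AddMonoidAlgebra.lift ℤ (DualNumber ℚ) (T.Root → ℚ)
    { toFun := fun x => inl 1 + inr (φ x.toAdd)
      map_one' := by ext <;> simp
      map_mul' := fun x y => by ext <;> simp [add_comm] } : T.Puiseux ℤ →ₐ[ℤ] DualNumber ℚ)

open TrivSqZeroExt in
theorem tangent_single (φ : (T.Root → ℚ) →+ ℚ) (x : T.Root → ℚ) (c : ℤ) :
    tangent φ (AddMonoidAlgebra.single x c) = inl (c : ℚ) + inr ((c : ℚ) * φ x) := by
  have h : tangent φ (AddMonoidAlgebra.single x c) = c • (inl 1 + inr (φ x)) := by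
    simp [tangent]
  rw [h]
  ext
  · simp
  · simp [mul_comm]

open TrivSqZeroExt in
theorem tangent_monoZ (φ : (T.Root → ℚ) →+ ℚ) (x : T.Root → ℚ) :
    tangent φ (T.monoZ x) = inl 1 + inr (φ x) := by
  rw [monoZ, tangent_single]
  simp

theorem tangent_comp_sZ (φ : (T.Root → ℚ) →+ ℚ) (r : T.Root) :
    (tangent φ).comp (T.sZ r) = tangent (φ.comp (T.expAct r : (T.Root → ℚ) →+ (T.Root → ℚ))) := by
  refine AddMonoidAlgebra.ringHom_ext ?_ ?_ <;>
  · intro c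
    rw [RingHom.comp_apply, sZ_single, tangent_single, tangent_single]
    rfl

variable (T) in
/-- The coordinates `1/θ` of the base point of the normalization. -/
def thetaInv (z : T.Coord) : ℚ := if z.2 = 0 then 1 / T.θ0 z.1 else 1 / T.θinf z.1

/-- First order expansion of a polynomial at the base point `a = 1`, `ζ = 1/θ`. -/
def expand (φ : (T.Root → ℚ) →+ ℚ) : MvPolynomial T.Coord (T.Puiseux ℤ) →+* DualNumber ℚ :=
  MvPolynomial.eval₂Hom (tangent φ) fun z => TrivSqZeroExt.inl (T.thetaInv z)

variable (T) in
/-- The first order expansions are nonzero constants. -/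
def IsBalanced (P : MvPolynomial T.Coord (T.Puiseux ℤ)) : Prop :=
  ∃ e : ℚ, e ≠ 0 ∧ ∀ φ, expand φ P = TrivSqZeroExt.inl e

theorem IsBalanced.one : T.IsBalanced 1 := ⟨1, one_ne_zero, fun φ => by simp⟩

theorem IsBalanced.mul {P Q : MvPolynomial T.Coord (T.Puiseux ℤ)} (hP : T.IsBalanced P)
    (hQ : T.IsBalanced Q) : T.IsBalanced (P * Q) := by
  obtain ⟨a, ha, hP⟩ := hP
  obtain ⟨b, hb, hQ⟩ := hQ
  exact ⟨a * b, mul_ne_zero ha hb, fun φ => by rw [map_mul, hP, hQ, TrivSqZeroExt.inl_mul]⟩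

theorem IsBalanced.pow {P : MvPolynomial T.Coord (T.Puiseux ℤ)} (hP : T.IsBalanced P)
    (a : ℕ) : T.IsBalanced (P ^ a) := by
  induction a with
  | zero => simpa using IsBalanced.one
  | succ a ih => rw [pow_succ]; exact ih.mul hP

theorem IsBalanced.of_mul {P Q : MvPolynomial T.Coord (T.Puiseux ℤ)} (hP : T.IsBalanced P)
    (hQ : T.IsBalanced (P * Q)) : T.IsBalanced Q := by
  obtain ⟨a, ha, hP⟩ := hP
  obtain ⟨b, hb, hQ⟩ := hQ
  refine ⟨a⁻¹ * b, mul_ne_zero (inv_ne_zero ha) hb, fun φ => ?_⟩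
  rw [TrivSqZeroExt.inl_mul, ← hQ φ, map_mul, hP, ← mul_assoc, ← TrivSqZeroExt.inl_mul,
    inv_mul_cancel₀ ha, TrivSqZeroExt.inl_one, one_mul]

/-- The ε-part is φ(g) times -ω(1/θ^0 + 1/θ^∞) + 1/θ^∞, and ω = θ^0/(θ^0+θ^∞) is the value at which
it vanishes. -/
theorem isBalanced_scaledForm (c : T.Center) : T.IsBalanced (T.scaledForm T.monoZ c) := by
  obtain ⟨h1, h2⟩ := T.θ_pos c.1
  refine ⟨1 / T.θ0 c.1 + 1 / T.θinf c.1, by positivity, fun φ => ?_⟩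
  have hφ : φ (-T.ω c.1 • T.gexp c) = -T.ω c.1 * φ (T.gexp c) := map_rat_smul φ _ _
  simp only [scaledForm, centerForm, expand, map_mul, map_add, MvPolynomial.coe_eval₂Hom,
    MvPolynomial.eval₂_C, MvPolynomial.eval₂_X,
    tangent_monoZ, thetaInv, hφ, if_true, one_ne_zero, if_false]
  ext
  · simp
  · simp
    rw [ω]
    field_simp
    ring

theorem isBalanced_denom (r : T.Root) (Λ : T.NS) : T.IsBalanced (T.denom T.monoZ r Λ) := by
  unfold denom
  split_ifs
  · exact ((isBalanced_scaledForm _).pow _).mul ((isBalanced_scaledForm _).pow _)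
  · exact IsBalanced.one

theorem isBalanced_numer (r : T.Root) (Λ : T.NS) : T.IsBalanced (T.numer T.monoZ r Λ) := by
  unfold numer
  split_ifs
  · exact ((isBalanced_scaledForm _).pow _).mul ((isBalanced_scaledForm _).pow _)
  · exact IsBalanced.one

/-- The expansions of the multipliers depend only on the row. -/
theorem exists_expand_multiplier (r : T.Root) : ∃ w : ZMod T.N → ℚ, (∀ n, w n ≠ 0) ∧
    ∀ φ z, expand φ (T.multiplier T.monoZ r z) = TrivSqZeroExt.inl (w z.1) := by
  obtain ⟨h1, h2⟩ := T.θ_pos r.1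
  have hF : ∀ c : T.Center, c.1 = r.1 → ∀ φ, expand φ (T.scaledForm T.monoZ c) =
      TrivSqZeroExt.inl (1 / T.θ0 r.1 + 1 / T.θinf r.1) := by
    intro c hc φ
    obtain ⟨e, _, h⟩ := isBalanced_scaledForm c
    rw [h φ]
    congr 1
    -- The constant does not depend on φ, so it can be read off at φ = 0, where only the row of the
    -- center matters.
    have h0 := h 0
    have := congrArg TrivSqZeroExt.fst h0
    rw [TrivSqZeroExt.fst_inl] at this
    rw [← this, ← hc]
    simp [scaledForm, centerForm, expand, tangent_monoZ, thetaInv]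
  refine ⟨fun n => if (r.2 : ℤ) = 0 ∧ (n = r.1 - 1 ∨ n = r.1 + 1) then
    1 / T.θ0 r.1 + 1 / T.θinf r.1 else 1, fun n => ?_, fun φ z => ?_⟩
  · simp only
    split_ifs
    · positivity
    · exact one_ne_zero
  · by_cases h0 : (r.2 : ℤ) = 0
    swap
    · dsimp only
      rw [multiplier_of_ne_zero h0, map_one, if_neg (fun h => h0 h.1), TrivSqZeroExt.inl_one]
    obtain ⟨n, i⟩ := z
    dsimp only
    by_cases h1 : n = r.1 - 1
    · subst h1
      rw [if_pos ⟨h0, Or.inl rfl⟩, multiplier_sub_one h0]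
      split_ifs
      · exact hF (T.far r) rfl φ
      · exact hF (T.near r) rfl φ
    by_cases h2 : n = r.1 + 1
    · subst h2
      rw [if_pos ⟨h0, Or.inr rfl⟩, multiplier_add_one h0]
      split_ifs
      · exact hF (T.near r) rfl φ
      · exact hF (T.far r) rfl φ
    · rw [multiplier_of_ne r h1 h2, map_one, if_neg (fun h => not_or.2 ⟨h1, h2⟩ h.2),
        TrivSqZeroExt.inl_one]

/-- The substitution turns expansion along φ into expansion along φ composed with the reflection,
times constants of the rows. This is why balance is demanded for all φ at once with the same
constant. -/
theorem IsBalanced.subZ {P : MvPolynomial T.Coord (T.Puiseux ℤ)} {d : ZMod T.N → ℤ}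
    (hd : T.IsMultihomogeneous d P) (hP : T.IsBalanced P) (r : T.Root) :
    T.IsBalanced (T.subZ r P) := by
  obtain ⟨e, he, hP⟩ := hP
  obtain ⟨w, hw, hm⟩ := exists_expand_multiplier r
  refine ⟨(∏ n, w n ^ (d n).toNat) * e,
    mul_ne_zero (Finset.prod_ne_zero_iff.2 fun n _ => pow_ne_zero _ (hw n)) he, fun φ => ?_⟩
  have e1 : (expand φ).comp (T.subZ r) = MvPolynomial.eval₂Hom ((tangent φ).comp (T.sZ r))
      (fun z => TrivSqZeroExt.inl (w z.1) * TrivSqZeroExt.inl (T.thetaInv z)) := by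
    refine MvPolynomial.ringHom_ext ?_ ?_
    · intro a
      simp [substitution, expand]
    · intro z
      simp only [RingHom.comp_apply, substitution, MvPolynomial.coe_eval₂Hom,
        MvPolynomial.eval₂_X, map_mul, hm]
      simp [expand]
  have e2 := (RingHom.congr_fun e1 P).trans (hd.eval₂Hom_mul ((tangent φ).comp (T.sZ r))
    (fun n => TrivSqZeroExt.inl (w n)) (fun z => TrivSqZeroExt.inl (T.thetaInv z)))
  rw [RingHom.comp_apply] at e2
  have e3 := hP (φ.comp (T.expAct r : (T.Root → ℚ) →+ (T.Root → ℚ)))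
  rw [expand, ← tangent_comp_sZ] at e3
  rw [e2, e3, TrivSqZeroExt.inl_mul]
  congr 1
  have : ∀ s : Finset (ZMod T.N), (∏ n ∈ s, (TrivSqZeroExt.inl (w n) : DualNumber ℚ) ^ (d n).toNat) =
      TrivSqZeroExt.inl (∏ n ∈ s, w n ^ (d n).toNat) := by
    intro s
    have := map_prod (TrivSqZeroExt.inlHom ℚ ℚ) (fun n => w n ^ (d n).toNat) s
    simp only [map_pow] at this
    exact this.symm
  exact this _

end TropicalDatum
end

/-! ### Weighted exponents and uniqueness of the normalization -/

noncomputable section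
namespace TropicalDatum
variable {T : TropicalDatum}

/-- The exponent of `∏_m A_m^{(1/θ)^m}`. -/
def weightedExponent (P : MvPolynomial T.Coord (T.Puiseux ℤ)) : T.Root → ℚ :=
  ∑ m ∈ P.support, (P.coeff m).coeff.sum fun x c => ((c : ℚ) * T.thetaWeight m) • x

theorem mono_sum {ι : Type*} (s : Finset ι) (f : ι → T.Root → ℚ) :
    T.mono (∑ i ∈ s, f i) = ∏ i ∈ s, T.mono (f i) := by
  classical
  induction s using Finset.induction_on with
  | empty => exact T.mono_zero
  | insert i s hi ih => rw [Finset.sum_insert hi, Finset.prod_insert hi, mono_add, ih]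

theorem mono_weightedExponent (P : MvPolynomial T.Coord (T.Puiseux ℤ)) :
    T.mono (weightedExponent P) = ∏ m ∈ P.support, (P.coeff m).coeff.prod
      (fun x c => T.mono (((c : ℚ) * T.thetaWeight m) • x)) := by
  rw [weightedExponent, mono_sum]
  refine Finset.prod_congr rfl fun m _ => ?_
  rw [Finsupp.sum, mono_sum, Finsupp.prod]

theorem snd_tangent (φ : (T.Root → ℚ) →+ ℚ) (p : T.Puiseux ℤ) :
    (tangent φ p).snd = p.coeff.sum fun x c => (c : ℚ) * φ x := by
  induction p using AddMonoidAlgebra.induction_linear with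
  | zero => simp
  | add f g hf hg =>
    rw [map_add, TrivSqZeroExt.snd_add, hf, hg, AddMonoidAlgebra.coeff_add, Finsupp.sum_add_index']
    · simp
    · intros; push_cast; ring
  | single x c =>
    rw [tangent_single, AddMonoidAlgebra.coeff_single, Finsupp.sum_single_index] <;> simp

theorem thetaWeight_eq (m : T.Coord →₀ ℕ) : T.thetaWeight m = ∏ z, T.thetaInv z ^ m z := by
  rw [thetaWeight, Fintype.prod_prod_type]
  simp [thetaInv]

/-- A term c a^x ζ^m contributes c φ(x)(1/θ)^m to the ε-part, which is the logarithm, seen through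
φ, of its factor in the normalization product. -/
theorem snd_expand (φ : (T.Root → ℚ) →+ ℚ) (P : MvPolynomial T.Coord (T.Puiseux ℤ)) :
    (expand φ P).snd = φ (weightedExponent P) := by
  rw [expand, MvPolynomial.coe_eval₂Hom, MvPolynomial.eval₂_eq', TrivSqZeroExt.snd_sum,
    weightedExponent, map_sum]
  refine Finset.sum_congr rfl fun m _ => ?_
  have h := map_prod (TrivSqZeroExt.inlHom ℚ ℚ) (fun z => T.thetaInv z ^ m z) Finset.univ
  simp only [map_pow] at h
  have h' : ∏ z : T.Coord, (TrivSqZeroExt.inl (T.thetaInv z) : DualNumber ℚ) ^ m z =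
      TrivSqZeroExt.inl (T.thetaWeight m) := by
    rw [thetaWeight_eq]
    exact h.symm
  rw [h', Finsupp.sum, map_sum]
  simp only [TrivSqZeroExt.snd_mul, TrivSqZeroExt.snd_inl, TrivSqZeroExt.fst_inl, snd_tangent,
    op_smul_eq_smul, smul_eq_mul, mul_zero, zero_add]
  rw [Finsupp.sum, Finset.mul_sum]
  refine Finset.sum_congr rfl fun x _ => ?_
  rw [map_rat_smul φ, smul_eq_mul]
  ring

theorem eq_zero_of_forall_hom {x : T.Root → ℚ} (h : ∀ φ : (T.Root → ℚ) →+ ℚ, φ x = 0) : x = 0 :=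
  funext fun r => h (Pi.evalAddMonoidHom (fun _ => ℚ) r)

theorem IsBalanced.weightedExponent_eq_zero {P : MvPolynomial T.Coord (T.Puiseux ℤ)}
    (h : T.IsBalanced P) : weightedExponent P = 0 := by
  obtain ⟨e, _, h⟩ := h
  exact eq_zero_of_forall_hom fun φ => by rw [← snd_expand, h, TrivSqZeroExt.snd_inl]

theorem isNormalized_iff {d : ZMod T.N → ℤ} {Φ : MvPolynomial T.Coord T.K}
    (hd : T.IsMultihomogeneous d Φ) : T.IsNormalized d Φ ↔ ∃ P,
      MvPolynomial.map T.puiseuxToK P = Φ ∧ T.HasMonicCorners P ∧ weightedExponent P = 0 := by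
  refine exists_congr fun P => and_congr_right fun hP => ?_
  have hd' : T.IsMultihomogeneous d P := IsMultihomogeneous.of_map T.puiseuxToK_injective (hP ▸ hd)
  refine and_congr ?_ ?_
  · simp only [T.coeff_corner hd']
    rfl
  · rw [← mono_weightedExponent, ← T.mono_zero, T.mono_injective.eq_iff]

/-- Proportional normalized polynomials agree. -/
theorem eq_of_eq_smul {P P' : MvPolynomial T.Coord (T.Puiseux ℤ)}
    (hc : T.HasMonicCorners P) (hc' : T.HasMonicCorners P') (hb : T.IsBalanced P)
    (hb' : weightedExponent P' = 0) {a : T.K}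
    (h : MvPolynomial.map T.puiseuxToK P' = a • MvPolynomial.map T.puiseuxToK P) : P' = P := by
  have hev : ∀ Q : MvPolynomial T.Coord (T.Puiseux ℤ),
      MvPolynomial.eval (T.cornerPoint 0) (MvPolynomial.map T.puiseuxToK Q) =
        T.puiseuxToK (MvPolynomial.eval (T.cornerPoint 0) Q) := by
    intro Q
    rw [MvPolynomial.eval_map, ← MvPolynomial.coe_eval₂Hom, ← RingHom.comp_apply]
    refine RingHom.congr_fun (MvPolynomial.ringHom_ext ?_ ?_) Q
    · intro a; simp
    · intro z
      by_cases h : z.2 = (0 : ZMod T.N → Fin 2) z.1 <;> simp [cornerPoint, h]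
  obtain ⟨x, hx⟩ := hc 0
  obtain ⟨y, hy⟩ := hc' 0
  -- One corner already shows that the scalar is a monic monomial; its exponent is then the ε-part
  -- of `P'` divided by the nonzero constant of `P`.
  have ha : a = T.mono (y - x) := by
    have := congrArg (MvPolynomial.eval (T.cornerPoint 0)) h
    rw [hev, hy, MvPolynomial.smul_eval, hev, hx, puiseuxToK_monoZ, puiseuxToK_monoZ] at this
    rw [sub_eq_add_neg, mono_add, mono_neg, this, mul_inv_cancel_right₀ (T.mono_ne_zero x)]
  have h' : P' = MvPolynomial.C (T.monoZ (y - x)) * P := by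
    refine T.map_puiseuxToK_injective ?_
    rw [h, map_mul, MvPolynomial.map_C, puiseuxToK_monoZ, ← ha, MvPolynomial.smul_eq_C_mul]
  have h0 : y - x = 0 := by
    refine eq_zero_of_forall_hom fun φ => ?_
    obtain ⟨e, he, hb⟩ := hb
    have := snd_expand φ P'
    rw [hb', map_zero, h', map_mul, hb, expand, MvPolynomial.coe_eval₂Hom, MvPolynomial.eval₂_C,
      tangent_monoZ] at this
    simpa [he] using this
  rw [h', h0, monoZ_zero, MvPolynomial.C_1, one_mul]

end TropicalDatum
end

noncomputable section
namespace TropicalDatum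
variable (T : TropicalDatum)

/-! ### Simple reflections on the `τ`-variables -/

theorem sL_const (r : T.Root) (a : T.K) : T.sL r (T.const a) = T.const (T.sK r a) := by
  rw [const, RingHom.comp_apply, sL, IsFractionRing.lift_algebraMap, sPoly]
  simp [const]

theorem sL_tauVar (r : T.Root) (c : T.Center) : T.sL r (T.tauVar c) = T.sTau r c := by
  rw [tauVar, sL, IsFractionRing.lift_algebraMap, sPoly]
  simp

theorem tauVar_near (r : T.Root) : T.tauVar (T.near r) =
    T.tau r.1 (if (r.2 : ℤ) = 0 then 1 else r.2) := (T.tau_center (T.near r)).symm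

theorem tauVar_far (r : T.Root) : T.tauVar (T.far r) =
    T.tau r.1 (if (r.2 : ℤ) = 0 then -1 else if 0 < (r.2 : ℤ) then r.2 + 1 else r.2 - 1) :=
  (T.tau_center (T.far r)).symm

theorem sTau_of_ne {r : T.Root} {c : T.Center} (h1 : c ≠ T.near r) (h2 : c ≠ T.far r) :
    T.sTau r c = T.tauVar c := by
  have h1' : ¬ (c.1 = r.1 ∧ (c.2 : ℤ) = if (r.2 : ℤ) = 0 then 1 else (r.2 : ℤ)) :=
    fun h => h1 (T.center_ext h.1 h.2)
  have h2' : ¬ (c.1 = r.1 ∧ (c.2 : ℤ) = if (r.2 : ℤ) = 0 then -1 else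
      if 0 < (r.2 : ℤ) then (r.2 : ℤ) + 1 else r.2 - 1) :=
    fun h => h2 (T.center_ext h.1 h.2)
  rw [← tau_center, sTau]
  by_cases h : c.1 = r.1
  · rw [if_neg (not_not.2 h)]
    split_ifs <;> simp_all
  · rw [if_pos h]

theorem sTau_of_ne_zero {r : T.Root} (h : (r.2 : ℤ) ≠ 0) (c : T.Center) :
    T.sTau r c = T.tauVar (T.perm r c) := by
  by_cases h1 : c = T.near r
  · subst h1
    rw [perm_near, tauVar_far]
    by_cases h3 : 0 < (r.2 : ℤ) <;> simp [sTau, near_snd, h, h3]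
  by_cases h2 : c = T.far r
  · subst h2
    rw [perm_far, tauVar_near]
    by_cases h3 : 0 < (r.2 : ℤ) <;> simp [sTau, far_snd, h, h3]
  rw [T.sTau_of_ne h1 h2, T.perm_of_ne r c h1 h2]

theorem aeval_scaledForm (c : T.Center) : MvPolynomial.aeval T.zeta (T.scaledForm T.mono c) =
    T.const (T.mono (-T.ω c.1 • T.gexp c)) * (T.ξ (c.1 + 1) * T.η (c.1 - 1)) +
      T.const (T.mono ((1 - T.ω c.1) • T.gexp c)) * (T.ξ (c.1 - 1) * T.η (c.1 + 1)) := by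
  rw [show (1 - T.ω c.1) • T.gexp c = -T.ω c.1 • T.gexp c + T.gexp c by module, mono_add, map_mul]
  simp only [scaledForm, centerForm, map_mul, map_add, MvPolynomial.aeval_C, MvPolynomial.aeval_X,
    ← const_eq, zeta, if_true, one_ne_zero, if_false]
  ring

/-- The numerators in the action on the τ-variables are the scaled forms at ζ(τ). This ties the
action on L to the substitution. -/
theorem Fu_eq {r : T.Root} (h : (r.2 : ℤ) = 0) :
    T.Fu r.1 = MvPolynomial.aeval T.zeta (T.scaledForm T.mono (T.near r)) := by
  rw [aeval_scaledForm, Fu, T.uExp_eq h, near_fst]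

theorem Fv_eq {r : T.Root} (h : (r.2 : ℤ) = 0) :
    T.Fv r.1 = MvPolynomial.aeval T.zeta (T.scaledForm T.mono (T.far r)) := by
  rw [aeval_scaledForm, Fv, T.vExp_eq h, far_fst,
    show T.ω r.1 • -T.gexp (T.far r) = -T.ω r.1 • T.gexp (T.far r) by module,
    show (-1 + T.ω r.1) • -T.gexp (T.far r) = (1 - T.ω r.1) • T.gexp (T.far r) by module]

/-- The product of the two `τ`-variables involved in a simple reflection. -/
def pairTau (r : T.Root) : T.L := T.tauVar (T.near r) * T.tauVar (T.far r)

theorem pairTau_ne_zero (r : T.Root) : T.pairTau r ≠ 0 :=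
  mul_ne_zero (T.tauVar_ne_zero _) (T.tauVar_ne_zero _)

theorem sTau_near {r : T.Root} (h : (r.2 : ℤ) = 0) : T.sTau r (T.near r) =
    T.tauVar (T.near r) * ((T.pairTau r)⁻¹ * T.Fv r.1) := by
  have e : T.sTau r (T.near r) = T.Fv r.1 / T.tauVar (T.far r) := by
    rw [tauVar_far]
    simp [sTau, near_snd, h]
  rw [e, pairTau]
  have h1 := T.tauVar_ne_zero (T.near r)
  have h2 := T.tauVar_ne_zero (T.far r)
  field_simp

theorem sTau_far {r : T.Root} (h : (r.2 : ℤ) = 0) : T.sTau r (T.far r) =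
    T.tauVar (T.far r) * ((T.pairTau r)⁻¹ * T.Fu r.1) := by
  have e : T.sTau r (T.far r) = T.Fu r.1 / T.tauVar (T.near r) := by
    rw [tauVar_near]
    simp [sTau, far_snd, h]
  rw [e, pairTau]
  have h1 := T.tauVar_ne_zero (T.near r)
  have h2 := T.tauVar_ne_zero (T.far r)
  field_simp

/-- The factor acquired by a `τ`-variable under `s_n^0`. -/
def gain (r : T.Root) (c : T.Center) : T.L :=
  if c = T.near r then (T.pairTau r)⁻¹ * T.Fv r.1
  else if c = T.far r then (T.pairTau r)⁻¹ * T.Fu r.1 else 1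

theorem gain_near (r : T.Root) : T.gain r (T.near r) = (T.pairTau r)⁻¹ * T.Fv r.1 := if_pos rfl

theorem gain_far (r : T.Root) : T.gain r (T.far r) = (T.pairTau r)⁻¹ * T.Fu r.1 := by
  rw [gain, if_neg (T.near_ne_far r).symm, if_pos rfl]

theorem gain_of_ne {r : T.Root} {c : T.Center} (h1 : c ≠ T.near r) (h2 : c ≠ T.far r) :
    T.gain r c = 1 := by rw [gain, if_neg h1, if_neg h2]

theorem sTau_of_eq_zero {r : T.Root} (h : (r.2 : ℤ) = 0) (c : T.Center) :
    T.sTau r c = T.tauVar c * T.gain r c := by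
  by_cases h1 : c = T.near r
  · rw [h1, T.sTau_near h, gain_near]
  by_cases h2 : c = T.far r
  · rw [h2, T.sTau_far h, gain_far]
  rw [T.sTau_of_ne h1 h2, T.gain_of_ne h1 h2, mul_one]

/-- `ξ_n` and `η_n`. -/
def block (n : ZMod T.N) (i : Fin 2) : T.L :=
  ∏ c : T.Center, if c.1 = n ∧ T.side c = i then T.tauVar c else 1

theorem block_eq (n : ZMod T.N) (i : Fin 2) : T.block n i =
    ∏ j ∈ (Finset.Icc (-(T.ℓ n : ℤ)) (T.k n : ℤ)).erase 0,
      if (if 0 < j then (0 : Fin 2) else 1) = i then T.tau n j else 1 := by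
  rw [block, Fintype.prod_sigma, Fintype.prod_eq_single n]
  · refine Eq.trans ?_ (Finset.prod_coe_sort ((Finset.Icc (-(T.ℓ n : ℤ)) (T.k n : ℤ)).erase 0)
      fun j => if (if 0 < j then (0 : Fin 2) else 1) = i then T.tau n j else 1)
    refine Fintype.prod_congr _ _ fun j => ?_
    simp only [true_and, side, ← T.tau_center ⟨n, j⟩]
  · intro m hm
    simp [hm]

theorem ξ_eq_block (n : ZMod T.N) : T.ξ n = T.block n 0 := by
  rw [block_eq, ξ, ← Finset.prod_filter]
  refine Finset.prod_nbij' (fun i : ℕ => (i : ℤ)) Int.toNat ?_ ?_ ?_ ?_ ?_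
  · intro i hi
    rw [Finset.mem_Icc] at hi
    simp only [Finset.mem_filter, Finset.mem_erase, Finset.mem_Icc]
    refine ⟨by omega, by rw [if_pos (by omega)]⟩
  · intro j hj
    simp only [Finset.mem_filter, Finset.mem_erase, Finset.mem_Icc] at hj
    rw [Finset.mem_Icc]
    have : 0 < j := by
      by_contra h
      simp [h] at hj
    omega
  · intro i _; simp
  · intro j hj
    simp only [Finset.mem_filter, Finset.mem_erase, Finset.mem_Icc] at hj
    have : 0 < j := by
      by_contra h
      simp [h] at hj
    simp [this.le]
  · intro i _; rfl

theorem η_eq_block (n : ZMod T.N) : T.η n = T.block n 1 := by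
  rw [block_eq, η, ← Finset.prod_filter]
  refine Finset.prod_nbij' (fun i : ℕ => -(i : ℤ)) (fun j => (-j).toNat) ?_ ?_ ?_ ?_ ?_
  · intro i hi
    rw [Finset.mem_Icc] at hi
    simp only [Finset.mem_filter, Finset.mem_erase, Finset.mem_Icc]
    refine ⟨by omega, by rw [if_neg (by omega)]⟩
  · intro j hj
    simp only [Finset.mem_filter, Finset.mem_erase, Finset.mem_Icc] at hj
    rw [Finset.mem_Icc]
    have : ¬ 0 < j := by
      intro h
      simp [h] at hj
    omega
  · intro i _; simp
  · intro j hj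
    simp only [Finset.mem_filter, Finset.mem_erase, Finset.mem_Icc] at hj
    have : ¬ 0 < j := by
      intro h
      simp [h] at hj
    omega
  · intro i _; rfl

theorem zeta_eq (z : T.Coord) :
    T.zeta z = T.block (z.1 + 1) z.2 * T.block (z.1 - 1) (1 - z.2) := by
  obtain ⟨n, i⟩ := z
  rw [zeta]
  simp only [ξ_eq_block, η_eq_block]
  fin_cases i
  · simp
  · exact mul_comm _ _

theorem sL_block_of_ne_zero {r : T.Root} (h : (r.2 : ℤ) ≠ 0) (n : ZMod T.N) (i : Fin 2) :
    T.sL r (T.block n i) = T.block n i := by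
  rw [block, map_prod]
  refine Fintype.prod_equiv (T.perm r) _ _ fun c => ?_
  rw [perm_fst, (T.side_perm h c).1]
  split_ifs
  · rw [sL_tauVar, T.sTau_of_ne_zero h]
  · rw [map_one]

theorem sL_block_of_eq_zero {r : T.Root} (h : (r.2 : ℤ) = 0) (n : ZMod T.N) (i : Fin 2) :
    T.sL r (T.block n i) = T.block n i *
      if n = r.1 then (T.pairTau r)⁻¹ * (if i = 0 then T.Fv r.1 else T.Fu r.1) else 1 := by
  have e : T.sL r (T.block n i) =
      T.block n i * ∏ c, if c.1 = n ∧ T.side c = i then T.gain r c else 1 := by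
    rw [block, map_prod, ← Finset.prod_mul_distrib]
    refine Finset.prod_congr rfl fun c _ => ?_
    split_ifs
    · rw [sL_tauVar, T.sTau_of_eq_zero h]
    · rw [map_one, one_mul]
  rw [e]
  congr 1
  rw [Fintype.prod_eq_mul _ _ (T.near_ne_far r) fun c hc => by
    rw [T.gain_of_ne hc.1 hc.2, ite_self]]
  rw [(side_near h).1, (side_far h).1, near_fst, far_fst, gain_near, gain_far]
  by_cases hn : n = r.1
  · subst hn
    fin_cases i <;> simp
  · simp [hn, Ne.symm hn]

/-- The denominators acquired by the coordinates under a simple reflection. -/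
def rowFactor (r : T.Root) (n : ZMod T.N) : T.L :=
  if (r.2 : ℤ) = 0 ∧ (n = r.1 - 1 ∨ n = r.1 + 1) then (T.pairTau r)⁻¹ else 1

/-- ζ_{n-1} and ζ_{n+1} each contain exactly one of ξ_n, η_n, and s_n^0 multiplies these by the form
of C_n^{-1} resp. C_n^1 over τ_n^1 τ_n^{-1}. The multipliers of the substitution record these forms.
-/
theorem sL_zeta (r : T.Root) (z : T.Coord) : T.sL r (T.zeta z) =
    T.rowFactor r z.1 * MvPolynomial.aeval T.zeta (T.subK r (MvPolynomial.X z)) := by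
  rw [subK_X, map_mul, MvPolynomial.aeval_X]
  by_cases h : (r.2 : ℤ) = 0
  swap
  · rw [rowFactor, if_neg (fun h' => h h'.1), multiplier_of_ne_zero h, map_one, one_mul, one_mul,
      zeta_eq, map_mul, T.sL_block_of_ne_zero h, T.sL_block_of_ne_zero h]
  have hne := T.add_one_ne_sub_one r.1
  have key : T.sL r (T.zeta z) = (if z.1 + 1 = r.1 then
      (T.pairTau r)⁻¹ * (if z.2 = 0 then T.Fv r.1 else T.Fu r.1) else 1) * (if z.1 - 1 = r.1 then
      (T.pairTau r)⁻¹ * (if 1 - z.2 = 0 then T.Fv r.1 else T.Fu r.1) else 1) * T.zeta z := by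
    rw [zeta_eq, map_mul, T.sL_block_of_eq_zero h, T.sL_block_of_eq_zero h]
    ring
  rw [key, ← mul_assoc]
  congr 1
  obtain ⟨n, i⟩ := z
  simp only [← eq_sub_iff_add_eq, sub_eq_iff_eq_add]
  by_cases h1 : n = r.1 - 1
  · subst h1
    have hw : T.rowFactor r (r.1 - 1) = (T.pairTau r)⁻¹ := if_pos ⟨h, Or.inl rfl⟩
    rw [multiplier_sub_one h, hw, if_pos rfl, if_neg hne.symm, mul_one, T.Fv_eq h, T.Fu_eq h]
    split_ifs <;> rfl
  by_cases h2 : n = r.1 + 1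
  · subst h2
    have hw : T.rowFactor r (r.1 + 1) = (T.pairTau r)⁻¹ := if_pos ⟨h, Or.inr rfl⟩
    rw [multiplier_add_one h, hw, if_neg hne, if_pos rfl, one_mul, T.Fv_eq h, T.Fu_eq h]
    fin_cases i <;> simp
  · rw [multiplier_of_ne r h1 h2, rowFactor, if_neg h1, if_neg h2,
      if_neg (fun h' => not_or.2 ⟨h1, h2⟩ h'.2), map_one]

theorem sL_aeval_zeta (r : T.Root) {d : ZMod T.N → ℤ} {f : MvPolynomial T.Coord T.K}
    (hf : T.IsMultihomogeneous d f) : T.sL r (MvPolynomial.aeval T.zeta f) =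
      (∏ n, T.rowFactor r n ^ (d n).toNat) * MvPolynomial.aeval T.zeta (T.subK r f) := by
  let φ : T.K →+* T.L := T.const.comp (T.sK r : T.K →+* T.K)
  have e1 : (T.sL r).comp (MvPolynomial.aeval T.zeta : _ →ₐ[T.K] T.L).toRingHom =
      MvPolynomial.eval₂Hom φ (fun z => T.rowFactor r z.1 *
        MvPolynomial.aeval T.zeta (T.subK r (MvPolynomial.X z))) := by
    refine MvPolynomial.ringHom_ext ?_ ?_
    · intro a
      simp [← const_eq, sL_const, φ]
    · intro z
      simp [sL_zeta]
  have e2 : (MvPolynomial.aeval T.zeta : _ →ₐ[T.K] T.L).toRingHom.comp (T.subK r) =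
      MvPolynomial.eval₂Hom φ (fun z =>
        MvPolynomial.aeval T.zeta (T.subK r (MvPolynomial.X z))) := by
    refine MvPolynomial.ringHom_ext ?_ ?_
    · intro a
      simp [subK_C, ← const_eq, φ]
    · intro z
      simp
  have e3 := (RingHom.congr_fun e1 f).trans (hf.eval₂Hom_mul φ (T.rowFactor r)
    (fun z => MvPolynomial.aeval T.zeta (T.subK r (MvPolynomial.X z))))
  rw [← e2] at e3
  exact e3

end TropicalDatum
end

noncomputable section
namespace TropicalDatum
variable (T : TropicalDatum)

/-! ### Values of normalized polynomials -/

/-- The product of the `τ`-variables to the powers given by the multiplicities. -/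
def multTau (Λ : T.NS) : T.L := ∏ c : T.Center, T.tauVar c ^ T.mult Λ c

theorem multTau_ne_zero (Λ : T.NS) : T.multTau Λ ≠ 0 :=
  Finset.prod_ne_zero_iff.2 fun c _ => zpow_ne_zero _ (T.tauVar_ne_zero c)

theorem sL_multTau_of_ne_zero {r : T.Root} (h : (r.2 : ℤ) ≠ 0) (Λ : T.NS) :
    T.sL r (T.multTau Λ) = T.multTau (T.s r Λ) := by
  rw [multTau, map_prod]
  refine Fintype.prod_equiv (T.perm r) _ _ fun c => ?_
  rw [map_zpow₀, sL_tauVar, T.sTau_of_ne_zero h, T.mult_s_of_ne_zero h, perm_perm]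

theorem sL_multTau_of_eq_zero {r : T.Root} (h : (r.2 : ℤ) = 0) (Λ : T.NS) :
    T.sL r (T.multTau Λ) = T.multTau Λ * (T.gain r (T.near r) ^ T.mult Λ (T.near r) *
      T.gain r (T.far r) ^ T.mult Λ (T.far r)) := by
  rw [multTau, map_prod, ← Fintype.prod_eq_mul (T.near r) (T.far r)
    (f := fun c => T.gain r c ^ T.mult Λ c) (T.near_ne_far r) fun c hc => by
      rw [T.gain_of_ne hc.1 hc.2, one_zpow], ← Finset.prod_mul_distrib]
  refine Finset.prod_congr rfl fun c _ => ?_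
  rw [map_zpow₀, sL_tauVar, T.sTau_of_eq_zero h, mul_zpow]

theorem multTau_s_of_eq_zero {r : T.Root} (h : (r.2 : ℤ) = 0) (Λ : T.NS) :
    T.multTau (T.s r Λ) = T.multTau Λ * T.pairTau r ^ (T.deg Λ (r.1 - 1) + T.deg Λ (r.1 + 1)
      - T.mult Λ (T.near r) - T.mult Λ (T.far r)) := by
  have e : ∀ c, T.tauVar c ^ T.mult (T.s r Λ) c = T.tauVar c ^ T.mult Λ c *
      T.tauVar c ^ (T.mult (T.s r Λ) c - T.mult Λ c) := by
    intro c
    rw [← zpow_add₀ (T.tauVar_ne_zero c)]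
    congr 1
    ring
  rw [multTau, Finset.prod_congr rfl fun c _ => e c, Finset.prod_mul_distrib, multTau]
  congr 1
  rw [Fintype.prod_eq_mul (T.near r) (T.far r) (T.near_ne_far r) fun c hc => by
    rw [T.mult_s_of_ne h Λ hc.1 hc.2, sub_self, zpow_zero], T.mult_s_near h, T.mult_s_far h,
    pairTau, mul_zpow]
  congr 2
  ring

theorem prod_rowFactor {r : T.Root} (h : (r.2 : ℤ) = 0) {d : ZMod T.N → ℤ} (hd : ∀ n, 0 ≤ d n) :
    ∏ n, T.rowFactor r n ^ (d n).toNat = T.pairTau r ^ (-(d (r.1 - 1) + d (r.1 + 1))) := by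
  have h0 : T.rowFactor r (r.1 - 1) = (T.pairTau r)⁻¹ := if_pos ⟨h, Or.inl rfl⟩
  have h1 : T.rowFactor r (r.1 + 1) = (T.pairTau r)⁻¹ := if_pos ⟨h, Or.inr rfl⟩
  rw [Fintype.prod_eq_mul (r.1 - 1) (r.1 + 1) (T.add_one_ne_sub_one r.1).symm fun n hn => by
    rw [rowFactor, if_neg (fun h' => not_or.2 hn h'.2), one_pow], h0, h1, ← zpow_natCast,
    ← zpow_natCast, Int.toNat_of_nonneg (hd _), Int.toNat_of_nonneg (hd _),
    ← zpow_add₀ (inv_ne_zero (T.pairTau_ne_zero r)), inv_zpow, zpow_neg]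

/-- The value which a `τ`-function must take on `Λ` if the defining polynomial is `f`. -/
def tauValue (Λ : T.NS) (f : MvPolynomial T.Coord T.K) : T.L :=
  MvPolynomial.aeval T.zeta f / T.multTau Λ

/-- With D = d_{n-1} + d_{n+1}, the product τ_n^1 τ_n^{-1} gets the exponent -D from the coordinates
and +a+b from the τ-powers, matching the change D - a - b of both multiplicities. The forms
themselves cancel against those split off from f. -/
theorem sL_tauValue (r : T.Root) (Λ : T.NS) {f g : MvPolynomial T.Coord T.K}
    (hf : f ∈ T.linearSystem Λ)
    (h : T.denom T.mono r Λ * g = T.numer T.mono r Λ * T.subK r f) :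
    T.sL r (T.tauValue Λ f) = T.tauValue (T.s r Λ) g := by
  by_cases hf0 : f = 0
  · rw [hf0, map_zero, mul_zero] at h
    have hg := (mul_eq_zero.1 h).resolve_left (T.denom_ne_zero r Λ)
    rw [hf0, hg, tauValue, tauValue, map_zero, zero_div, zero_div, map_zero]
  have hd := ((T.mem_linearSystem Λ f).1 hf).1
  rw [tauValue, tauValue, map_div₀, T.sL_aeval_zeta r hd]
  by_cases h0 : (r.2 : ℤ) = 0
  swap
  · rw [denom, numer, if_neg h0, if_neg h0, one_mul, one_mul] at h
    rw [h, T.sL_multTau_of_ne_zero h0, Finset.prod_eq_one, one_mul]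
    intro n _
    rw [rowFactor, if_neg (fun h' => h0 h'.1), one_pow]
  rw [T.prod_rowFactor h0 (hd.nonneg hf0), T.sL_multTau_of_eq_zero h0, T.multTau_s_of_eq_zero h0,
    gain_near, gain_far]
  have h := congrArg (MvPolynomial.aeval T.zeta) h
  rw [denom, numer, if_pos h0, if_pos h0] at h
  simp only [map_mul, map_pow, ← T.Fu_eq h0, ← T.Fv_eq h0, ← zpow_natCast] at h
  have hp := T.pairTau_ne_zero r
  have hu := T.Fu_ne_zero r.1
  have hv := T.Fv_ne_zero r.1
  have hm := T.multTau_ne_zero Λ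
  set a := T.mult Λ (T.near r)
  set b := T.mult Λ (T.far r)
  set D := T.deg Λ (r.1 - 1) + T.deg Λ (r.1 + 1)
  set G := MvPolynomial.aeval T.zeta g
  set S := MvPolynomial.aeval T.zeta (T.subK r f)
  set U := T.Fu r.1
  set V := T.Fv r.1
  set p := T.pairTau r
  set m := T.multTau Λ
  -- In the field L the separate powers for positive and negative multiplicities merge into integer
  -- powers.
  have h' : S = U ^ b * V ^ a * G := by
    have ea : a = (a.toNat : ℤ) - ((-a).toNat : ℤ) := (Int.toNat_sub_toNat_neg a).symm
    have eb : b = (b.toNat : ℤ) - ((-b).toNat : ℤ) := (Int.toNat_sub_toNat_neg b).symm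
    rw [ea, eb, zpow_sub₀ hu, zpow_sub₀ hv]
    have h1 := zpow_ne_zero ((-a).toNat : ℤ) hv
    have h2 := zpow_ne_zero ((-b).toNat : ℤ) hu
    field_simp
    linear_combination -h
  have e1 : p ^ (D - a - b) = p ^ D * (p ^ a)⁻¹ * (p ^ b)⁻¹ := by
    rw [zpow_sub₀ hp, zpow_sub₀ hp, div_eq_mul_inv, div_eq_mul_inv]
  rw [h', e1, zpow_neg, mul_zpow, mul_zpow, inv_zpow, inv_zpow]
  have k1 := zpow_ne_zero D hp
  have k2 := zpow_ne_zero a hp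
  have k3 := zpow_ne_zero b hp
  have k4 := zpow_ne_zero b hu
  have k5 := zpow_ne_zero a hv
  field_simp

/-- `P` is an integral form of a normalized section belonging to `Λ`. -/
structure IsNormalizedSection (Λ : T.NS) (P : MvPolynomial T.Coord (T.Puiseux ℤ)) : Prop where
  mem : MvPolynomial.map T.puiseuxToK P ∈ T.linearSystem Λ
  corners : T.HasMonicCorners P
  balanced : T.IsBalanced P

variable {T}

theorem IsNormalizedSection.ne_zero {Λ : T.NS} {P : MvPolynomial T.Coord (T.Puiseux ℤ)}
    (h : T.IsNormalizedSection Λ P) : MvPolynomial.map T.puiseuxToK P ≠ 0 := by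
  intro h0
  have hP : P = 0 := T.map_puiseuxToK_injective (by rw [h0, map_zero])
  obtain ⟨x, hx⟩ := h.corners 0
  rw [hP, map_zero] at hx
  have := congrArg T.puiseuxToK hx
  rw [map_zero, puiseuxToK_monoZ] at this
  exact T.mono_ne_zero x this.symm

variable (T)

theorem isNormalizedSection_E (c : T.Center) : T.IsNormalizedSection (T.E c.1 c.2) 1 :=
  ⟨by rw [map_one]; exact T.one_mem_linearSystem_E c, HasMonicCorners.one, IsBalanced.one⟩

theorem tauValue_E (c : T.Center) : T.tauValue (T.E c.1 c.2) 1 = T.tauVar c := by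
  rw [tauValue, map_one, multTau, Fintype.prod_eq_single c]
  · rw [mult_E, if_pos rfl, zpow_neg_one, one_div, inv_inv]
  · intro x hx
    rw [mult_E, if_neg hx, zpow_zero]


/-! ### Normalized sections on the orbit -/

section Orbit

variable {T}
variable (hT : ∀ n : ZMod T.N, T.k (n - 1) * T.k (n + 1) = T.ℓ (n - 1) * T.ℓ (n + 1))
include hT

/-- The integral form of the quotient satisfies the same division identity, so monic corners and
balance follow from those of the other three factors. -/
theorem exists_isNormalizedSection_s (r : T.Root) {Λ : T.NS}
    {P : MvPolynomial T.Coord (T.Puiseux ℤ)} (hP : T.IsNormalizedSection Λ P) :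
    ∃ Q, T.IsNormalizedSection (T.s r Λ) Q ∧
      T.sL r (T.tauValue Λ (MvPolynomial.map T.puiseuxToK P)) =
        T.tauValue (T.s r Λ) (MvPolynomial.map T.puiseuxToK Q) := by
  obtain ⟨g, hg, h⟩ := T.exists_transform hT r Λ hP.mem
  have hden : MvPolynomial.map T.puiseuxToK (T.denom T.monoZ r Λ) = T.denom T.mono r Λ := by
    rw [map_denom, puiseuxToK_comp_monoZ]
  have hnum : MvPolynomial.map T.puiseuxToK (T.numer T.monoZ r Λ) = T.numer T.mono r Λ := by
    rw [map_numer, puiseuxToK_comp_monoZ]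
  obtain ⟨Q, rfl⟩ := T.exists_map_eq_of_denom_mul r Λ (g := g)
    ⟨T.numer T.monoZ r Λ * T.subZ r P, by rw [map_mul, hnum, map_subZ, h]⟩
  have hQ : T.denom T.monoZ r Λ * Q = T.numer T.monoZ r Λ * T.subZ r P := by
    refine T.map_puiseuxToK_injective ?_
    rw [map_mul, map_mul, hden, hnum, map_subZ, h]
  have hd : T.IsMultihomogeneous (T.deg Λ) P := IsMultihomogeneous.of_map T.puiseuxToK_injective
    ((T.mem_linearSystem Λ _).1 hP.mem).1
  refine ⟨Q, ⟨hg, ?_, ?_⟩, T.sL_tauValue r Λ hP.mem h⟩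
  · refine (hasMonicCorners_denom r Λ).of_mul ?_
    rw [hQ]
    exact (hasMonicCorners_numer r Λ).mul (hP.corners.subZ hd r)
  · refine (isBalanced_denom r Λ).of_mul ?_
    rw [hQ]
    exact (isBalanced_numer r Λ).mul (hP.balanced.subZ hd r)

theorem exists_isNormalizedSection {Λ : T.NS} (h : Λ ∈ T.M) :
    ∃ P, T.IsNormalizedSection Λ P := by
  obtain ⟨w, hw, c, rfl⟩ := h
  exact T.weyl_induction (Q := fun Λ => ∃ P, T.IsNormalizedSection Λ P)
    (fun r Λ ⟨P, hP⟩ => (exists_isNormalizedSection_s hT r hP).imp fun _ h => h.1) hw _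
    ⟨1, T.isNormalizedSection_E c⟩

theorem exists_eq_smul {Λ : T.NS} (h : Λ ∈ T.M) {f g : MvPolynomial T.Coord T.K}
    (hf : f ∈ T.linearSystem Λ) (hf0 : f ≠ 0) (hg : g ∈ T.linearSystem Λ) :
    ∃ a : T.K, g = a • f := by
  obtain ⟨f₀, _, _, h1⟩ := T.isRigid_of_mem hT h
  obtain ⟨a, rfl⟩ := h1 f hf
  obtain ⟨b, rfl⟩ := h1 g hg
  have ha : a ≠ 0 := by
    rintro rfl
    exact hf0 (zero_smul _ _)
  exact ⟨b * a⁻¹, by rw [smul_smul, inv_mul_cancel_right₀ ha]⟩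

theorem IsNormalizedSection.unique {Λ : T.NS} (h : Λ ∈ T.M)
    {P Q : MvPolynomial T.Coord (T.Puiseux ℤ)} (hP : T.IsNormalizedSection Λ P)
    (hQ : T.IsNormalizedSection Λ Q) : Q = P := by
  obtain ⟨a, ha⟩ := exists_eq_smul hT h hP.mem hP.ne_zero hQ.mem
  exact eq_of_eq_smul hP.corners hQ.corners hP.balanced hQ.balanced.weightedExponent_eq_zero ha

/-- For Φ the normalization supplies only a vanishing weighted exponent; balance of the reference
section suffices to determine the scalar. -/
theorem isNormalizedDefiningPolynomial_iff {Λ : T.NS} (h : Λ ∈ T.M)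
    {P : MvPolynomial T.Coord (T.Puiseux ℤ)} (hP : T.IsNormalizedSection Λ P)
    (Φ : MvPolynomial T.Coord T.K) :
    T.IsNormalizedDefiningPolynomial Λ Φ ↔ Φ = MvPolynomial.map T.puiseuxToK P := by
  constructor
  · rintro ⟨h1, h2⟩
    have hd := ((T.mem_linearSystem Λ _).1 h1.mem_linearSystem).1
    obtain ⟨Q, rfl, hc, hw⟩ := (isNormalized_iff hd).1 h2
    obtain ⟨a, ha⟩ := exists_eq_smul hT h hP.mem hP.ne_zero h1.mem_linearSystem
    rw [eq_of_eq_smul hP.corners hc hP.balanced hw ha]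
  · rintro rfl
    refine ⟨T.isDefiningPolynomial hT h hP.mem hP.ne_zero, ?_⟩
    exact (isNormalized_iff ((T.mem_linearSystem Λ _).1 hP.mem).1).2
      ⟨P, rfl, hP.corners, hP.balanced.weightedExponent_eq_zero⟩

end Orbit

end TropicalDatum
end

noncomputable section
namespace TropicalDatum
variable {T : TropicalDatum}

/-! ### The action of the Weyl group -/

/-- Ring homomorphisms out of `L` agree if they agree on terms `c a^x` and on the `τ`-variables. -/
theorem ringHom_L_ext {S : Type*} [CommRing S] {f g : T.L →+* S}
    (h : ∀ x c, f (T.const (algebraMap (T.Puiseux ℂ) T.K (AddMonoidAlgebra.single x c))) =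
      g (T.const (algebraMap (T.Puiseux ℂ) T.K (AddMonoidAlgebra.single x c))))
    (h' : ∀ c, f (T.tauVar c) = g (T.tauVar c)) : f = g := by
  refine IsLocalization.ringHom_ext (nonZeroDivisors (MvPolynomial T.Center T.K)) ?_
  refine MvPolynomial.ringHom_ext (fun a => ?_) h'
  exact RingHom.congr_fun (T.ringHom_K_ext (f := f.comp T.const) (g := g.comp T.const) h) a

/-- The element `∑ z_t α_t` of the root lattice. -/
def rootSum (z : T.Root → ℤ) : T.NS := ∑ t, z t • T.α t

theorem rootSum_single (r : T.Root) (a : ℤ) : rootSum (Pi.single r a) = a • T.α r := by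
  rw [rootSum, Fintype.sum_eq_single r fun t ht => by rw [Pi.single_eq_of_ne ht, zero_smul],
    Pi.single_eq_same]

theorem rootSum_injective : Function.Injective (rootSum (T := T)) := by
  have key : ∀ z : T.Root → ℤ, rootSum z = 0 → z = 0 := by
    intro z hz
    have h0 : (fun t => (z t : ℚ)) = 0 := by
      refine T.eq_zero_of_extend_slope (fun n => ?_) fun c => ?_
      · rw [← sum_mul_α_fst]
        have := congrFun (congrArg Prod.fst hz) n
        simp only [rootSum, Prod.fst_sum, Finset.sum_apply, Prod.smul_fst, Pi.smul_apply,
          smul_eq_mul, Prod.fst_zero, Pi.zero_apply] at this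
        exact_mod_cast this
      · rw [slope, ← sum_mul_α_snd]
        have := congrFun (congrArg Prod.snd hz) c
        simp only [rootSum, Prod.snd_sum, Finset.sum_apply, Prod.smul_snd, Pi.smul_apply,
          smul_eq_mul, Prod.snd_zero, Pi.zero_apply] at this
        exact_mod_cast this
    funext t
    exact Int.cast_eq_zero.1 (congrFun h0 t)
  intro z z' h
  refine sub_eq_zero.1 (key _ ?_)
  have : rootSum (z - z') = rootSum z - rootSum z' := by
    simp [rootSum, sub_smul]
  rw [this, h, sub_self]

theorem s_rootSum (r : T.Root) (z : T.Root → ℤ) : T.s r (rootSum z) =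
    rootSum (z + Pi.single r (∑ t, z t * T.pairing (T.coα r) (T.α t))) := by
  have : ∀ z z' : T.Root → ℤ, rootSum (z + z') = rootSum z + rootSum z' := by
    intro z z'
    simp [rootSum, add_smul, Finset.sum_add_distrib]
  rw [this, rootSum_single, s_apply]
  congr 2
  rw [rootSum, map_sum]
  exact Finset.sum_congr rfl fun t _ => by rw [map_zsmul, smul_eq_mul]

/-- `g` acts on terms in the root variables as `w` does on the root lattice. -/
def ActsOnConst (w : T.NS ≃ₗ[ℤ] T.NS) (g : RingAut T.L) : Prop :=
  ∃ e : (T.Root → ℚ) →+ (T.Root → ℚ),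
    (∀ x c, g (T.const (algebraMap (T.Puiseux ℂ) T.K (AddMonoidAlgebra.single x c))) =
      T.const (algebraMap (T.Puiseux ℂ) T.K (AddMonoidAlgebra.single (e x) c))) ∧
    ∀ z : T.Root → ℤ, ∃ z' : T.Root → ℤ, e (fun t => (z t : ℚ)) = (fun t => (z' t : ℚ)) ∧
      rootSum z' = w (rootSum z)

/-- `g` acts on values of normalized sections as `w` does on classes. -/
def ActsOnTauValues (w : T.NS ≃ₗ[ℤ] T.NS) (g : RingAut T.L) : Prop :=
  ∀ Λ P, T.IsNormalizedSection Λ P → ∃ Q, T.IsNormalizedSection (w Λ) Q ∧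
    g (T.tauValue Λ (MvPolynomial.map T.puiseuxToK P)) =
      T.tauValue (w Λ) (MvPolynomial.map T.puiseuxToK Q)

theorem ActsOnConst.mul {w w' : T.NS ≃ₗ[ℤ] T.NS} {g g' : RingAut T.L} (h : ActsOnConst w g)
    (h' : ActsOnConst w' g') : ActsOnConst (w * w') (g * g') := by
  obtain ⟨e, h1, h2⟩ := h
  obtain ⟨e', h1', h2'⟩ := h'
  refine ⟨e.comp e', fun x c => ?_, fun z => ?_⟩
  · rw [RingAut.mul_apply, h1', h1, AddMonoidHom.comp_apply]
  · obtain ⟨z', hz', hw'⟩ := h2' z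
    obtain ⟨z'', hz, hw⟩ := h2 z'
    refine ⟨z'', by rw [AddMonoidHom.comp_apply, hz', hz], ?_⟩
    rw [hw, hw', LinearEquiv.mul_apply]

theorem ActsOnTauValues.mul {w w' : T.NS ≃ₗ[ℤ] T.NS} {g g' : RingAut T.L}
    (h : ActsOnTauValues w g) (h' : ActsOnTauValues w' g') :
    ActsOnTauValues (w * w') (g * g') := by
  intro Λ P hP
  obtain ⟨Q, hQ, e⟩ := h' Λ P hP
  obtain ⟨R, hR, e'⟩ := h _ Q hQ
  exact ⟨R, hR, by rw [RingAut.mul_apply, e, e', LinearEquiv.mul_apply]⟩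

theorem actsOnConst_one : ActsOnConst (1 : T.NS ≃ₗ[ℤ] T.NS) 1 :=
  ⟨AddMonoidHom.id _, fun _ _ => rfl, fun z => ⟨z, rfl, rfl⟩⟩

theorem actsOnTauValues_one : ActsOnTauValues (1 : T.NS ≃ₗ[ℤ] T.NS) 1 :=
  fun _ P hP => ⟨P, hP, rfl⟩

theorem E_mem (c : T.Center) : T.E c.1 c.2 ∈ T.M := ⟨1, one_mem _, c, rfl⟩

theorem sW_inv (r : T.Root) : (T.sW r)⁻¹ = T.sW r := by
  refine inv_eq_of_mul_eq_one_left (Subtype.ext (LinearEquiv.ext fun Λ => ?_))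
  exact T.s_s r Λ

theorem lift_sW_surjective : Function.Surjective (FreeGroup.lift T.sW) := by
  rintro ⟨w, hw⟩
  induction hw using Subgroup.closure_induction with
  | mem x hx =>
    obtain ⟨r, rfl⟩ := hx
    exact ⟨FreeGroup.of r, FreeGroup.lift_apply_of⟩
  | one => exact ⟨1, map_one _⟩
  | mul x y _ _ hx hy =>
    obtain ⟨a, ha⟩ := hx
    obtain ⟨b, hb⟩ := hy
    exact ⟨a * b, by rw [map_mul, ha, hb]; rfl⟩
  | inv x _ hx =>
    obtain ⟨a, ha⟩ := hx
    exact ⟨a⁻¹, by rw [map_inv, ha]; rfl⟩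

/-! ### Existence of the action and of the τ-function -/

section Orbit

variable (hT : ∀ n : ZMod T.N, T.k (n - 1) * T.k (n + 1) = T.ℓ (n - 1) * T.ℓ (n + 1))
include hT

/-- Instead of computing with the exchange formulas: two reflections carry the normalized section of
E_n^i to a normalized section of the same class, which is unique. -/
theorem sL_sL (r : T.Root) (x : T.L) : T.sL r (T.sL r x) = x := by
  have : (T.sL r).comp (T.sL r) = RingHom.id _ := by
    refine ringHom_L_ext (fun x c => ?_) fun c => ?_
    · simp only [RingHom.comp_apply, sL_const, sK_sK, RingHom.id_apply]
    · obtain ⟨Q, hQ, e⟩ := exists_isNormalizedSection_s hT r (T.isNormalizedSection_E c)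
      obtain ⟨R, hR, e'⟩ := exists_isNormalizedSection_s hT r hQ
      rw [s_s] at hR e'
      rw [(T.isNormalizedSection_E c).unique hT (E_mem c) hR] at e'
      rw [map_one, tauValue_E] at e e'
      rw [RingHom.comp_apply, e, e', RingHom.id_apply]
  exact RingHom.congr_fun this x

/-- The simple reflections as automorphisms of `L`. -/
def sAut (r : T.Root) : RingAut T.L :=
  RingEquiv.ofRingHom (T.sL r) (T.sL r) (RingHom.ext (sL_sL hT r)) (RingHom.ext (sL_sL hT r))

theorem sAut_inv (r : T.Root) : (sAut hT r)⁻¹ = sAut hT r := rfl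

theorem actsOnConst_sAut (r : T.Root) : ActsOnConst (T.s r) (sAut hT r) := by
  refine ⟨(T.expAct r : (T.Root → ℚ) →+ (T.Root → ℚ)), fun x c => ?_, fun z =>
    ⟨_, ?_, (s_rootSum r z).symm⟩⟩
  · exact (T.sL_const r _).trans (by rw [sK_algebraMap_single]; rfl)
  · change T.expAct r _ = _
    rw [expAct_apply]
    funext t
    by_cases h : t = r
    · subst h
      simp
    · simp [h]

theorem actsOnTauValues_sAut (r : T.Root) : ActsOnTauValues (T.s r) (sAut hT r) :=
  fun _ _ hP => exists_isNormalizedSection_s hT r hP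

theorem acts_freeGroup (x : FreeGroup T.Root) :
    ActsOnConst (FreeGroup.lift T.sW x).1 (FreeGroup.lift (sAut hT) x) ∧
      ActsOnTauValues (FreeGroup.lift T.sW x).1 (FreeGroup.lift (sAut hT) x) := by
  induction x using FreeGroup.induction_on with
  | C1 => rw [map_one, map_one]; exact ⟨actsOnConst_one, actsOnTauValues_one⟩
  | of r =>
    rw [FreeGroup.lift_apply_of, FreeGroup.lift_apply_of]
    exact ⟨actsOnConst_sAut hT r, actsOnTauValues_sAut hT r⟩
  | inv_of r ih =>
    rw [map_inv, map_inv, FreeGroup.lift_apply_of, FreeGroup.lift_apply_of, sAut_inv, sW_inv]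
    exact ⟨actsOnConst_sAut hT r, actsOnTauValues_sAut hT r⟩
  | mul x y hx hy =>
    rw [map_mul, map_mul]
    exact ⟨hx.1.mul hy.1, hx.2.mul hy.2⟩

/-- The coefficients are fixed because the root lattice is faithful, and τ_n^i is fixed as the value
of the unique normalized section of E_n^i. -/
theorem eq_one_of_acts {g : RingAut T.L} (h : ActsOnConst (1 : T.NS ≃ₗ[ℤ] T.NS) g)
    (h' : ActsOnTauValues (1 : T.NS ≃ₗ[ℤ] T.NS) g) : g = 1 := by
  have : (g : T.L →+* T.L) = RingHom.id _ := by
    refine ringHom_L_ext (fun x c => ?_) fun c => ?_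
    · obtain ⟨e, h1, h2⟩ := h
      -- An additive map of ℚ-vector spaces is linear, so rational exponents are controlled by the
      -- integral basis vectors.
      have he : e.toRatLinearMap = LinearMap.id := by
        refine LinearMap.pi_ext' fun t => LinearMap.ext_ring ?_
        obtain ⟨z', hz, hw⟩ := h2 (Pi.single t 1)
        rw [rootSum_injective hw] at hz
        have hs : (fun u => ((Pi.single t 1 : T.Root → ℤ) u : ℚ)) = Pi.single t 1 := by
          funext u
          by_cases hu : u = t
          · subst hu; simp
          · simp [hu]
        rw [hs] at hz
        exact hz
      have hx : e x = x := LinearMap.congr_fun he x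
      exact (h1 x c).trans (by rw [hx]; rfl)
    · obtain ⟨Q, hQ, e⟩ := h' _ _ (T.isNormalizedSection_E c)
      change T.IsNormalizedSection (T.E c.1 c.2) Q at hQ
      rw [(T.isNormalizedSection_E c).unique hT (E_mem c) hQ] at e
      change _ = T.tauValue (T.E c.1 c.2) _ at e
      rw [map_one, tauValue_E] at e
      exact e
  exact RingEquiv.ext fun x => RingHom.congr_fun this x

/-- The action of the free group on the reflections descends because every word trivial in W acts
trivially on L; no presentation of W is needed. -/
theorem exists_isWeylAction : ∃ ρ : T.W →* RingAut T.L, T.IsWeylAction ρ := by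
  have hker : (FreeGroup.lift T.sW).ker ≤ (FreeGroup.lift (sAut hT)).ker := by
    intro x hx
    rw [MonoidHom.mem_ker] at hx ⊢
    have h := acts_freeGroup hT x
    rw [hx] at h
    exact eq_one_of_acts hT h.1 h.2
  refine ⟨(FreeGroup.lift T.sW).liftOfSurjective lift_sW_surjective
    ⟨FreeGroup.lift (sAut hT), hker⟩, fun r x => ?_⟩
  have := MonoidHom.liftOfRightInverse_comp_apply (FreeGroup.lift T.sW) _
    (Function.rightInverse_surjInv lift_sW_surjective) ⟨FreeGroup.lift (sAut hT), hker⟩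
    (FreeGroup.of r)
  rw [FreeGroup.lift_apply_of] at this
  rw [MonoidHom.liftOfSurjective, this]
  simp only [FreeGroup.lift_apply_of]
  rfl

theorem IsWeylAction.actsOnTauValues {ρ : T.W →* RingAut T.L} (hρ : T.IsWeylAction ρ) (w : T.W) :
    ActsOnTauValues w.1 (ρ w) := by
  obtain ⟨x, rfl⟩ := lift_sW_surjective w
  have e : ρ.comp (FreeGroup.lift T.sW) = FreeGroup.lift (sAut hT) := by
    refine FreeGroup.ext_hom _ _ fun r => ?_
    rw [MonoidHom.comp_apply, FreeGroup.lift_apply_of, FreeGroup.lift_apply_of]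
    exact RingEquiv.ext (hρ r)
  have h := (acts_freeGroup hT x).2
  rw [← e] at h
  exact h

theorem exists_isTauFunction {ρ : T.W →* RingAut T.L} (hρ : T.IsWeylAction ρ) :
    ∃ τ : T.M → T.L, T.IsTauFunction ρ τ := by
  choose P hP using fun Λ : T.M => exists_isNormalizedSection hT Λ.2
  refine ⟨fun Λ => T.tauValue Λ (MvPolynomial.map T.puiseuxToK (P Λ)), fun c Λ h => ?_,
    fun w Λ Λ' h => ?_⟩
  · have h1 := hP Λ
    have h2 := T.isNormalizedSection_E c
    rw [← h] at h2
    rw [h2.unique hT Λ.2 h1, map_one, h, tauValue_E]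
  · obtain ⟨Q, hQ, e⟩ := hρ.actsOnTauValues hT w Λ (P Λ) (hP Λ)
    rw [← h] at hQ e
    rw [e, (hP Λ').unique hT Λ'.2 hQ]

/-- Equivariance transports the values from the exceptional classes, so this holds for an arbitrary
τ-function and not only for the one constructed. -/
theorem IsTauFunction.eq_tauValue {ρ : T.W →* RingAut T.L} (hρ : T.IsWeylAction ρ)
    {τ : T.M → T.L} (hτ : T.IsTauFunction ρ τ) (Λ : T.M) :
    ∃ P, T.IsNormalizedSection Λ P ∧
      τ Λ = T.tauValue Λ (MvPolynomial.map T.puiseuxToK P) := by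
  obtain ⟨w, hw, c, h⟩ := Λ.2
  obtain ⟨Q, hQ, e⟩ := hρ.actsOnTauValues hT ⟨w, hw⟩ _ _ (T.isNormalizedSection_E c)
  rw [map_one, tauValue_E] at e
  dsimp only at hQ e
  rw [← h] at hQ e
  refine ⟨Q, hQ, ?_⟩
  rw [← e, hτ.equivariant ⟨w, hw⟩ ⟨T.E c.1 c.2, E_mem c⟩ Λ h, hτ.exceptional c _ rfl]

end Orbit

/-! ### The Laurent phenomenon -/

theorem tau_mem_laurent (n : ZMod T.N) (i : ℤ) : T.tau n i ∈ T.laurent := by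
  unfold tau
  split_ifs
  · exact Algebra.subset_adjoin (Or.inl ⟨_, rfl⟩)
  · exact one_mem _

theorem zeta_mem_laurent (z : T.Coord) : T.zeta z ∈ T.laurent := by
  have hξ : ∀ n, T.ξ n ∈ T.laurent := fun n => prod_mem fun _ _ => tau_mem_laurent _ _
  have hη : ∀ n, T.η n ∈ T.laurent := fun n => prod_mem fun _ _ => tau_mem_laurent _ _
  unfold zeta
  split_ifs
  · exact mul_mem (hξ _) (hη _)
  · exact mul_mem (hξ _) (hη _)

theorem tauVar_zpow_mem_laurent (c : T.Center) (a : ℤ) : T.tauVar c ^ a ∈ T.laurent := by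
  rcases Int.eq_nat_or_neg a with ⟨j, rfl | rfl⟩
  · rw [zpow_natCast]
    have h : T.tauVar c ∈ T.laurent := Algebra.subset_adjoin (Or.inl ⟨c, rfl⟩)
    exact pow_mem h j
  · rw [zpow_neg, zpow_natCast, ← inv_pow]
    have h : (T.tauVar c)⁻¹ ∈ T.laurent := Algebra.subset_adjoin (Or.inr ⟨c, rfl⟩)
    exact pow_mem h j

theorem tauValue_mem_laurent (Λ : T.NS) (f : MvPolynomial T.Coord T.K) :
    T.tauValue Λ f ∈ T.laurent := by
  rw [tauValue, div_eq_mul_inv]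
  refine mul_mem ?_ ?_
  · induction f using MvPolynomial.induction_on with
    | C a => rw [MvPolynomial.aeval_C]; exact T.laurent.algebraMap_mem a
    | add p q hp hq => rw [map_add]; exact add_mem hp hq
    | mul_X p z hp =>
      rw [map_mul, MvPolynomial.aeval_X]
      exact mul_mem hp (zeta_mem_laurent z)
  · rw [multTau, ← Finset.prod_inv_distrib]
    refine prod_mem fun c _ => ?_
    rw [← zpow_neg]
    exact tauVar_zpow_mem_laurent c _

end TropicalDatum
end

/-! ### The theorem -/

theorem theorem3p2 (T : TropicalDatum)
    (hT : ∀ n : ZMod T.N, T.k (n - 1) * T.k (n + 1) = T.ℓ (n - 1) * T.ℓ (n + 1)) :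
    (∃ (ρ : T.W →* RingAut T.L) (τ : T.M → T.L), T.IsWeylAction ρ ∧ T.IsTauFunction ρ τ) ∧
    ∀ (ρ : T.W →* RingAut T.L) (τ : T.M → T.L), T.IsWeylAction ρ → T.IsTauFunction ρ τ →
      ∀ Λ : T.M,
        Module.finrank T.K (T.linearSystem (Λ : T.NS)) = 1 ∧
        (∃! Φ, T.IsNormalizedDefiningPolynomial (Λ : T.NS) Φ) ∧
        (∀ Φ, T.IsNormalizedDefiningPolynomial (Λ : T.NS) Φ →
          τ Λ * ∏ c : T.Center, T.tauVar c ^ T.mult (Λ : T.NS) c =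
            MvPolynomial.aeval T.zeta Φ) ∧
        τ Λ ∈ T.laurent := by
  obtain ⟨ρ₀, hρ₀⟩ := TropicalDatum.exists_isWeylAction hT
  obtain ⟨τ₀, hτ₀⟩ := TropicalDatum.exists_isTauFunction hT hρ₀
  refine ⟨⟨ρ₀, τ₀, hρ₀, hτ₀⟩, fun ρ τ hρ hτ Λ => ?_⟩
  obtain ⟨P, hP, e⟩ := hτ.eq_tauValue hT hρ Λ
  have huniq := TropicalDatum.isNormalizedDefiningPolynomial_iff hT Λ.2 hP
  refine ⟨T.finrank_linearSystem hT Λ.2, ⟨_, (huniq _).2 rfl, fun Φ h => (huniq Φ).1 h⟩,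
    fun Φ h => ?_, ?_⟩
  · rw [e, (huniq Φ).1 h]
    exact div_mul_cancel₀ _ (T.multTau_ne_zero Λ)
  · rw [e]
    exact TropicalDatum.tauValue_mem_laurent _ _
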